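/- Let $L>0$, $\mathbb T=\mathbb R/L\mathbb Z$, $T_0>0$, $\Phi\in W^{2,\infty}(\mathbb T)$, $E=-\partial_x\Phi$, and $$\mathcal A u=\sqrt{T_0}\,\partial_x u-\frac{E}{2\sqrt{T_0}}\,u,\qquad \mathcal A^\star u=-\sqrt{T_0}\,\partial_x u-\frac{E}{2\sqrt{T_0}}\,u,$$ with $\mathcal B_0=\mathcal A$ and $\mathcal B_k=\mathcal A^\star$ for $k\ge1$. For a sequence $D=(D_k)_{k\in\mathbb N}$ of real functions on $\mathbb T$ put $\|D\|_{L^2}^2=\sum_{k}\|D_k\|_{L^2(\mathbb T)}^2$ and $\|\mathcal B D\|_{L^2}^2=\sum_k\|\mathcal B_kD_k\|^2_{L^2(\mathbb T)}$. There is a constant $C>0$ depending only on $\Phi$ and $T_0$ (and the torus $\mathbb T$) such that the following holds. Let $\overline\tau_0\in(0,\infty)$ and let $\tau:(0,\infty)\to(0,\infty)$ satisfy $\sup_{\varepsilon>0}\tau(\varepsilon)/\varepsilon\le\overline\tau_0$. Let $\varepsilon>0$, and let $D=(D_k)_{k\in\mathbb N}$ be the solution, with initial datum $D(0)$ satisfying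 $\|D(0)\|_{L^2}<\infty$, of $$\partial_t D_k+\frac1\varepsilon\left(\sqrt k\,\mathcal A D_{k-1}-\sqrt{k+1}\,\mathcal A^\star D_{k+1}\right)=-\frac{k}{\tau(\varepsilon)}D_k,\qquad k\in\mathbb N,\ t\ge0,$$ that is, $D$ is continuous from $[0,\infty)$ to the Hilbert space $\{\|D\|_{L^2}<\infty\}$ and the equations hold in the sense of distributions. Let $\rho_\infty=c_0e^{-\Phi/T_0}$, where $c_0>0$ is fixed by the conservation of mass, $\int_{\mathbb T}\rho_\infty\,dx=\int_{\mathbb T}D_0(0)\sqrt{\rho_\infty}\,dx$, let $D_\infty=(\sqrt{\rho_\infty},0,0,\dots)$, and let $\kappa=\dfrac1{C(\overline\tau_0^2+1)}$. Then: (i) for all $t\ge0$, $$\|D(t)-D_\infty\|_{L^2}\le\sqrt3\,\|D(0)-D_\infty\|_{L^2}\exp\left(-\frac{\tau(\varepsilon)}{\varepsilon^2}\kappa t\right);$$ (ii) if moreover $\|\mathcal B D(0)\|_{L^2}<\infty$, then for all $t\ge0$, $\|\mathcal B D(t)\|_{L^2}<\infty$ and $$\|\mathcal B D(t)\|_{L^2}\le\sqrt3\left(C(\overline\tau_0+1)\|D(0)-D_\infty\|_{L^2}+\|\mathcal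 B D(0)\|_{L^2}\right)\exp\left(-\frac{\tau(\varepsilon)}{\varepsilon^2}\kappa t\right).$$ -/

import Mathlib

open MeasureTheory Set
open scoped ContDiff

noncomputable section

namespace VFP

variable {L : ℝ} [Fact (0 < L)]

/-- Smooth functions on the one-dimensional torus `ℝ / Lℤ`. -/
def IsSmooth (φ : AddCircle L → ℝ) : Prop :=
  ContDiff ℝ ∞ (fun s : ℝ => φ (s : AddCircle L))

/-- The classical derivative of a function on the torus. -/
def circleDeriv (φ : AddCircle L → ℝ) (x : AddCircle L) : ℝ :=
  deriv (fun s : ℝ => φ (x + (s : AddCircle L))) 0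

/-- `w` is a weak (distributional) derivative of `u` on the torus. -/
structure HasWeakDeriv (u w : AddCircle L → ℝ) : Prop where
  integrable : Integrable u
  integrable_deriv : Integrable w
  integral_eq : ∀ φ : AddCircle L → ℝ, IsSmooth φ →
    ∫ x, u x * circleDeriv φ x = -∫ x, w x * φ x

open scoped Classical in
/-- The weak derivative of `u` (determined almost everywhere when it exists, `0` otherwise). -/
def weakDeriv (u : AddCircle L → ℝ) : AddCircle L → ℝ :=
  if h : ∃ w, HasWeakDeriv u w then h.choose else 0

/-- The Sobolev space `W^{2,∞}` of the torus. -/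
def MemW2Inf (u : AddCircle L → ℝ) : Prop :=
  MemLp u (⊤ : ENNReal) volume ∧ ∃ w₁ w₂ : AddCircle L → ℝ,
    MemLp w₁ (⊤ : ENNReal) volume ∧ MemLp w₂ (⊤ : ENNReal) volume ∧ HasWeakDeriv u w₁ ∧ HasWeakDeriv w₁ w₂

/-- The Sobolev space `H¹` of the torus. -/
def MemH1 (u : AddCircle L → ℝ) : Prop :=
  MemLp u 2 volume ∧ ∃ w : AddCircle L → ℝ, MemLp w 2 volume ∧ HasWeakDeriv u w

/-- The electric field `E = -∂ₓΦ`. -/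
def field (Φ : AddCircle L → ℝ) : AddCircle L → ℝ := fun x => -weakDeriv Φ x

/-- `𝓐 u = √T₀ ∂ₓu - E / (2 √T₀) u`. -/
def opA (Φ : AddCircle L → ℝ) (T₀ : ℝ) (u : AddCircle L → ℝ) : AddCircle L → ℝ :=
  fun x => √T₀ * weakDeriv u x - field Φ x / (2 * √T₀) * u x

/-- `𝓐⋆ u = -√T₀ ∂ₓu - E / (2 √T₀) u`. -/
def opAstar (Φ : AddCircle L → ℝ) (T₀ : ℝ) (u : AddCircle L → ℝ) : AddCircle L → ℝ :=
  fun x => -√T₀ * weakDeriv u x - field Φ x / (2 * √T₀) * u x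

/-- `𝓑₀ = 𝓐` and `𝓑ₖ = 𝓐⋆` for `k ≥ 1`. -/
def opB (Φ : AddCircle L → ℝ) (T₀ : ℝ) (k : ℕ) (u : AddCircle L → ℝ) : AddCircle L → ℝ :=
  if k = 0 then opA Φ T₀ u else opAstar Φ T₀ u

variable (L) in
/-- The sequences `D = (D_k)_{k ∈ ℕ}` in `L²(𝕋)` with `‖D‖² = ∑ₖ ‖D_k‖²_{L²(𝕋)} < ∞`,
normed by `‖D‖`. -/
abbrev State : Type := lp (fun _ : ℕ => Lp ℝ 2 (volume : Measure (AddCircle L))) 2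

/-- A representative of the `k`-th Hermite coefficient. -/
def coeff (D : State L) (k : ℕ) : AddCircle L → ℝ :=
  ((D : ∀ _ : ℕ, Lp ℝ 2 (volume : Measure (AddCircle L))) k : AddCircle L → ℝ)

/-- `‖𝓑 D‖_{L²} < ∞`. -/
def FiniteB (Φ : AddCircle L → ℝ) (T₀ : ℝ) (D : State L) : Prop :=
  (∀ k, MemH1 (coeff D k)) ∧ Summable fun k => ∫ x, (opB Φ T₀ k (coeff D k) x) ^ 2

/-- `‖𝓑 D‖_{L²}`, meaningful when `FiniteB Φ T₀ D` holds. -/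
def normB (Φ : AddCircle L → ℝ) (T₀ : ℝ) (D : State L) : ℝ :=
  √(∑' k, ∫ x, (opB Φ T₀ k (coeff D k) x) ^ 2)

/-- The equilibrium density `ρ_∞ = c₀ exp(-Φ / T₀)`. -/
def rhoInf (Φ : AddCircle L → ℝ) (T₀ c₀ : ℝ) : AddCircle L → ℝ :=
  fun x => c₀ * Real.exp (-Φ x / T₀)

theorem memLp_sqrt_rhoInf {Φ : AddCircle L → ℝ} (hΦ : MemW2Inf Φ) (T₀ c₀ : ℝ) :
    MemLp (fun x => √(rhoInf Φ T₀ c₀ x)) 2 (volume : Measure (AddCircle L)) := by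
  have h1 : AEStronglyMeasurable (fun x => √(rhoInf Φ T₀ c₀ x))
      (volume : Measure (AddCircle L)) := by
    have := hΦ.1.1.aemeasurable
    refine AEMeasurable.aestronglyMeasurable ?_
    unfold rhoInf
    fun_prop
  refine MemLp.of_bound h1
    (√(|c₀| * Real.exp ((eLpNorm Φ (⊤ : ENNReal) (volume : Measure (AddCircle L))).toReal / |T₀|))) ?_
  have h2 := ae_le_eLpNormEssSup (f := Φ) (μ := (volume : Measure (AddCircle L)))
  filter_upwards [h2] with x hx
  have hfin : eLpNormEssSup Φ (volume : Measure (AddCircle L)) ≠ (⊤ : ENNReal) := by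
    rw [← eLpNorm_exponent_top]; exact hΦ.1.2.ne
  have hx' : |Φ x| ≤ (eLpNorm Φ (⊤ : ENNReal) (volume : Measure (AddCircle L))).toReal := by
    rw [eLpNorm_exponent_top]
    simpa using ENNReal.toReal_mono hfin hx
  rw [Real.norm_of_nonneg (Real.sqrt_nonneg _)]
  apply Real.sqrt_le_sqrt
  unfold rhoInf
  have h3 : -Φ x / T₀ ≤ (eLpNorm Φ (⊤ : ENNReal) (volume : Measure (AddCircle L))).toReal / |T₀| := by
    calc -Φ x / T₀ ≤ |-Φ x / T₀| := le_abs_self _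
      _ = |Φ x| / |T₀| := by rw [abs_div, abs_neg]
      _ ≤ _ := by gcongr
  calc c₀ * Real.exp (-Φ x / T₀) ≤ |c₀| * Real.exp (-Φ x / T₀) := by
        gcongr; exact le_abs_self _
    _ ≤ _ := by gcongr

/-- The equilibrium `D_∞ = (√ρ_∞, 0, 0, …)`. -/
def equilibrium {Φ : AddCircle L → ℝ} (hΦ : MemW2Inf Φ) (T₀ c₀ : ℝ) : State L :=
  lp.single 2 0 ((memLp_sqrt_rhoInf hΦ T₀ c₀).toLp _)

/-- `D` is the solution with initial datum `D₀` of the Hermite system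
`∂ₜ D_k + (1/ε) (√k 𝓐 D_{k-1} - √(k+1) 𝓐⋆ D_{k+1}) = -(k/τ) D_k`, `k ∈ ℕ`:
`D` is continuous in time with values in `L²`, and each equation holds for all times `t ≥ 0`
in the sense of distributions on the torus (`𝓐` and `𝓐⋆` are formal adjoints of each other).
For `k = 0` the term with index `k - 1` has the factor `√0 = 0`. -/
structure IsSolution (Φ : AddCircle L → ℝ) (T₀ ε τ : ℝ) (D₀ : State L) (D : ℝ → State L) :
    Prop where
  initial : D 0 = D₀
  continuousOn : ContinuousOn D (Ici 0)
  equation : ∀ (k : ℕ) (φ : AddCircle L → ℝ), IsSmooth φ → ∀ t : ℝ, 0 ≤ t →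
    HasDerivWithinAt (fun s => ∫ x, coeff (D s) k x * φ x)
      (-(1 / ε) * (√(k : ℝ) * (∫ x, coeff (D t) (k - 1) x * opAstar Φ T₀ φ x)
          - √((k : ℝ) + 1) * (∫ x, coeff (D t) (k + 1) x * opA Φ T₀ φ x))
        - (k : ℝ) / τ * ∫ x, coeff (D t) k x * φ x)
      (Ici 0) t

end VFP

end

open scoped InnerProductSpace Topology
open Filter

set_option linter.unusedSectionVars false

namespace VFP

section LaxMilgram

variable {W : Type*} [NormedAddCommGroup W] [InnerProductSpace ℝ W] [CompleteSpace W]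

/-! This is a hypocoercivity argument. The relaxation term damps the components `k ≥ 1` at rate `k /
τ` but leaves the density `k = 0` undamped. The missing dissipation comes from adding a small
corrector `α ⟪D₁, G D₀⟫` to `‖D‖² / 2`, where `G` inverts `𝓐⋆` off the kernel of `𝓐`. Along the flow
`D₁` receives `-𝓐 D₀ / ε`, and `⟪𝓐 D₀, G D₀⟫ = ‖D₀‖²`, so the corrector dissipates `(α / ε) ‖D₀‖²`.
Conservation of mass places `D₀ - √ρ_∞` orthogonally to the kernel, where the weighted Poincaré
inequality bounds `G`. For an admissible `α` the modified entropy lies between `1/4` and `3/4` of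
`‖D‖²`; the ratio of these two numbers is the source of `√3`.

For derivatives, `z_k = 𝓑_k D_k` solves a hierarchy of the same shape with the two operators
exchanged, up to a source `[𝓐⋆, 𝓐] D_{k-1}` that appears only for `k ≥ 2`. The commutator is
multiplication by a multiple of `Φ''`, hence bounded. The corrector is now `α ⟪z₁, D₀⟫`, and adding
`γ` times the entropy of order zero absorbs the source into the damping of the components `k ≥ 1`.

A solution that is merely continuous into `L²` cannot be tested against itself. The estimates
(`dissipation_u`, `dissipation_z`) are therefore proved for a truncated, elliptically regularized
resolvent equation and become one-step inequalities for implicit Euler (`IsTruncated.entropy_le`,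
`IsTruncated.entropy_B_le`). Sublevel sets of the entropies are weakly closed, so the inequalities
pass to the true resolvent, which is identified by the uniqueness result
`eq_zero_of_weak_stationary`. Applying a resolvent to a weak solution makes it `C¹` in time;
implicit Euler converges to this smoothed solution, and removing the smoothing gives exponential
decay (`IsWeakSolution.sublevel_of_resolvent`).

All of this takes place in an abstract `DirichletPair`. The analysis on the torus serves to
construct one (`exists_dirichletPair`) and to match it with the concrete operators
(`exists_realizes`). -/

theorem exists_forall_eq_of_isCoercive {B : W →L[ℝ] W →L[ℝ] ℝ} (hB : IsCoercive B)
    (l : W →L[ℝ] ℝ) : ∃ u, ∀ w, B u w = l w := by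
  refine ⟨hB.continuousLinearEquivOfBilin.symm ((InnerProductSpace.toDual ℝ W).symm l), fun w => ?_⟩
  rw [← hB.continuousLinearEquivOfBilin_apply, ContinuousLinearEquiv.apply_symm_apply,
    InnerProductSpace.toDual_symm_apply]

end LaxMilgram

/-! ### Abstract adjoint pairs and uniqueness for the stationary system -/

/-- A densely defined operator `A` on a Hilbert space `H` with adjoint `As`, both closed with the
same domain (the Hilbert space `V`, embedded by `ι`), such that the commutator `As A - A As`
extends to a bounded operator, and with a Poincaré inequality off the vector `m` of the kernel
of `A`. -/
structure DirichletPair (H V : Type*) [NormedAddCommGroup H] [InnerProductSpace ℝ H]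
    [NormedAddCommGroup V] [InnerProductSpace ℝ V] where
  ι : V →L[ℝ] H
  A : V →L[ℝ] H
  As : V →L[ℝ] H
  c : H →L[ℝ] H
  m : V
  b : ℝ
  P : ℝ
  Cv : ℝ
  b_nonneg : 0 ≤ b
  P_nonneg : 0 ≤ P
  Cv_pos : 0 < Cv
  injective : Function.Injective ι
  dense : DenseRange ι
  adj : ∀ u v, ⟪A u, ι v⟫_ℝ = ⟪ι u, As v⟫_ℝ
  closed_A : ∀ w q, (∀ v, ⟪w, As v⟫_ℝ = ⟪q, ι v⟫_ℝ) → ∃ u, ι u = w ∧ A u = q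
  closed_As : ∀ w q, (∀ v, ⟪w, A v⟫_ℝ = ⟪q, ι v⟫_ℝ) → ∃ u, ι u = w ∧ As u = q
  comm : ∀ u v, ⟪A u, A v⟫_ℝ - ⟪As u, As v⟫_ℝ = ⟪c (ι u), ι v⟫_ℝ
  norm_sq_le_A : ∀ v, ‖v‖ ^ 2 ≤ Cv * (‖ι v‖ ^ 2 + ‖A v‖ ^ 2)
  norm_sq_le_As : ∀ v, ‖v‖ ^ 2 ≤ Cv * (‖ι v‖ ^ 2 + ‖As v‖ ^ 2)
  norm_A_le : ∀ v, ‖A v‖ ≤ ‖As v‖ + b * ‖ι v‖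
  A_m : A m = 0
  norm_m : ‖ι m‖ = 1
  poincare : ∀ v, ⟪ι v, ι m⟫_ℝ = 0 → ‖ι v‖ ≤ P * ‖A v‖

namespace DirichletPair

variable {H V : Type*} [NormedAddCommGroup H] [InnerProductSpace ℝ H]
    [NormedAddCommGroup V] [InnerProductSpace ℝ V] (S : DirichletPair H V)

theorem adj' (u v : V) : ⟪S.As u, S.ι v⟫_ℝ = ⟪S.ι u, S.A v⟫_ℝ := by
  rw [real_inner_comm, ← S.adj, real_inner_comm]

theorem inner_As_m (v : V) : ⟪S.As v, S.ι S.m⟫_ℝ = 0 := by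
  rw [S.adj', S.A_m, inner_zero_right]

theorem isCoercive_add_A {l : ℝ} (hl : 0 < l) :
    IsCoercive (l • (innerSL ℝ).bilinearComp S.ι S.ι + (innerSL ℝ).bilinearComp S.A S.A) := by
  refine ⟨min l 1 / S.Cv, div_pos (lt_min hl one_pos) S.Cv_pos, fun u => ?_⟩
  have h := S.norm_sq_le_A u
  have h1 : min l 1 * (‖S.ι u‖ ^ 2 + ‖S.A u‖ ^ 2) ≤ l * ‖S.ι u‖ ^ 2 + ‖S.A u‖ ^ 2 := by
    nlinarith [min_le_left l 1, min_le_right l 1, sq_nonneg ‖S.ι u‖, sq_nonneg ‖S.A u‖]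
  simp only [add_apply, smul_apply,
    ContinuousLinearMap.bilinearComp_apply, innerSL_apply_apply, real_inner_self_eq_norm_sq,
    smul_eq_mul]
  refine le_trans ?_ h1
  have h2 : 0 < min l 1 := lt_min hl one_pos
  rw [div_mul_eq_mul_div, div_mul_eq_mul_div, div_le_iff₀ S.Cv_pos]
  nlinarith

/-- The equation `l v + As (A v) = f` is solvable. -/
theorem exists_resolvent [CompleteSpace V] {l : ℝ} (hl : 0 < l) (f : H) :
    ∃ v z : V, S.ι z = S.A v ∧ l • S.ι v + S.As z = f := by
  obtain ⟨v, hv⟩ := exists_forall_eq_of_isCoercive (S.isCoercive_add_A hl)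
    ((innerSL ℝ f).comp S.ι)
  obtain ⟨z, hz, hz'⟩ := S.closed_As (S.A v) (f - l • S.ι v) fun w => by
    have := hv w
    simp only [add_apply, smul_apply,
      ContinuousLinearMap.bilinearComp_apply, innerSL_apply_apply,
      smul_eq_mul, ContinuousLinearMap.comp_apply] at this
    rw [inner_sub_left, inner_smul_left, ← this]
    simp
  exact ⟨v, z, hz, by rw [hz']; abel⟩

/-- Uniqueness for the stationary weak Hermite system. -/
theorem eq_zero_of_weak_stationary [CompleteSpace V] {a s : ℝ} (ha : 0 ≤ a)
    (hs : |s| * (1 + ‖S.c‖) < 1) (g : ℕ → H) (hg : Tendsto (fun k => ‖g k‖) atTop (𝓝 0))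
    (heq : ∀ (k : ℕ) (v : V), (1 + a * k) * ⟪g k, S.ι v⟫_ℝ
      + s * (√(k : ℝ) * ⟪g (k - 1), S.As v⟫_ℝ - √((k : ℝ) + 1) * ⟪g (k + 1), S.A v⟫_ℝ) = 0) :
    ∀ k, g k = 0 := by
  -- `g k` lies only in `H` and is not an admissible test vector. The test vector is `(1 + k + As
  -- A)⁻¹ (g k)` instead; the diagonal pairing is then `e k`, the square of a negative-order norm.
  have hJ : ∀ k : ℕ, ∃ v z : V, S.ι z = S.A v ∧ (1 + k : ℝ) • S.ι v + S.As z = g k :=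
    fun k => S.exists_resolvent (by positivity) (g k)
  choose v z hz hv using hJ
  set e : ℕ → ℝ := fun k => (1 + k) * ‖S.ι (v k)‖ ^ 2 + ‖S.A (v k)‖ ^ 2 with he
  have he0 : ∀ k, 0 ≤ e k := fun k => by positivity
  have hgv : ∀ k, ⟪g k, S.ι (v k)⟫_ℝ = e k := fun k => by
    rw [← hv k, inner_add_left, inner_smul_left, S.adj', hz, real_inner_self_eq_norm_sq,
      real_inner_self_eq_norm_sq]
    simp [he]
  -- The weight `1 + k` in the test operator is what pays for `√(k + 1)` here; this bound makes the
  -- boundary term of the truncated sum vanish in the limit.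
  have hA : ∀ k : ℕ, √((k : ℝ) + 1) * ‖S.A (v k)‖ ≤ ‖g k‖ := fun k => by
    have h1 : e k ≤ ‖g k‖ * ‖S.ι (v k)‖ := (hgv k).symm.le.trans (real_inner_le_norm _ _)
    have h2 : (√((k : ℝ) + 1)) ^ 2 = k + 1 := Real.sq_sqrt (by positivity)
    apply le_of_sq_le_sq _ (norm_nonneg _)
    rw [mul_pow, h2]
    have h3 : (k + 1 : ℝ) * e k ≤ (k + 1 : ℝ) * (‖g k‖ * ‖S.ι (v k)‖) := by gcongr
    simp only [he] at h3
    nlinarith [sq_nonneg ((k + 1) * ‖S.ι (v k)‖ - ‖g k‖ / 2), sq_nonneg ‖g k‖]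
  set p : ℕ → ℝ := fun k => √(k : ℝ) * ⟪g (k - 1), S.As (v k)⟫_ℝ with hp
  set q : ℕ → ℝ := fun k => √((k : ℝ) + 1) * ⟪g (k + 1), S.A (v k)⟫_ℝ with hq
  -- The two transport terms between neighbouring levels almost cancel. What remains is the unit
  -- difference of the weights `1 + k` and `2 + k`, together with the commutator `c`; both are of
  -- order zero in `A (v k)`.
  have hpq : ∀ k, |p (k + 1) - q k| ≤ (1 + ‖S.c‖) / 2 * (e k + e (k + 1)) := fun k => by
    have h1 : ⟪g k, S.As (v (k + 1))⟫_ℝ - ⟪g (k + 1), S.A (v k)⟫_ℝ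
        = -⟪S.A (v k) + S.c (S.A (v k)), S.ι (v (k + 1))⟫_ℝ := by
      have h2 := S.comm (z k) (v (k + 1))
      rw [hz] at h2
      have h3 : ⟪S.ι (v k), S.As (v (k + 1))⟫_ℝ = ⟪S.A (v k), S.ι (v (k + 1))⟫_ℝ := (S.adj _ _).symm
      have h4 : ⟪S.As (z (k + 1)), S.A (v k)⟫_ℝ = ⟪S.A (z k), S.A (v (k + 1))⟫_ℝ := by
        rw [← hz k, S.adj', ← hz (k + 1), real_inner_comm]
      have h5 : ⟪S.ι (v (k + 1)), S.A (v k)⟫_ℝ = ⟪S.A (v k), S.ι (v (k + 1))⟫_ℝ :=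
        real_inner_comm _ _
      rw [← hv k, ← hv (k + 1)]
      simp only [inner_add_left, inner_smul_left, h3, h4, h5, RCLike.conj_to_real]
      push_cast
      linarith
    have h2 : p (k + 1) - q k = √((k : ℝ) + 1) *
        (⟪g k, S.As (v (k + 1))⟫_ℝ - ⟪g (k + 1), S.A (v k)⟫_ℝ) := by
      simp only [hp, hq, Nat.add_sub_cancel]
      push_cast
      ring
    rw [h2, h1, abs_mul, abs_neg, abs_of_nonneg (Real.sqrt_nonneg _)]
    have h3 : |⟪S.A (v k) + S.c (S.A (v k)), S.ι (v (k + 1))⟫_ℝ| ≤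
        (1 + ‖S.c‖) * ‖S.A (v k)‖ * ‖S.ι (v (k + 1))‖ := by
      refine (abs_real_inner_le_norm _ _).trans ?_
      gcongr
      refine (norm_add_le _ _).trans ?_
      have := S.c.le_opNorm (S.A (v k))
      linarith
    have h4 : (√((k : ℝ) + 1)) ^ 2 = k + 1 := Real.sq_sqrt (by positivity)
    have h5 : √((k : ℝ) + 1) * ‖S.A (v k)‖ * ‖S.ι (v (k + 1))‖ ≤ (e k + e (k + 1)) / 2 := by
      have h6 : (k + 1 : ℝ) * ‖S.ι (v (k + 1))‖ ^ 2 ≤ e (k + 1) := by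
        simp only [he]; push_cast
        nlinarith [sq_nonneg ‖S.ι (v (k + 1))‖, sq_nonneg ‖S.A (v (k + 1))‖]
      have h7 : ‖S.A (v k)‖ ^ 2 ≤ e k := by
        simp only [he]
        have : 0 ≤ (1 + k : ℝ) * ‖S.ι (v k)‖ ^ 2 := by positivity
        linarith
      nlinarith [sq_nonneg (√((k : ℝ) + 1) * ‖S.ι (v (k + 1))‖ - ‖S.A (v k)‖)]
    calc √((k : ℝ) + 1) * |⟪S.A (v k) + S.c (S.A (v k)), S.ι (v (k + 1))⟫_ℝ|
        ≤ √((k : ℝ) + 1) * ((1 + ‖S.c‖) * ‖S.A (v k)‖ * ‖S.ι (v (k + 1))‖) := by gcongr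
      _ = (1 + ‖S.c‖) * (√((k : ℝ) + 1) * ‖S.A (v k)‖ * ‖S.ι (v (k + 1))‖) := by ring
      _ ≤ (1 + ‖S.c‖) * ((e k + e (k + 1)) / 2) := by gcongr
      _ = _ := by ring
  have hsum : ∀ K : ℕ, ∑ k ∈ Finset.range (K + 1), (1 + a * k) * e k
      = -s * ((∑ k ∈ Finset.range K, (p (k + 1) - q k)) - q K) := fun K => by
    have h1 : ∀ k, (1 + a * k) * e k = -s * (p k - q k) := fun k => by
      have := heq k (v k)
      rw [hgv] at this
      simp only [hp, hq]
      linarith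
    simp only [h1, ← Finset.mul_sum]
    congr 1
    rw [Finset.sum_sub_distrib, Finset.sum_sub_distrib, Finset.sum_range_succ' p,
      Finset.sum_range_succ q]
    simp only [hp]
    simp
    ring
  set θ := |s| * (1 + ‖S.c‖) with hθ
  have hE : ∀ K : ℕ, (1 - θ) * ∑ k ∈ Finset.range (K + 1), e k ≤ |s| * (‖g K‖ * ‖g (K + 1)‖) :=
    fun K => by
    have h1 : ∑ k ∈ Finset.range (K + 1), e k ≤ ∑ k ∈ Finset.range (K + 1), (1 + a * k) * e k := by
      refine Finset.sum_le_sum fun k _ => ?_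
      have : 0 ≤ a * k * e k := by have := he0 k; positivity
      linarith
    have h2 : |∑ k ∈ Finset.range K, (p (k + 1) - q k)| ≤
        (1 + ‖S.c‖) * ∑ k ∈ Finset.range (K + 1), e k := by
      refine (Finset.abs_sum_le_sum_abs _ _).trans ((Finset.sum_le_sum fun k _ => hpq k).trans ?_)
      rw [← Finset.mul_sum, Finset.sum_add_distrib]
      have h3 : ∑ k ∈ Finset.range K, e k ≤ ∑ k ∈ Finset.range (K + 1), e k := by
        rw [Finset.sum_range_succ]; linarith [he0 K]
      have h4 : ∑ k ∈ Finset.range K, e (k + 1) ≤ ∑ k ∈ Finset.range (K + 1), e k := by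
        rw [Finset.sum_range_succ']; linarith [he0 0]
      have h5 : 0 ≤ 1 + ‖S.c‖ := by positivity
      nlinarith
    have h3 : |q K| ≤ ‖g K‖ * ‖g (K + 1)‖ := by
      simp only [hq]
      rw [abs_mul, abs_of_nonneg (Real.sqrt_nonneg _)]
      calc √((K : ℝ) + 1) * |⟪g (K + 1), S.A (v K)⟫_ℝ|
          ≤ √((K : ℝ) + 1) * (‖g (K + 1)‖ * ‖S.A (v K)‖) := by
            gcongr; exact abs_real_inner_le_norm _ _
        _ = (√((K : ℝ) + 1) * ‖S.A (v K)‖) * ‖g (K + 1)‖ := by ring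
        _ ≤ _ := by gcongr; exact hA K
    have h4 : -s * ((∑ k ∈ Finset.range K, (p (k + 1) - q k)) - q K) ≤
        |s| * ((1 + ‖S.c‖) * ∑ k ∈ Finset.range (K + 1), e k + ‖g K‖ * ‖g (K + 1)‖) := by
      refine (le_abs_self _).trans ?_
      rw [abs_mul, abs_neg]
      gcongr
      exact (abs_sub _ _).trans (add_le_add h2 h3)
    have := hsum K
    rw [hθ]
    nlinarith
  have hlim : Tendsto (fun K => |s| * (‖g K‖ * ‖g (K + 1)‖)) atTop (𝓝 0) := by
    have := (hg.mul (hg.comp (tendsto_add_atTop_nat 1))).const_mul |s|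
    simpa using this
  intro j
  have hj : e j ≤ 0 := by
    have h1 : (1 - θ) * e j ≤ 0 := by
      refine ge_of_tendsto hlim ?_
      filter_upwards [eventually_ge_atTop j] with K hK
      refine le_trans ?_ (hE K)
      have : 0 ≤ 1 - θ := by linarith
      gcongr
      exact Finset.single_le_sum (f := e) (fun k _ => he0 k) (Finset.mem_range.2 (by omega))
    by_contra hcon
    push Not at hcon
    have : 0 < (1 - θ) * e j := mul_pos (by linarith) hcon
    linarith
  have h2 : ‖S.ι (v j)‖ ^ 2 ≤ 0 := by
    simp only [he] at hj
    nlinarith [sq_nonneg ‖S.ι (v j)‖, sq_nonneg ‖S.A (v j)‖,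
      mul_nonneg (Nat.cast_nonneg (α := ℝ) j) (sq_nonneg ‖S.ι (v j)‖)]
  have h3 : ‖S.A (v j)‖ ^ 2 ≤ 0 := by
    simp only [he] at hj
    nlinarith [sq_nonneg ‖S.ι (v j)‖, sq_nonneg ‖S.A (v j)‖,
      mul_nonneg (Nat.cast_nonneg (α := ℝ) j) (sq_nonneg ‖S.ι (v j)‖)]
  have h2' : S.ι (v j) = 0 := by simpa using le_antisymm h2 (sq_nonneg _)
  have h3' : S.A (v j) = 0 := by simpa using le_antisymm h3 (sq_nonneg _)
  have h4 : z j = 0 := S.injective (by rw [hz, h3', map_zero])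
  rw [← hv j, h2', h4]
  simp

end DirichletPair

/-! ### Galerkin truncation with elliptic regularization -/

namespace DirichletPair

variable {H V : Type*} [NormedAddCommGroup H] [InnerProductSpace ℝ H]
    [NormedAddCommGroup V] [InnerProductSpace ℝ V] (S : DirichletPair H V)

/-- The operator `A` for `k = 0` and `As` for `k ≥ 1`. -/
noncomputable def B (k : ℕ) : V →L[ℝ] H := if k = 0 then S.A else S.As

/-- The formal adjoint of `B k`. -/
noncomputable def Bd (k : ℕ) : V →L[ℝ] H := if k = 0 then S.As else S.A

@[simp] theorem B_zero : S.B 0 = S.A := rfl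
@[simp] theorem Bd_zero : S.Bd 0 = S.As := rfl
@[simp] theorem B_succ (k : ℕ) : S.B (k + 1) = S.As := rfl
@[simp] theorem Bd_succ (k : ℕ) : S.Bd (k + 1) = S.A := rfl

theorem adj_B (k : ℕ) (u v : V) : ⟪S.B k u, S.ι v⟫_ℝ = ⟪S.ι u, S.Bd k v⟫_ℝ := by
  cases k with
  | zero => exact S.adj u v
  | succ k => exact S.adj' u v

theorem adj_Bd (k : ℕ) (u v : V) : ⟪S.Bd k u, S.ι v⟫_ℝ = ⟪S.ι u, S.B k v⟫_ℝ := by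
  rw [real_inner_comm, ← S.adj_B, real_inner_comm]

theorem closed_B (k : ℕ) (w q : H) (h : ∀ v, ⟪w, S.Bd k v⟫_ℝ = ⟪q, S.ι v⟫_ℝ) :
    ∃ u, S.ι u = w ∧ S.B k u = q := by
  cases k with
  | zero => exact S.closed_A w q h
  | succ k => exact S.closed_As w q h

theorem closed_Bd (k : ℕ) (w q : H) (h : ∀ v, ⟪w, S.B k v⟫_ℝ = ⟪q, S.ι v⟫_ℝ) :
    ∃ u, S.ι u = w ∧ S.Bd k u = q := by
  cases k with
  | zero => exact S.closed_As w q h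
  | succ k => exact S.closed_A w q h

theorem norm_sq_le_B (k : ℕ) (v : V) : ‖v‖ ^ 2 ≤ S.Cv * (‖S.ι v‖ ^ 2 + ‖S.B k v‖ ^ 2) := by
  cases k with
  | zero => exact S.norm_sq_le_A v
  | succ k => exact S.norm_sq_le_As v

/-- The `k`-th component of a finite sequence, `0` out of range. -/
noncomputable def finProj (V : Type*) [NormedAddCommGroup V] [InnerProductSpace ℝ V] (n k : ℕ) :
    PiLp 2 (fun _ : Fin (n + 1) => V) →L[ℝ] V :=
  if h : k < n + 1 then PiLp.proj 2 (fun _ : Fin (n + 1) => V) ⟨k, h⟩ else 0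

theorem finProj_of_lt {n k : ℕ} (h : n < k) (u : PiLp 2 (fun _ : Fin (n + 1) => V)) :
    finProj V n k u = 0 := by
  simp [finProj, show ¬ k < n + 1 by omega]

theorem norm_sq_eq_sum_finProj (n : ℕ) (u : PiLp 2 (fun _ : Fin (n + 1) => V)) :
    ‖u‖ ^ 2 = ∑ k ∈ Finset.range (n + 1), ‖finProj V n k u‖ ^ 2 := by
  rw [PiLp.norm_sq_eq_of_L2, Finset.sum_range]
  refine Finset.sum_congr rfl fun i _ => ?_
  rw [finProj, dif_pos i.2]
  rfl

theorem exists_finProj_eq (n k : ℕ) (hk : k < n + 1) (v : V) :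
    ∃ w : PiLp 2 (fun _ : Fin (n + 1) => V), ∀ j, finProj V n j w = if j = k then v else 0 := by
  refine ⟨WithLp.toLp 2 (Pi.single ⟨k, hk⟩ v), fun j => ?_⟩
  by_cases hj : j < n + 1
  · simp [finProj, hj]
  · simp [finProj, hj, show j ≠ k by omega]

/-- The bilinear form of the truncated, elliptically regularized Hermite system. -/
noncomputable def galerkinForm (n : ℕ) (a d s : ℝ) :
    PiLp 2 (fun _ : Fin (n + 1) => V) →L[ℝ] PiLp 2 (fun _ : Fin (n + 1) => V) →L[ℝ] ℝ :=
  ∑ k ∈ Finset.range (n + 1),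
    ((1 + (a + d) * k) •
        (innerSL ℝ).bilinearComp (S.ι.comp (finProj V n k)) (S.ι.comp (finProj V n k))
      + d • (innerSL ℝ).bilinearComp ((S.B k).comp (finProj V n k)) ((S.B k).comp (finProj V n k))
      + (s * √((k : ℝ) + 1)) •
        ((innerSL ℝ).bilinearComp (S.A.comp (finProj V n k)) (S.ι.comp (finProj V n (k + 1)))
        - (innerSL ℝ).bilinearComp (S.As.comp (finProj V n (k + 1))) (S.ι.comp (finProj V n k))))

theorem galerkinForm_apply (n : ℕ) (a d s : ℝ) (u w : PiLp 2 (fun _ : Fin (n + 1) => V)) :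
    S.galerkinForm n a d s u w = ∑ k ∈ Finset.range (n + 1),
      ((1 + (a + d) * k) * ⟪S.ι (finProj V n k u), S.ι (finProj V n k w)⟫_ℝ
      + d * ⟪S.B k (finProj V n k u), S.B k (finProj V n k w)⟫_ℝ
      + s * √((k : ℝ) + 1) * (⟪S.A (finProj V n k u), S.ι (finProj V n (k + 1) w)⟫_ℝ
        - ⟪S.As (finProj V n (k + 1) u), S.ι (finProj V n k w)⟫_ℝ)) := by
  simp [galerkinForm, ContinuousLinearMap.bilinearComp_apply,
    innerSL_apply_apply]

theorem isCoercive_galerkinForm (n : ℕ) {a d : ℝ} (ha : 0 ≤ a) (hd : 0 < d) (s : ℝ) :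
    IsCoercive (S.galerkinForm n a d s) := by
  refine ⟨min 1 d / S.Cv, div_pos (lt_min one_pos hd) S.Cv_pos, fun u => ?_⟩
  rw [galerkinForm_apply, mul_assoc, ← sq, norm_sq_eq_sum_finProj, Finset.mul_sum]
  refine Finset.sum_le_sum fun k _ => ?_
  have h := S.norm_sq_le_B k (finProj V n k u)
  -- The transport coupling is antisymmetric and drops out on the diagonal, so coercivity holds for
  -- every `s`.
  have h1 : ⟪S.A (finProj V n k u), S.ι (finProj V n (k + 1) u)⟫_ℝ
        - ⟪S.As (finProj V n (k + 1) u), S.ι (finProj V n k u)⟫_ℝ = 0 := by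
    rw [S.adj, real_inner_comm, sub_self]
  rw [h1, real_inner_self_eq_norm_sq, real_inner_self_eq_norm_sq, div_mul_eq_mul_div,
    div_le_iff₀ S.Cv_pos]
  have h2 : 0 ≤ (a + d) * k := by positivity
  have h3 := min_le_left 1 d
  have h4 := min_le_right 1 d
  have h5 : 0 < min 1 d := lt_min one_pos hd
  set x := ‖S.ι (finProj V n k u)‖ ^ 2
  set y := ‖S.B k (finProj V n k u)‖ ^ 2
  have hx : 0 ≤ x := sq_nonneg _
  have hy : 0 ≤ y := sq_nonneg _
  calc min 1 d * ‖finProj V n k u‖ ^ 2 ≤ min 1 d * (S.Cv * (x + y)) := by gcongr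
    _ = (min 1 d * x + min 1 d * y) * S.Cv := by ring
    _ ≤ (1 * x + d * y) * S.Cv := by have := S.Cv_pos; gcongr
    _ ≤ _ := by have := S.Cv_pos; gcongr ?_ * S.Cv; nlinarith [mul_nonneg h2 hx]

/-- Solvability of the truncated, elliptically regularized Hermite system. -/
theorem exists_galerkin [CompleteSpace V] (n : ℕ) {a d : ℝ} (ha : 0 ≤ a) (hd : 0 < d) (s : ℝ)
    (f : ℕ → H) :
    ∃ u z : ℕ → V, (∀ k, n < k → u k = 0) ∧ (∀ k, S.ι (z k) = S.B k (u k)) ∧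
      ∀ k ≤ n, (1 + (a + d) * k) • S.ι (u k) + d • S.Bd k (z k)
        + s • (√(k : ℝ) • S.A (u (k - 1)) - √((k : ℝ) + 1) • S.As (u (k + 1))) = f k := by
  obtain ⟨U, hU⟩ := exists_forall_eq_of_isCoercive (S.isCoercive_galerkinForm n ha hd s)
    (∑ k ∈ Finset.range (n + 1), (innerSL ℝ (f k)).comp (S.ι.comp (finProj V n k)))
  set u : ℕ → V := fun k => finProj V n k U with hu
  have hu0 : ∀ k, n < k → u k = 0 := fun k hk => finProj_of_lt hk U
  have key : ∀ k ≤ n, ∀ v, (1 + (a + d) * k) * ⟪S.ι (u k), S.ι v⟫_ℝ + d * ⟪S.B k (u k), S.B k v⟫_ℝ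
      + s * (√(k : ℝ) * ⟪S.A (u (k - 1)), S.ι v⟫_ℝ
        - √((k : ℝ) + 1) * ⟪S.As (u (k + 1)), S.ι v⟫_ℝ) = ⟪f k, S.ι v⟫_ℝ := fun k hk v => by
    obtain ⟨w, hw⟩ := exists_finProj_eq n k (by omega) v
    have h := hU w
    rw [galerkinForm_apply] at h
    simp only [sum_apply, ContinuousLinearMap.comp_apply, innerSL_apply_apply,
      hw] at h
    rw [Finset.sum_eq_single (a := k) (f := fun i => ⟪f i, S.ι (if i = k then v else 0)⟫_ℝ)
      (fun j _ hj => by simp [hj]) (by simp; omega)] at h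
    simp only [if_true] at h
    rw [← h]
    simp only [mul_sub, Finset.sum_add_distrib, Finset.sum_sub_distrib]
    rw [Finset.sum_eq_single k (fun j _ hj => by simp [hj]) (by simp; omega),
      Finset.sum_eq_single k (fun j _ hj => by simp [hj]) (by simp; omega)]
    have e2 : ∑ j ∈ Finset.range (n + 1), s * √((j : ℝ) + 1) *
        ⟪S.As (finProj V n (j + 1) U), S.ι (if j = k then v else 0)⟫_ℝ
        = s * √((k : ℝ) + 1) * ⟪S.As (u (k + 1)), S.ι v⟫_ℝ := by
      rw [Finset.sum_eq_single k (fun j _ hj => by simp [hj]) (by simp; omega)]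
      simp [hu]
    have e1 : ∑ j ∈ Finset.range (n + 1), s * √((j : ℝ) + 1) *
        ⟪S.A (finProj V n j U), S.ι (if j + 1 = k then v else 0)⟫_ℝ
        = s * √(k : ℝ) * ⟪S.A (u (k - 1)), S.ι v⟫_ℝ := by
      cases k with
      | zero => simp
      | succ k =>
        rw [Finset.sum_eq_single k (fun j _ hj => by simp [hj]) (by simp; omega)]
        simp [hu]
    rw [e1, e2]
    simp only [if_true, hu]
    ring
  -- Elliptic regularity: the weak equation bounds `⟪B k (u k), B k v⟫` by `‖ι v‖`, and closedness
  -- puts `B k (u k)` in the domain of `Bd k`. Division by `d` makes the regularization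
  -- indispensable.
  have hz : ∀ k, ∃ z : V, S.ι z = S.B k (u k) ∧ (k ≤ n →
      (1 + (a + d) * k) • S.ι (u k) + d • S.Bd k z
        + s • (√(k : ℝ) • S.A (u (k - 1)) - √((k : ℝ) + 1) • S.As (u (k + 1))) = f k) := fun k => by
    by_cases hk : k ≤ n
    · obtain ⟨z, h1, h2⟩ := S.closed_Bd k (S.B k (u k)) (d⁻¹ • (f k - (1 + (a + d) * k) • S.ι (u k)
        - s • (√(k : ℝ) • S.A (u (k - 1)) - √((k : ℝ) + 1) • S.As (u (k + 1))))) fun v => by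
        have h := key k hk v
        simp only [inner_sub_left, inner_smul_left, RCLike.conj_to_real]
        field_simp
        linarith
      refine ⟨z, h1, fun _ => ?_⟩
      rw [h2, smul_inv_smul₀ hd.ne']
      abel
    · exact ⟨0, by simp [hu0 k (by omega)], fun h => absurd h hk⟩
  choose z hz using hz
  exact ⟨u, z, hu0, fun k => (hz k).1, fun k => (hz k).2⟩

end DirichletPair
-- The bounded inverse of `As` that defines the corrector
namespace DirichletPair

variable {H V : Type*} [NormedAddCommGroup H] [InnerProductSpace ℝ H]
    [NormedAddCommGroup V] [InnerProductSpace ℝ V] (S : DirichletPair H V)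

/-- The Poincaré inequality gives coercivity on the complement of `m`; the rank-one term restores it
along `m`, where `A` vanishes. -/
theorem isCoercive_poincare :
    IsCoercive ((innerSL ℝ).bilinearComp S.A S.A + (innerSL ℝ).bilinearComp
      ((innerSL ℝ (S.ι S.m)).comp S.ι) ((innerSL ℝ (S.ι S.m)).comp S.ι)) := by
  have hP := S.P_nonneg
  have hC := S.Cv_pos
  refine ⟨1 / (S.Cv * (1 + (S.P ^ 2 + 1))), by positivity, fun u => ?_⟩
  simp only [add_apply, ContinuousLinearMap.bilinearComp_apply, innerSL_apply_apply,
    ContinuousLinearMap.comp_apply, real_inner_self_eq_norm_sq]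
  rw [mul_assoc, ← sq, Real.norm_eq_abs, sq_abs]
  set t := ⟪S.ι S.m, S.ι u⟫_ℝ with ht
  have hmm : ⟪S.ι S.m, S.ι S.m⟫_ℝ = 1 := by rw [real_inner_self_eq_norm_sq, S.norm_m]; norm_num
  have h1 : ‖S.ι (u - t • S.m)‖ ≤ S.P * ‖S.A u‖ := by
    have := S.poincare (u - t • S.m) (by
      rw [map_sub, map_smul, inner_sub_left, inner_smul_left, hmm, real_inner_comm, ← ht]
      simp)
    simpa [S.A_m] using this
  have h2 : ‖S.ι u‖ ^ 2 = ‖S.ι (u - t • S.m)‖ ^ 2 + t ^ 2 := by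
    rw [map_sub, map_smul, norm_sub_sq_real, inner_smul_right, norm_smul, S.norm_m,
      real_inner_comm, ← ht, Real.norm_eq_abs, mul_one, sq_abs]
    ring
  have h3 : ‖S.ι (u - t • S.m)‖ ^ 2 ≤ S.P ^ 2 * ‖S.A u‖ ^ 2 := by
    rw [← mul_pow]; gcongr
  have h4 := S.norm_sq_le_A u
  have h5 : ‖u‖ ^ 2 ≤ S.Cv * ((S.P ^ 2 + 1) * ‖S.A u‖ ^ 2 + t ^ 2) := by
    refine h4.trans ?_
    gcongr ?_ * ?_
    rw [h2]
    linarith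
  rw [div_mul_eq_mul_div, div_le_iff₀ (by positivity), one_mul]
  refine h5.trans ?_
  have h6 : 0 ≤ S.Cv * ‖S.A u‖ ^ 2 := by positivity
  have h7 : 0 ≤ S.Cv * t ^ 2 := by positivity
  have h8 : 0 ≤ S.Cv * t ^ 2 * S.P ^ 2 := by positivity
  nlinarith

variable [CompleteSpace H] [CompleteSpace V]

/-- The inverse of `As` from the orthogonal complement of the kernel of `A`. -/
noncomputable def G : H →L[ℝ] H :=
  S.A.comp (((S.isCoercive_poincare).continuousLinearEquivOfBilin.symm : V →L[ℝ] V).comp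
    (ContinuousLinearMap.adjoint S.ι))

/-- Testing the variational equation with `m` shows that, for such `h`, the added rank-one term is
zero. Thus `G h = A u` where `As (A u) = h` weakly. -/
theorem exists_G_eq (h : H) (hm : ⟪h, S.ι S.m⟫_ℝ = 0) :
    ∃ u : V, S.G h = S.A u ∧ ⟪S.ι u, S.ι S.m⟫_ℝ = 0 ∧ ∀ v, ⟪S.A u, S.A v⟫_ℝ = ⟪h, S.ι v⟫_ℝ := by
  set u := (S.isCoercive_poincare).continuousLinearEquivOfBilin.symm
    (ContinuousLinearMap.adjoint S.ι h) with hu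
  have key : ∀ v, ⟪S.A u, S.A v⟫_ℝ + ⟪S.ι S.m, S.ι u⟫_ℝ * ⟪S.ι S.m, S.ι v⟫_ℝ = ⟪h, S.ι v⟫_ℝ :=
    fun v => by
      have h1 := (S.isCoercive_poincare).continuousLinearEquivOfBilin_apply u v
      rw [hu, ContinuousLinearEquiv.apply_symm_apply, ContinuousLinearMap.adjoint_inner_left,
        ← hu] at h1
      rw [h1]
      simp [ContinuousLinearMap.bilinearComp_apply, innerSL_apply_apply, mul_comm]
  have h0 : ⟪S.ι S.m, S.ι u⟫_ℝ = 0 := by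
    have := key S.m
    rw [S.A_m, inner_zero_right, real_inner_self_eq_norm_sq, S.norm_m, hm] at this
    linarith
  refine ⟨u, rfl, by rw [real_inner_comm, h0], fun v => ?_⟩
  rw [← key v, h0]; ring

theorem exists_As_eq (h : H) (hm : ⟪h, S.ι S.m⟫_ℝ = 0) : ∃ w : V, S.ι w = S.G h ∧ S.As w = h := by
  obtain ⟨u, h1, -, h2⟩ := S.exists_G_eq h hm
  rw [h1]
  exact S.closed_As _ _ h2

theorem norm_G_le (h : H) (hm : ⟪h, S.ι S.m⟫_ℝ = 0) : ‖S.G h‖ ≤ S.P * ‖h‖ := by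
  obtain ⟨u, h1, h0, h2⟩ := S.exists_G_eq h hm
  rw [h1]
  have h3 : ‖S.A u‖ ^ 2 ≤ (S.P * ‖h‖) * ‖S.A u‖ := by
    rw [← real_inner_self_eq_norm_sq, h2]
    refine (real_inner_le_norm _ _).trans ?_
    calc ‖h‖ * ‖S.ι u‖ ≤ ‖h‖ * (S.P * ‖S.A u‖) := by gcongr; exact S.poincare u h0
      _ = _ := by ring
  rcases (norm_nonneg (S.A u)).eq_or_lt with h4 | h4
  · rw [← h4]; have := S.P_nonneg; positivity
  · rw [sq] at h3; exact le_of_mul_le_mul_right h3 h4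

/-- `G (As z)` is the orthogonal projection of `ι z` onto the range of `A`, so no Poincaré constant
enters. -/
theorem norm_G_As_le (z : V) : ‖S.G (S.As z)‖ ≤ ‖S.ι z‖ := by
  obtain ⟨u, h1, h0, h2⟩ := S.exists_G_eq (S.As z) (S.inner_As_m z)
  rw [h1]
  have h3 : ‖S.A u‖ ^ 2 ≤ ‖S.ι z‖ * ‖S.A u‖ := by
    rw [← real_inner_self_eq_norm_sq, h2, S.adj']
    exact real_inner_le_norm _ _
  rcases (norm_nonneg (S.A u)).eq_or_lt with h4 | h4
  · rw [← h4]; positivity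
  · rw [sq] at h3; exact le_of_mul_le_mul_right h3 h4

end DirichletPair

/-! ### Dissipation of the modified entropies for the truncated system -/

/-- The conditions on the weight `α` of the corrector in the modified entropy. -/
structure AdmissibleWeight (P C ε τ α : ℝ) : Prop where
  ε_pos : 0 < ε
  τ_pos : 0 < τ
  nonneg : 0 ≤ α
  le_one : α ≤ 1
  mul_P_le : α * P ≤ 1 / 2
  le_first : 2 * α * C ^ 2 / ε ≤ 1 / τ
  le_second : α * (ε * P ^ 2 / τ ^ 2) + α / ε ≤ 1 / (2 * τ)

/-- The numerical core shared by both orders: `x` and `y` stand for the first components and their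
images under `B` (respectively `Bd`). By Young, half of `(α / ε) x₀²` and half of `X / τ` pay for
the cross terms with `x₁` and `x₂`. The terms `δ (X + Y)`, available because the regularization also
contains `δ k`, pay for the corrector's `δ` terms up to `δ x₀²`. -/
theorem dissipation_scalar {P C ε τ α δ x₀ x₁ x₂ y₀ y₁ X Y : ℝ} (hα : AdmissibleWeight P C ε τ α)
    (hδ : 0 ≤ δ) (hX : x₁ ^ 2 + 2 * x₂ ^ 2 ≤ X) (hY : y₀ ^ 2 + y₁ ^ 2 ≤ Y)
    (h₀ : 0 ≤ x₀) (h₁ : 0 ≤ x₁) :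
    X / (2 * τ) + α / (2 * ε) * x₀ ^ 2 - δ * x₀ ^ 2 ≤
      δ * (X + Y) + X / τ + α / ε * x₀ ^ 2 - α * √2 * C / ε * (x₂ * x₀)
        - α * P / τ * (x₁ * x₀) - α / ε * x₁ ^ 2
        - α * δ * (P * (x₁ * x₀) + y₁ * x₀ + x₁ * y₀) := by
  obtain ⟨hε, hτ, hα0, hα1, hP, hC, hD⟩ := hα
  have e1 : α * √2 * C / ε * (x₂ * x₀) ≤ α / (4 * ε) * x₀ ^ 2 + 2 * α * C ^ 2 / ε * x₂ ^ 2 := by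
    have h2 : √2 ^ 2 = 2 := Real.sq_sqrt (by norm_num)
    have : 0 ≤ α / ε * (x₀ / 2 - √2 * C * x₂) ^ 2 := by positivity
    have h3 : α / ε * (x₀ / 2 - √2 * C * x₂) ^ 2
        = α / (4 * ε) * x₀ ^ 2 + √2 ^ 2 * α * C ^ 2 / ε * x₂ ^ 2 - α * √2 * C / ε * (x₂ * x₀) := by
      field_simp; ring
    rw [h2] at h3
    linarith
  have e2 : α * P / τ * (x₁ * x₀) ≤ α / (4 * ε) * x₀ ^ 2 + α * (ε * P ^ 2 / τ ^ 2) * x₁ ^ 2 := by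
    have : 0 ≤ α / ε * (x₀ / 2 - ε * P / τ * x₁) ^ 2 := by positivity
    have h3 : α / ε * (x₀ / 2 - ε * P / τ * x₁) ^ 2
        = α / (4 * ε) * x₀ ^ 2 + α * (ε * P ^ 2 / τ ^ 2) * x₁ ^ 2 - α * P / τ * (x₁ * x₀) := by
      field_simp; ring
    linarith
  have e3 : 2 * α * C ^ 2 / ε * x₂ ^ 2 ≤ 1 / τ * x₂ ^ 2 := by gcongr
  have e4 : (α * (ε * P ^ 2 / τ ^ 2) + α / ε) * x₁ ^ 2 ≤ 1 / (2 * τ) * x₁ ^ 2 := by gcongr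
  have e5 : 1 / (2 * τ) * (x₁ ^ 2 + 2 * x₂ ^ 2) ≤ 1 / (2 * τ) * X := by gcongr
  have e6 : 1 / (2 * τ) * (2 * x₂ ^ 2) = 1 / τ * x₂ ^ 2 := by field_simp
  have e7 : X / τ = 1 / (2 * τ) * X + X / (2 * τ) := by field_simp; ring
  have e8 : α / ε * x₀ ^ 2 = α / (4 * ε) * x₀ ^ 2 + α / (4 * ε) * x₀ ^ 2 + α / (2 * ε) * x₀ ^ 2 := by
    field_simp; ring
  have d1 : α * (P * (x₁ * x₀) + y₁ * x₀ + x₁ * y₀) ≤ X + Y + x₀ ^ 2 := by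
    have a1 : α * P * (x₁ * x₀) ≤ 1 / 2 * (x₁ * x₀) := by gcongr
    have a2 : α * (y₁ * x₀) ≤ (y₁ ^ 2 + x₀ ^ 2) / 2 := by
      nlinarith [sq_nonneg (y₁ - x₀), sq_nonneg (y₁ + x₀)]
    have a3 : α * (x₁ * y₀) ≤ (x₁ ^ 2 + y₀ ^ 2) / 2 := by
      nlinarith [sq_nonneg (x₁ - y₀), sq_nonneg (x₁ + y₀)]
    have a4 : x₁ * x₀ ≤ (x₁ ^ 2 + x₀ ^ 2) / 2 := by nlinarith [sq_nonneg (x₁ - x₀)]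
    have a5 : α * (P * (x₁ * x₀) + y₁ * x₀ + x₁ * y₀)
        = α * P * (x₁ * x₀) + α * (y₁ * x₀) + α * (x₁ * y₀) := by ring
    linarith [sq_nonneg x₂, sq_nonneg y₁, sq_nonneg y₀, sq_nonneg x₁, sq_nonneg x₀]
  have d2 : α * δ * (P * (x₁ * x₀) + y₁ * x₀ + x₁ * y₀) ≤ δ * (X + Y) + δ * x₀ ^ 2 := by
    calc α * δ * (P * (x₁ * x₀) + y₁ * x₀ + x₁ * y₀)
        = δ * (α * (P * (x₁ * x₀) + y₁ * x₀ + x₁ * y₀)) := by ring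
      _ ≤ δ * (X + Y + x₀ ^ 2) := by gcongr
      _ = _ := by ring
  rw [mul_add] at e5
  rw [add_mul] at e4
  linarith

namespace DirichletPair

section Identities

variable {H V : Type*} [NormedAddCommGroup H] [InnerProductSpace ℝ H]
    [NormedAddCommGroup V] [InnerProductSpace ℝ V]

/-- `g` is the value at `u` of the negative generator of the Hermite system, truncated at level `n`
and elliptically regularized with parameter `δ`; `z` collects the `B k (u k)`. -/
structure IsTruncated (S : DirichletPair H V) (n : ℕ) (ε τ δ : ℝ) (u z : ℕ → V) (g : ℕ → H) :
    Prop where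
  two_le : 2 ≤ n
  zero : ∀ k, n < k → u k = 0
  z_eq : ∀ k, S.ι (z k) = S.B k (u k)
  eq : ∀ k ≤ n, g k = ((1 / τ + δ) * k) • S.ι (u k) + δ • S.Bd k (z k)
    + (1 / ε) • (√(k : ℝ) • S.A (u (k - 1)) - √((k : ℝ) + 1) • S.As (u (k + 1)))

namespace IsTruncated

variable {S : DirichletPair H V} {n : ℕ} {ε τ δ : ℝ} {u z : ℕ → V} {g : ℕ → H}

theorem z_zero (h : S.IsTruncated n ε τ δ u z g) {k : ℕ} (hk : n < k) : z k = 0 :=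
  S.injective (by rw [h.z_eq, h.zero k hk, map_zero, map_zero])

theorem g_zero (h : S.IsTruncated n ε τ δ u z g) :
    g 0 = δ • S.As (z 0) - (1 / ε) • S.As (u 1) := by
  rw [h.eq 0 (Nat.zero_le _)]
  simp [sub_eq_add_neg]

theorem g_one (h : S.IsTruncated n ε τ δ u z g) :
    g 1 = (1 / τ + δ) • S.ι (u 1) + δ • S.A (z 1)
      + (1 / ε) • (S.A (u 0) - √2 • S.As (u 2)) := by
  rw [h.eq 1 (by have := h.two_le; omega)]
  norm_num

theorem inner_g_zero_m (h : S.IsTruncated n ε τ δ u z g) : ⟪g 0, S.ι S.m⟫_ℝ = 0 := by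
  rw [h.g_zero, inner_sub_left, inner_smul_left, inner_smul_left, S.inner_As_m, S.inner_As_m]
  simp

/-- The transport terms telescope; the ends vanish because `√0 = 0` and `u (n + 1) = 0`. -/
theorem sum_inner_u_g (h : S.IsTruncated n ε τ δ u z g) :
    ∑ k ∈ Finset.range (n + 1), ⟪S.ι (u k), g k⟫_ℝ =
      (1 / τ + δ) * ∑ k ∈ Finset.range (n + 1), (k : ℝ) * ‖S.ι (u k)‖ ^ 2
      + δ * ∑ k ∈ Finset.range (n + 1), ‖S.ι (z k)‖ ^ 2 := by
  set p : ℕ → ℝ := fun k => √(k : ℝ) * ⟪S.ι (u k), S.A (u (k - 1))⟫_ℝ with hp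
  have h1 : ∀ k ∈ Finset.range (n + 1), ⟪S.ι (u k), g k⟫_ℝ =
      (1 / τ + δ) * ((k : ℝ) * ‖S.ι (u k)‖ ^ 2) + δ * ‖S.ι (z k)‖ ^ 2
      + (1 / ε) * (p k - p (k + 1)) := fun k hk => by
    rw [h.eq k (by simpa [Nat.lt_succ_iff] using hk)]
    simp only [inner_add_right, inner_smul_right, inner_sub_right, real_inner_self_eq_norm_sq]
    rw [← S.adj_B, ← h.z_eq, real_inner_self_eq_norm_sq, real_inner_comm (S.As (u (k + 1))),
      S.adj']
    simp only [hp, Nat.add_sub_cancel]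
    push_cast
    ring
  rw [Finset.sum_congr rfl h1, Finset.sum_add_distrib, Finset.sum_add_distrib, ← Finset.mul_sum,
    ← Finset.mul_sum, ← Finset.mul_sum, Finset.sum_range_sub']
  simp [hp, h.zero (n + 1) (by omega)]

/-- Transport telescopes again. `As A` must be exchanged for `A As` only when `B` is `As` at both
levels `k - 1` and `k`, so the commutator source starts at `k = 2`. -/
theorem sum_inner_z_g (h : S.IsTruncated n ε τ δ u z g) :
    ∑ k ∈ Finset.range (n + 1), ⟪S.Bd k (z k), g k⟫_ℝ =
      (1 / τ + δ) * ∑ k ∈ Finset.range (n + 1), (k : ℝ) * ‖S.ι (z k)‖ ^ 2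
      + δ * ∑ k ∈ Finset.range (n + 1), ‖S.Bd k (z k)‖ ^ 2
      + (1 / ε) * ∑ k ∈ Finset.range (n + 1),
        if 2 ≤ k then √(k : ℝ) * ⟪S.c (S.ι (u (k - 1))), S.ι (z k)⟫_ℝ else 0 := by
  set q : ℕ → ℝ := fun k => √(k : ℝ) * ⟪S.Bd (k - 1) (z (k - 1)), S.ι (z k)⟫_ℝ with hq
  have h1 : ∀ k ∈ Finset.range (n + 1), ⟪S.Bd k (z k), g k⟫_ℝ =
      (1 / τ + δ) * ((k : ℝ) * ‖S.ι (z k)‖ ^ 2) + δ * ‖S.Bd k (z k)‖ ^ 2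
      + ((1 / ε) * (if 2 ≤ k then √(k : ℝ) * ⟪S.c (S.ι (u (k - 1))), S.ι (z k)⟫_ℝ else 0)
      + (1 / ε) * (q k - q (k + 1))) := fun k hk => by
    have e1 : √(k : ℝ) * ⟪S.Bd k (z k), S.A (u (k - 1))⟫_ℝ =
        q k + if 2 ≤ k then √(k : ℝ) * ⟪S.c (S.ι (u (k - 1))), S.ι (z k)⟫_ℝ else 0 := by
      match k with
      | 0 => simp [hq]
      | 1 =>
        have hz0 := h.z_eq 0
        simp only [B_zero] at hz0
        simp [hq, ← hz0, S.adj, real_inner_comm]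
      | k + 2 =>
        have hz1 := h.z_eq (k + 1)
        simp only [B_succ] at hz1
        have hc := S.comm (u (k + 1)) (z (k + 2))
        rw [← hz1, ← S.adj, sub_eq_iff_eq_add] at hc
        simp only [hq, Bd_succ, Nat.le_add_left, if_true,
          show k + 2 - 1 = k + 1 by omega]
        rw [real_inner_comm, hc]
        ring
    have e2 : √((k : ℝ) + 1) * ⟪S.Bd k (z k), S.As (u (k + 1))⟫_ℝ = q (k + 1) := by
      have hz1 := h.z_eq (k + 1)
      simp only [B_succ] at hz1
      simp [hq, ← hz1]
    rw [h.eq k (by simpa [Nat.lt_succ_iff] using hk)]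
    simp only [inner_add_right, inner_smul_right, inner_sub_right, real_inner_self_eq_norm_sq,
      e1, e2]
    rw [S.adj_Bd, ← h.z_eq, real_inner_self_eq_norm_sq]
    ring
  rw [Finset.sum_congr rfl h1, Finset.sum_add_distrib, Finset.sum_add_distrib,
    Finset.sum_add_distrib, ← Finset.mul_sum,
    ← Finset.mul_sum, ← Finset.mul_sum, ← Finset.mul_sum, Finset.sum_range_sub']
  simp [hq, h.z_zero (k := n + 1) (by omega)]

end IsTruncated

end Identities

theorem three_terms_le_sum {x : ℕ → ℝ} (hx : ∀ k, 0 ≤ x k) {n : ℕ} (hn : 2 ≤ n) :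
    x 0 + x 1 + x 2 ≤ ∑ k ∈ Finset.range (n + 1), x k := by
  calc x 0 + x 1 + x 2 = ∑ k ∈ Finset.range 3, x k := by simp [Finset.sum_range_succ]
    _ ≤ _ := Finset.sum_le_sum_of_subset_of_nonneg (Finset.range_mono (by omega))
      fun k _ _ => hx k

/-- For `k ≥ 1` the weight `k` is at least one, so a quarter of the microscopic dissipation
dominates these components and only `x 0` needs the corrector. -/
theorem weighted_sum_le {x : ℕ → ℝ} (hx : ∀ k, 0 ≤ x k) {ε τ α : ℝ} (n : ℕ) (hε : 0 < ε)
    (hτ : 0 < τ) (h : α / ε ≤ 1 / (2 * τ)) :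
    α / (2 * ε) * ∑ k ∈ Finset.range (n + 1), x k ≤
      (∑ k ∈ Finset.range (n + 1), (k : ℝ) * x k) / (4 * τ) + α / (2 * ε) * x 0 := by
  rw [Finset.sum_range_succ', Finset.sum_range_succ']
  simp only [Nat.cast_zero, zero_mul, add_zero, mul_add]
  gcongr
  rw [Finset.sum_div, Finset.mul_sum]
  refine Finset.sum_le_sum fun k _ => ?_
  have h1 : α / (2 * ε) ≤ 1 / (4 * τ) := by
    have e1 : α / (2 * ε) = α / ε / 2 := by field_simp
    have e2 : 1 / (4 * τ) = 1 / (2 * τ) / 2 := by field_simp; norm_num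
    rw [e1, e2]; linarith
  have hx1 := hx (k + 1)
  calc α / (2 * ε) * x (k + 1) ≤ 1 / (4 * τ) * x (k + 1) := by gcongr
    _ ≤ 1 / (4 * τ) * (((k + 1 : ℕ) : ℝ) * x (k + 1)) := by
      gcongr
      push_cast
      nlinarith [mul_nonneg (Nat.cast_nonneg (α := ℝ) k) hx1]
    _ = _ := by ring

section Estimates

variable {H V : Type*} [NormedAddCommGroup H] [InnerProductSpace ℝ H] [CompleteSpace H]
    [NormedAddCommGroup V] [InnerProductSpace ℝ V] [CompleteSpace V]

namespace IsTruncated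

variable {S : DirichletPair H V} {n : ℕ} {ε τ δ α : ℝ} {u z : ℕ → V} {g : ℕ → H}

/-- The gain is `⟪A (u 0), G (u 0)⟫ = ‖u 0‖²`, which comes from `As (G (u 0)) = u 0`. A quarter of
the microscopic dissipation is kept on the left: it later absorbs the commutator source of the
derivative hierarchy. -/
theorem dissipation_u (h : S.IsTruncated n ε τ δ u z g)
    (hm : ⟪S.ι (u 0), S.ι S.m⟫_ℝ = 0)
    (hα : AdmissibleWeight S.P (1 + S.b * S.P) ε τ α) (hδ : 0 ≤ δ) :
    (∑ k ∈ Finset.range (n + 1), (k : ℝ) * ‖S.ι (u k)‖ ^ 2) / (4 * τ)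
      + α / (2 * ε) * ∑ k ∈ Finset.range (n + 1), ‖S.ι (u k)‖ ^ 2 - δ * ‖S.ι (u 0)‖ ^ 2 ≤
    ∑ k ∈ Finset.range (n + 1), ⟪S.ι (u k), g k⟫_ℝ
      + α * (⟪g 1, S.G (S.ι (u 0))⟫_ℝ + ⟪S.ι (u 1), S.G (g 0)⟫_ℝ) := by
  obtain ⟨w, hw, hw'⟩ := S.exists_As_eq _ hm
  have hε := hα.ε_pos
  have hτ := hα.τ_pos
  have hα0 := hα.nonneg
  have hb := S.b_nonneg
  have hP := S.P_nonneg
  have hz0 : S.ι (z 0) = S.A (u 0) := h.z_eq 0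
  have hz1 : S.ι (z 1) = S.As (u 1) := h.z_eq 1
  have hwn : ‖S.ι w‖ ≤ S.P * ‖S.ι (u 0)‖ := hw ▸ S.norm_G_le _ hm
  -- `A w` arises when `As (u 2)` is paired with the corrector. Trading `A` for `As`, with `As w = u
  -- 0`, is the origin of the constant `1 + b P`.
  have hAw : ‖S.A w‖ ≤ (1 + S.b * S.P) * ‖S.ι (u 0)‖ := by
    refine (S.norm_A_le w).trans ?_
    rw [hw']
    calc _ ≤ ‖S.ι (u 0)‖ + S.b * (S.P * ‖S.ι (u 0)‖) := by gcongr
      _ = _ := by ring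
  have c1 : ⟪g 1, S.G (S.ι (u 0))⟫_ℝ = (1 / τ + δ) * ⟪S.ι (u 1), S.ι w⟫_ℝ
      + δ * ⟪S.ι (z 1), S.ι (u 0)⟫_ℝ + 1 / ε * ‖S.ι (u 0)‖ ^ 2
      - √2 / ε * ⟪S.ι (u 2), S.A w⟫_ℝ := by
    rw [h.g_one, ← hw]
    simp only [inner_add_left, inner_smul_left, inner_sub_left, RCLike.conj_to_real]
    rw [S.adj, S.adj, S.adj', hw', real_inner_self_eq_norm_sq]
    ring
  have c2 : ⟪S.ι (u 1), S.G (g 0)⟫_ℝ = δ * ⟪S.ι (u 1), S.G (S.As (z 0))⟫_ℝ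
      - 1 / ε * ⟪S.ι (u 1), S.G (S.As (u 1))⟫_ℝ := by
    rw [h.g_zero, map_sub, map_smul, map_smul, inner_sub_right, inner_smul_right, inner_smul_right]
  have b1 : -(S.P * (‖S.ι (u 1)‖ * ‖S.ι (u 0)‖)) ≤ ⟪S.ι (u 1), S.ι w⟫_ℝ := by
    refine (neg_le_neg ?_).trans (neg_le_of_abs_le (abs_real_inner_le_norm _ _))
    calc ‖S.ι (u 1)‖ * ‖S.ι w‖ ≤ ‖S.ι (u 1)‖ * (S.P * ‖S.ι (u 0)‖) := by gcongr
      _ = _ := by ring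
  have b2 : -(‖S.ι (z 1)‖ * ‖S.ι (u 0)‖) ≤ ⟪S.ι (z 1), S.ι (u 0)⟫_ℝ :=
    neg_le_of_abs_le (abs_real_inner_le_norm _ _)
  have b3 : ⟪S.ι (u 2), S.A w⟫_ℝ ≤ (1 + S.b * S.P) * (‖S.ι (u 2)‖ * ‖S.ι (u 0)‖) := by
    refine (real_inner_le_norm _ _).trans ?_
    calc ‖S.ι (u 2)‖ * ‖S.A w‖ ≤ ‖S.ι (u 2)‖ * ((1 + S.b * S.P) * ‖S.ι (u 0)‖) := by gcongr
      _ = _ := by ring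
  have b4 : -(‖S.ι (u 1)‖ * ‖S.ι (z 0)‖) ≤ ⟪S.ι (u 1), S.G (S.As (z 0))⟫_ℝ := by
    refine (neg_le_neg ?_).trans (neg_le_of_abs_le (abs_real_inner_le_norm _ _))
    gcongr
    exact S.norm_G_As_le _
  have b5 : ⟪S.ι (u 1), S.G (S.As (u 1))⟫_ℝ ≤ ‖S.ι (u 1)‖ ^ 2 := by
    refine (real_inner_le_norm _ _).trans ?_
    rw [sq]
    gcongr
    exact S.norm_G_As_le _
  have hX := three_terms_le_sum (x := fun k => (k : ℝ) * ‖S.ι (u k)‖ ^ 2)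
    (fun k => by positivity) h.two_le
  have hY := three_terms_le_sum (x := fun k => ‖S.ι (z k)‖ ^ 2) (fun k => by positivity) h.two_le
  have key := dissipation_scalar (x₀ := ‖S.ι (u 0)‖) (x₁ := ‖S.ι (u 1)‖) (x₂ := ‖S.ι (u 2)‖)
    (y₀ := ‖S.ι (z 0)‖) (y₁ := ‖S.ι (z 1)‖)
    (X := ∑ k ∈ Finset.range (n + 1), (k : ℝ) * ‖S.ι (u k)‖ ^ 2)
    (Y := ∑ k ∈ Finset.range (n + 1), ‖S.ι (z k)‖ ^ 2) hα hδ
    (by simpa using hX) (by nlinarith [sq_nonneg ‖S.ι (z 2)‖])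
    (norm_nonneg _) (norm_nonneg _)
  have hws := weighted_sum_le (x := fun k => ‖S.ι (u k)‖ ^ 2) (fun k => by positivity) n hε hτ
    (le_trans (le_add_of_nonneg_left (by positivity)) hα.le_second)
  rw [h.sum_inner_u_g, c1, c2]
  set X := ∑ k ∈ Finset.range (n + 1), (k : ℝ) * ‖S.ι (u k)‖ ^ 2
  set Y := ∑ k ∈ Finset.range (n + 1), ‖S.ι (z k)‖ ^ 2
  have t1 : α * (1 / τ + δ) * -(S.P * (‖S.ι (u 1)‖ * ‖S.ι (u 0)‖)) ≤
    α * (1 / τ + δ) * ⟪S.ι (u 1), S.ι w⟫_ℝ := by gcongr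
  have t2 : α * δ * -(‖S.ι (z 1)‖ * ‖S.ι (u 0)‖) ≤ α * δ * ⟪S.ι (z 1), S.ι (u 0)⟫_ℝ := by gcongr
  have t3 : α * √2 / ε * ⟪S.ι (u 2), S.A w⟫_ℝ ≤
    α * √2 / ε * ((1 + S.b * S.P) * (‖S.ι (u 2)‖ * ‖S.ι (u 0)‖)) := by gcongr
  have t4 : α * δ * -(‖S.ι (u 1)‖ * ‖S.ι (z 0)‖) ≤
    α * δ * ⟪S.ι (u 1), S.G (S.As (z 0))⟫_ℝ := by gcongr
  have t5 : α / ε * ⟪S.ι (u 1), S.G (S.As (u 1))⟫_ℝ ≤ α / ε * ‖S.ι (u 1)‖ ^ 2 := by gcongr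
  have hXs : X / (2 * τ) = X / (4 * τ) + X / (4 * τ) := by field_simp; ring
  ring_nf at key hws t1 t2 t3 t4 t5 hXs ⊢
  linarith

/-- Since `z 0 = A (u 0)`, the vector `u 0` itself plays the role that `G (u 0)` had before, and
Poincaré bounds it by `z 0`. The price is the commutator source, left as a multiple of the
microscopic dissipation of `u`. -/
theorem dissipation_z (h : S.IsTruncated n ε τ δ u z g)
    (hm : ⟪S.ι (u 0), S.ι S.m⟫_ℝ = 0)
    (hα : AdmissibleWeight S.P (1 + S.b * S.P) ε τ α) (hδ : 0 ≤ δ) :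
    α / (2 * ε) * ∑ k ∈ Finset.range (n + 1), ‖S.ι (z k)‖ ^ 2 - δ * ‖S.ι (z 0)‖ ^ 2
      - ‖S.c‖ ^ 2 * τ / ε ^ 2 * ∑ k ∈ Finset.range (n + 1), (k : ℝ) * ‖S.ι (u k)‖ ^ 2 ≤
    ∑ k ∈ Finset.range (n + 1), ⟪S.Bd k (z k), g k⟫_ℝ
      + α * (⟪g 1, S.ι (z 0)⟫_ℝ + ⟪S.ι (z 1), g 0⟫_ℝ) := by
  have hε := hα.ε_pos
  have hτ := hα.τ_pos
  have hα0 := hα.nonneg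
  have hb := S.b_nonneg
  have hP := S.P_nonneg
  have hz0 : S.ι (z 0) = S.A (u 0) := h.z_eq 0
  have hz1 : S.ι (z 1) = S.As (u 1) := h.z_eq 1
  have hz2 : S.ι (z 2) = S.As (u 2) := h.z_eq 2
  have c1 : ⟪g 1, S.ι (z 0)⟫_ℝ = (1 / τ + δ) * ⟪S.ι (z 1), S.ι (u 0)⟫_ℝ
      + δ * ⟪S.A (z 1), S.ι (z 0)⟫_ℝ + 1 / ε * ‖S.ι (z 0)‖ ^ 2
      - √2 / ε * ⟪S.ι (z 2), S.ι (z 0)⟫_ℝ := by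
    rw [h.g_one, ← hz0, ← hz2]
    simp only [inner_add_left, inner_smul_left, inner_sub_left, RCLike.conj_to_real]
    rw [show ⟪S.ι (u 1), S.ι (z 0)⟫_ℝ = ⟪S.ι (z 1), S.ι (u 0)⟫_ℝ by rw [hz0, hz1, S.adj'],
      real_inner_self_eq_norm_sq]
    ring
  have c2 : ⟪S.ι (z 1), g 0⟫_ℝ = δ * ⟪S.ι (z 1), S.As (z 0)⟫_ℝ - 1 / ε * ‖S.ι (z 1)‖ ^ 2 := by
    rw [h.g_zero, inner_sub_right, inner_smul_right, inner_smul_right, ← hz1,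
      real_inner_self_eq_norm_sq]
  have b1 : -(S.P * (‖S.ι (z 1)‖ * ‖S.ι (z 0)‖)) ≤ ⟪S.ι (z 1), S.ι (u 0)⟫_ℝ := by
    refine (neg_le_neg ?_).trans (neg_le_of_abs_le (abs_real_inner_le_norm _ _))
    calc ‖S.ι (z 1)‖ * ‖S.ι (u 0)‖ ≤ ‖S.ι (z 1)‖ * (S.P * ‖S.ι (z 0)‖) := by
          gcongr; rw [hz0]; exact S.poincare _ hm
      _ = _ := by ring
  have b2 : -(‖S.A (z 1)‖ * ‖S.ι (z 0)‖) ≤ ⟪S.A (z 1), S.ι (z 0)⟫_ℝ :=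
    neg_le_of_abs_le (abs_real_inner_le_norm _ _)
  have b3 : ⟪S.ι (z 2), S.ι (z 0)⟫_ℝ ≤ (1 + S.b * S.P) * (‖S.ι (z 2)‖ * ‖S.ι (z 0)‖) := by
    refine (real_inner_le_norm _ _).trans (le_mul_of_one_le_left (by positivity) ?_)
    have : 0 ≤ S.b * S.P := by positivity
    linarith
  have b4 : -(‖S.ι (z 1)‖ * ‖S.As (z 0)‖) ≤ ⟪S.ι (z 1), S.As (z 0)⟫_ℝ :=
    neg_le_of_abs_le (abs_real_inner_le_norm _ _)
  have hX := three_terms_le_sum (x := fun k => (k : ℝ) * ‖S.ι (z k)‖ ^ 2)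
    (fun k => by positivity) h.two_le
  have hY := three_terms_le_sum (x := fun k => ‖S.Bd k (z k)‖ ^ 2) (fun k => by positivity) h.two_le
  have hY' : ‖S.As (z 0)‖ ^ 2 + ‖S.A (z 1)‖ ^ 2 ≤
      ∑ k ∈ Finset.range (n + 1), ‖S.Bd k (z k)‖ ^ 2 := by
    have e1 : S.Bd 1 = S.A := S.Bd_succ 0
    simp only [Bd_zero, e1] at hY
    linarith [sq_nonneg ‖S.Bd 2 (z 2)‖]
  have key := dissipation_scalar (x₀ := ‖S.ι (z 0)‖) (x₁ := ‖S.ι (z 1)‖) (x₂ := ‖S.ι (z 2)‖)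
    (y₀ := ‖S.As (z 0)‖) (y₁ := ‖S.A (z 1)‖)
    (X := ∑ k ∈ Finset.range (n + 1), (k : ℝ) * ‖S.ι (z k)‖ ^ 2)
    (Y := ∑ k ∈ Finset.range (n + 1), ‖S.Bd k (z k)‖ ^ 2) hα hδ
    (by simpa using hX) hY' (norm_nonneg _) (norm_nonneg _)
  have hws := weighted_sum_le (x := fun k => ‖S.ι (z k)‖ ^ 2) (fun k => by positivity) n hε hτ
    (le_trans (le_add_of_nonneg_left (by positivity)) hα.le_second)
  -- The source at level `k + 1` contains `u k` with `k ≥ 1`. Young's inequality therefore produces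
  -- `k ‖u k‖²` and never the undamped `‖u 0‖²`.
  have hsrc : -((∑ k ∈ Finset.range (n + 1), (k : ℝ) * ‖S.ι (z k)‖ ^ 2) / (4 * τ)
      + ‖S.c‖ ^ 2 * τ / ε ^ 2 * ∑ k ∈ Finset.range (n + 1), (k : ℝ) * ‖S.ι (u k)‖ ^ 2) ≤
      (1 / ε) * ∑ k ∈ Finset.range (n + 1),
        if 2 ≤ k then √(k : ℝ) * ⟪S.c (S.ι (u (k - 1))), S.ι (z k)⟫_ℝ else 0 := by
    have hterm : ∀ k : ℕ, -(((k + 1 : ℕ) : ℝ) * ‖S.ι (z (k + 1))‖ ^ 2 / (4 * τ)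
        + ‖S.c‖ ^ 2 * τ / ε ^ 2 * ((k : ℝ) * ‖S.ι (u k)‖ ^ 2)) ≤ 1 / ε *
        (if 2 ≤ k + 1 then √((k + 1 : ℕ) : ℝ) * ⟪S.c (S.ι (u k)), S.ι (z (k + 1))⟫_ℝ else 0) := by
      intro k
      split_ifs with hk
      · have hk1 : (1 : ℝ) ≤ k := by exact_mod_cast (by omega : 1 ≤ k)
        have h1 : |⟪S.c (S.ι (u k)), S.ι (z (k + 1))⟫_ℝ| ≤
            ‖S.c‖ * ‖S.ι (u k)‖ * ‖S.ι (z (k + 1))‖ :=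
          (abs_real_inner_le_norm _ _).trans (by gcongr; exact S.c.le_opNorm _)
        have h2 := Real.sq_sqrt (Nat.cast_nonneg (α := ℝ) (k + 1))
        set r := √((k + 1 : ℕ) : ℝ)
        set x := ‖S.ι (u k)‖
        set y := ‖S.ι (z (k + 1))‖
        have h3 : 1 / ε * (r * (‖S.c‖ * x * y)) ≤
            r ^ 2 * y ^ 2 / (4 * τ) + ‖S.c‖ ^ 2 * τ / ε ^ 2 * x ^ 2 := by
          have : 0 ≤ τ * (r * y / (2 * τ) - ‖S.c‖ * x / ε) ^ 2 := by positivity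
          have e : τ * (r * y / (2 * τ) - ‖S.c‖ * x / ε) ^ 2 = r ^ 2 * y ^ 2 / (4 * τ)
            + ‖S.c‖ ^ 2 * τ / ε ^ 2 * x ^ 2 - 1 / ε * (r * (‖S.c‖ * x * y)) := by
            field_simp; ring
          linarith
        have h4 : ‖S.c‖ ^ 2 * τ / ε ^ 2 * x ^ 2 ≤ ‖S.c‖ ^ 2 * τ / ε ^ 2 * ((k : ℝ) * x ^ 2) := by
          gcongr
          exact le_mul_of_one_le_left (sq_nonneg _) hk1
        have h5 : -(1 / ε * (r * (‖S.c‖ * x * y))) ≤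
            1 / ε * (r * ⟪S.c (S.ι (u k)), S.ι (z (k + 1))⟫_ℝ) := by
          rw [← mul_neg, ← mul_neg]
          gcongr
          exact neg_le_of_abs_le h1
        rw [← h2]
        linarith
      · rw [mul_zero, neg_nonpos]
        positivity
    have hle := Finset.sum_le_sum fun k (_ : k ∈ Finset.range n) => hterm k
    rw [Finset.sum_range_succ' _ n, Finset.sum_range_succ (fun k => (k : ℝ) * ‖S.ι (u k)‖ ^ 2),
      Finset.sum_range_succ' (fun k => if 2 ≤ k then _ else _)]
    simp only [Finset.sum_neg_distrib, Finset.sum_add_distrib, ← Finset.mul_sum,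
      ← Finset.sum_div] at hle
    have hlast : 0 ≤ ‖S.c‖ ^ 2 * τ / ε ^ 2 * ((n : ℝ) * ‖S.ι (u n)‖ ^ 2) := by positivity
    simp only [Nat.cast_zero, zero_mul, add_zero, Nat.add_sub_cancel, mul_add,
      show ¬ (2 ≤ 0) by omega, if_false]
    linarith
  rw [h.sum_inner_z_g, c1, c2]
  set X := ∑ k ∈ Finset.range (n + 1), (k : ℝ) * ‖S.ι (z k)‖ ^ 2
  set Y := ∑ k ∈ Finset.range (n + 1), ‖S.Bd k (z k)‖ ^ 2
  have t1 : α * (1 / τ + δ) * -(S.P * (‖S.ι (z 1)‖ * ‖S.ι (z 0)‖)) ≤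
    α * (1 / τ + δ) * ⟪S.ι (z 1), S.ι (u 0)⟫_ℝ := by gcongr
  have t2 : α * δ * -(‖S.A (z 1)‖ * ‖S.ι (z 0)‖) ≤ α * δ * ⟪S.A (z 1), S.ι (z 0)⟫_ℝ := by gcongr
  have t3 : α * √2 / ε * ⟪S.ι (z 2), S.ι (z 0)⟫_ℝ ≤
    α * √2 / ε * ((1 + S.b * S.P) * (‖S.ι (z 2)‖ * ‖S.ι (z 0)‖)) := by gcongr
  have t4 : α * δ * -(‖S.ι (z 1)‖ * ‖S.As (z 0)‖) ≤
    α * δ * ⟪S.ι (z 1), S.As (z 0)⟫_ℝ := by gcongr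
  have hXs : X / (2 * τ) = X / (4 * τ) + X / (4 * τ) := by field_simp; ring
  ring_nf at key hws hsrc t1 t2 t3 t4 hXs ⊢
  linarith

end IsTruncated

/-- Cauchy–Schwarz form of the smallness of the corrector. -/
theorem abs_corrector_le {E : Type*} [NormedAddCommGroup E] [InnerProductSpace ℝ E]
    {α P t : ℝ} (h0 : 0 ≤ α) (hP : α * P ≤ 1 / 2) {x y : E} (hy : ‖y‖ ≤ P * t) (ht : 0 ≤ t) :
    |α * ⟪x, y⟫_ℝ| ≤ (‖x‖ ^ 2 + t ^ 2) / 4 := by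
  rw [abs_mul, abs_of_nonneg h0]
  calc α * |⟪x, y⟫_ℝ| ≤ α * (‖x‖ * (P * t)) := by
        gcongr; exact (abs_real_inner_le_norm _ _).trans (by gcongr)
    _ = α * P * (‖x‖ * t) := by ring
    _ ≤ 1 / 2 * (‖x‖ * t) := by gcongr
    _ ≤ _ := by nlinarith [sq_nonneg (‖x‖ - t)]

theorem two_terms_le_sum {x : ℕ → ℝ} (hx : ∀ k, 0 ≤ x k) {n : ℕ} (hn : 2 ≤ n) :
    x 1 + x 0 ≤ ∑ k ∈ Finset.range (n + 1), x k := by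
  linarith [three_terms_le_sum hx hn, hx 2]

namespace IsTruncated

variable {S : DirichletPair H V} {n : ℕ} {ε τ δ α : ℝ} {u z : ℕ → V} {g : ℕ → H}

/-- The entropy is quadratic: at `f = u + h g` it equals its value at `u`, plus `h` times the
dissipation, plus `h²` times its value at `g`. The last term is nonnegative because `g 0` is
orthogonal to `m`, so implicit Euler loses nothing. -/
theorem entropy_le (hu : S.IsTruncated n ε τ δ u z g)
    (hm : ⟪S.ι (u 0), S.ι S.m⟫_ℝ = 0)
    (hα : AdmissibleWeight S.P (1 + S.b * S.P) ε τ α) (hδ : 0 ≤ δ) {h : ℝ} (hh : 0 ≤ h)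
    (f : ℕ → H) (hf : ∀ k ≤ n, f k = S.ι (u k) + h • g k) :
    (1 + h * (α / (2 * ε) - 4 * δ)) * ((∑ k ∈ Finset.range (n + 1), ‖S.ι (u k)‖ ^ 2) / 2
      + α * ⟪S.ι (u 1), S.G (S.ι (u 0))⟫_ℝ)
      + h * ((∑ k ∈ Finset.range (n + 1), (k : ℝ) * ‖S.ι (u k)‖ ^ 2) / (4 * τ)) ≤
    (∑ k ∈ Finset.range (n + 1), ‖f k‖ ^ 2) / 2 + α * ⟪f 1, S.G (f 0)⟫_ℝ := by
  have hε := hα.ε_pos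
  have hα0 := hα.nonneg
  have h2 := hu.two_le
  have hdis := hu.dissipation_u hm hα hδ
  have hN : ∑ k ∈ Finset.range (n + 1), ‖f k‖ ^ 2 = ∑ k ∈ Finset.range (n + 1), ‖S.ι (u k)‖ ^ 2
      + 2 * h * ∑ k ∈ Finset.range (n + 1), ⟪S.ι (u k), g k⟫_ℝ
      + h ^ 2 * ∑ k ∈ Finset.range (n + 1), ‖g k‖ ^ 2 := by
    rw [Finset.mul_sum, Finset.mul_sum, ← Finset.sum_add_distrib, ← Finset.sum_add_distrib]
    refine Finset.sum_congr rfl fun k hk => ?_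
    rw [hf k (by simpa [Nat.lt_succ_iff] using hk), norm_add_sq_real, inner_smul_right, norm_smul,
      mul_pow, Real.norm_eq_abs, sq_abs]
    ring
  have hC : ⟪f 1, S.G (f 0)⟫_ℝ = ⟪S.ι (u 1), S.G (S.ι (u 0))⟫_ℝ
      + h * (⟪g 1, S.G (S.ι (u 0))⟫_ℝ + ⟪S.ι (u 1), S.G (g 0)⟫_ℝ) + h ^ 2 * ⟪g 1, S.G (g 0)⟫_ℝ := by
    rw [hf 1 (by omega), hf 0 (by omega)]
    simp only [map_add, map_smul, inner_add_left, inner_add_right, inner_smul_left,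
      inner_smul_right, RCLike.conj_to_real]
    ring
  have hg := neg_le_of_abs_le (abs_corrector_le hα0 hα.mul_P_le (x := g 1)
    (S.norm_G_le _ hu.inner_g_zero_m) (norm_nonneg _))
  have hg' := two_terms_le_sum (x := fun k => ‖g k‖ ^ 2) (fun k => sq_nonneg _) h2
  have hx := abs_le.1 (abs_corrector_le hα0 hα.mul_P_le (x := S.ι (u 1))
    (S.norm_G_le _ hm) (norm_nonneg _))
  have hx' := two_terms_le_sum (x := fun k => ‖S.ι (u k)‖ ^ 2) (fun k => sq_nonneg _) h2
  set N := ∑ k ∈ Finset.range (n + 1), ‖S.ι (u k)‖ ^ 2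
  set Q := ∑ k ∈ Finset.range (n + 1), ‖g k‖ ^ 2
  have q1 : 0 ≤ h ^ 2 * (Q / 2 + α * ⟪g 1, S.G (g 0)⟫_ℝ) := by
    have : 0 ≤ Q / 2 + α * ⟪g 1, S.G (g 0)⟫_ℝ := by
      linarith [sq_nonneg ‖g 1‖, sq_nonneg ‖g 0‖]
    positivity
  have q2 : h * (α / (2 * ε)) * (N / 2 + α * ⟪S.ι (u 1), S.G (S.ι (u 0))⟫_ℝ) ≤
      h * (α / (2 * ε)) * N := by
    gcongr
    linarith [sq_nonneg ‖S.ι (u 1)‖, sq_nonneg ‖S.ι (u 0)‖]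
  -- The entropy dominates a quarter of the squared norm, which turns the leftover `δ ‖u 0‖²` into
  -- the loss `4 δ` in the rate.
  have q3 : h * δ * ‖S.ι (u 0)‖ ^ 2 ≤
      h * δ * (4 * (N / 2 + α * ⟪S.ι (u 1), S.G (S.ι (u 0))⟫_ℝ)) := by
    gcongr
    linarith [sq_nonneg ‖S.ι (u 1)‖]
  have q4 := mul_le_mul_of_nonneg_left hdis hh
  rw [hN, hC]
  ring_nf at q1 q2 q3 q4 ⊢
  linarith

theorem entropy_B_le (hu : S.IsTruncated n ε τ δ u z g)
    (hm : ⟪S.ι (u 0), S.ι S.m⟫_ℝ = 0)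
    (hα : AdmissibleWeight S.P (1 + S.b * S.P) ε τ α) (hδ : 0 ≤ δ) {h : ℝ} (hh : 0 < h)
    (f : ℕ → V) (hf : ∀ k ≤ n, S.ι (f k) = S.ι (u k) + h • g k) :
    (1 + h * (α / (2 * ε) - 4 * δ)) * ((∑ k ∈ Finset.range (n + 1), ‖S.B k (u k)‖ ^ 2) / 2
      + α * ⟪S.B 1 (u 1), S.ι (u 0)⟫_ℝ)
      - h * (‖S.c‖ ^ 2 * τ / ε ^ 2 * ∑ k ∈ Finset.range (n + 1), (k : ℝ) * ‖S.ι (u k)‖ ^ 2) ≤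
    (∑ k ∈ Finset.range (n + 1), ‖S.B k (f k)‖ ^ 2) / 2 + α * ⟪S.B 1 (f 1), S.ι (f 0)⟫_ℝ := by
  have hε := hα.ε_pos
  have hα0 := hα.nonneg
  have h2 := hu.two_le
  have hdis := hu.dissipation_z hm hα hδ
  -- For `k ≤ n`, data and solution both lie in `V`, so `g k` has a preimage in `V` and `B k` can be
  -- applied to it.
  set γ : ℕ → V := fun k => h⁻¹ • (f k - u k) with hγ
  have hγg : ∀ k ≤ n, S.ι (γ k) = g k := fun k hk => by
    simp only [hγ]
    rw [map_smul, map_sub, hf k hk, add_sub_cancel_left, inv_smul_smul₀ hh.ne']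
  have hfγ : ∀ k, f k = u k + h • γ k := fun k => by
    simp only [hγ]
    rw [smul_inv_smul₀ hh.ne', add_sub_cancel]
  have hN : ∑ k ∈ Finset.range (n + 1), ‖S.B k (f k)‖ ^ 2 =
      ∑ k ∈ Finset.range (n + 1), ‖S.ι (z k)‖ ^ 2
      + 2 * h * ∑ k ∈ Finset.range (n + 1), ⟪S.Bd k (z k), g k⟫_ℝ
      + h ^ 2 * ∑ k ∈ Finset.range (n + 1), ‖S.B k (γ k)‖ ^ 2 := by
    rw [Finset.mul_sum, Finset.mul_sum, ← Finset.sum_add_distrib, ← Finset.sum_add_distrib]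
    refine Finset.sum_congr rfl fun k hk => ?_
    rw [hfγ k, map_add, map_smul, ← hγg k (by simpa [Nat.lt_succ_iff] using hk), norm_add_sq_real,
      inner_smul_right, norm_smul, mul_pow, Real.norm_eq_abs, sq_abs, S.adj_Bd, hu.z_eq]
    ring
  have e10 : S.B 1 = S.As := S.B_succ 0
  have hz0 : S.ι (z 0) = S.A (u 0) := hu.z_eq 0
  have hz1 : S.ι (z 1) = S.As (u 1) := hu.z_eq 1
  have hC : ⟪S.B 1 (f 1), S.ι (f 0)⟫_ℝ = ⟪S.ι (z 1), S.ι (u 0)⟫_ℝ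
      + h * (⟪g 1, S.ι (z 0)⟫_ℝ + ⟪S.ι (z 1), g 0⟫_ℝ) + h ^ 2 * ⟪S.As (γ 1), S.ι (γ 0)⟫_ℝ := by
    have e1 : ⟪g 1, S.ι (z 0)⟫_ℝ = ⟪S.As (γ 1), S.ι (u 0)⟫_ℝ := by
      rw [← hγg 1 (by omega), hz0, S.adj']
    rw [hfγ 1, hfγ 0, e10, e1, hz1, ← hγg 0 (by omega)]
    simp only [map_add, map_smul, inner_add_left, inner_add_right, inner_smul_left,
      inner_smul_right, RCLike.conj_to_real]
    ring
  have hγ0 : ⟪S.ι (γ 0), S.ι S.m⟫_ℝ = 0 := by rw [hγg 0 (by omega), hu.inner_g_zero_m]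
  have hg := neg_le_of_abs_le (abs_corrector_le hα0 hα.mul_P_le (x := S.As (γ 1))
    (S.poincare _ hγ0) (norm_nonneg _))
  have hg' := two_terms_le_sum (x := fun k => ‖S.B k (γ k)‖ ^ 2) (fun k => sq_nonneg _) h2
  have hx := abs_le.1 (abs_corrector_le hα0 hα.mul_P_le (x := S.ι (z 1))
    (S.poincare _ hm) (norm_nonneg _))
  have hx' := two_terms_le_sum (x := fun k => ‖S.ι (z k)‖ ^ 2) (fun k => sq_nonneg _) h2
  have hzB : ∑ k ∈ Finset.range (n + 1), ‖S.B k (u k)‖ ^ 2 =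
      ∑ k ∈ Finset.range (n + 1), ‖S.ι (z k)‖ ^ 2 := by simp only [hu.z_eq]
  simp only [e10, B_zero] at hg' hx'
  rw [← hz0] at hx
  rw [hzB, hN, hC, e10, ← hz1]
  set N := ∑ k ∈ Finset.range (n + 1), ‖S.ι (z k)‖ ^ 2
  set Q := ∑ k ∈ Finset.range (n + 1), ‖S.B k (γ k)‖ ^ 2
  have q1 : 0 ≤ h ^ 2 * (Q / 2 + α * ⟪S.As (γ 1), S.ι (γ 0)⟫_ℝ) := by
    have : 0 ≤ Q / 2 + α * ⟪S.As (γ 1), S.ι (γ 0)⟫_ℝ := by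
      linarith [sq_nonneg ‖S.As (γ 1)‖, sq_nonneg ‖S.A (γ 0)‖]
    positivity
  have q2 : h * (α / (2 * ε)) * (N / 2 + α * ⟪S.ι (z 1), S.ι (u 0)⟫_ℝ) ≤
      h * (α / (2 * ε)) * N := by
    gcongr
    linarith [sq_nonneg ‖S.ι (z 1)‖, sq_nonneg ‖S.ι (z 0)‖]
  have q3 : h * δ * ‖S.ι (z 0)‖ ^ 2 ≤
      h * δ * (4 * (N / 2 + α * ⟪S.ι (z 1), S.ι (u 0)⟫_ℝ)) := by
    gcongr
    linarith [sq_nonneg ‖S.ι (z 1)‖]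
  have q4 := mul_le_mul_of_nonneg_left hdis hh.le
  ring_nf at q1 q2 q3 q4 ⊢
  linarith

end IsTruncated

end Estimates

end DirichletPair

/-! ### Square-summable sequences and weak limits along ultrafilters -/

section HilbertSum

variable {H : Type*} [NormedAddCommGroup H] [InnerProductSpace ℝ H]

theorem hasSum_norm_sq (x : lp (fun _ : ℕ => H) 2) : HasSum (fun k => ‖x k‖ ^ 2) (‖x‖ ^ 2) := by
  simpa [real_inner_self_eq_norm_sq] using lp.hasSum_inner (𝕜 := ℝ) x x

theorem sum_norm_sq_le (x : lp (fun _ : ℕ => H) 2) (s : Finset ℕ) :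
    ∑ k ∈ s, ‖x k‖ ^ 2 ≤ ‖x‖ ^ 2 :=
  sum_le_hasSum s (fun _ _ => sq_nonneg _) (hasSum_norm_sq x)

theorem norm_sq_add_norm_sq_le (x : lp (fun _ : ℕ => H) 2) : ‖x 1‖ ^ 2 + ‖x 0‖ ^ 2 ≤ ‖x‖ ^ 2 := by
  have := sum_norm_sq_le x (Finset.range 2)
  simp only [Finset.sum_range_succ, Finset.sum_range_zero] at this
  linarith

theorem tendsto_norm_apply (x : lp (fun _ : ℕ => H) 2) :
    Tendsto (fun k => ‖x k‖) atTop (𝓝 0) := by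
  have h := (hasSum_norm_sq x).summable.tendsto_atTop_zero
  have := (Real.continuous_sqrt.tendsto 0).comp h
  simpa [Function.comp_def, Real.sqrt_sq (norm_nonneg _)] using this

theorem exists_lp_of_finite (x : ℕ → H) (n : ℕ) (hx : ∀ k, n < k → x k = 0) :
    ∃ X : lp (fun _ : ℕ => H) 2, (∀ k, X k = x k) ∧
      ‖X‖ ^ 2 = ∑ k ∈ Finset.range (n + 1), ‖x k‖ ^ 2 := by
  have hX : ∀ k, (∑ j ∈ Finset.range (n + 1), lp.single (E := fun _ : ℕ => H) 2 j (x j)) k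
      = x k := fun k => by
    simp only [lp.coeFn_sum, Finset.sum_apply, lp.coeFn_single]
    rw [Finset.sum_pi_single]
    split_ifs with h
    · rfl
    · exact (hx k (by simpa [Nat.lt_succ_iff] using h)).symm
  refine ⟨_, hX, ?_⟩
  refine (hasSum_norm_sq _).unique ?_
  simp only [hX]
  refine hasSum_sum_of_ne_finset_zero fun k hk => ?_
  rw [hx k (by simpa [Nat.lt_succ_iff] using hk)]
  simp

variable {E : Type*} [NormedAddCommGroup E] [InnerProductSpace ℝ E] [CompleteSpace E]

/-- Bounded sequences in a Hilbert space converge weakly along ultrafilters. -/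
theorem exists_weak_limit {ι : Type*} (F : Ultrafilter ι) (x : ι → E) (C : ℝ)
    (hx : ∀ᶠ i in (F : Filter ι), ‖x i‖ ≤ C) :
    ∃ y : E, ∀ w, Tendsto (fun i => ⟪x i, w⟫_ℝ) F (𝓝 ⟪y, w⟫_ℝ) := by
  have hK := WeakDual.isCompact_closedBall (𝕜 := ℝ) (E := E) 0 C
  let T : ι → WeakDual ℝ E := fun i => StrongDual.toWeakDual (InnerProductSpace.toDual ℝ E (x i))
  obtain ⟨y, -, hy⟩ := hK.ultrafilter_le_nhds (F.map T) (by
    rw [le_principal_iff]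
    change ∀ᶠ i in (F : Filter ι), _
    filter_upwards [hx] with i hi
    simpa [T] using hi)
  refine ⟨(InnerProductSpace.toDual ℝ E).symm (WeakDual.toStrongDual y), fun w => ?_⟩
  rw [InnerProductSpace.toDual_symm_apply]
  have h1 : Tendsto T F (𝓝 y) := hy
  exact ((WeakDual.eval_continuous w).tendsto y).comp h1

end HilbertSum

/-! ### The resolvent of the full Hermite system -/

namespace DirichletPair

section Resolvent

variable {H V : Type*} [NormedAddCommGroup H] [InnerProductSpace ℝ H]
    [NormedAddCommGroup V] [InnerProductSpace ℝ V]

/-- `u` is a weak solution of the resolvent equation `u - h 𝓛 u = f` of the generator `𝓛` of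
the Hermite system. -/
def IsResolvent (S : DirichletPair H V) (ε τ h : ℝ) (f u : lp (fun _ : ℕ => H) 2) : Prop :=
  ∀ (k : ℕ) (v : V), (1 + h / τ * k) * ⟪u k, S.ι v⟫_ℝ
    + h / ε * (√(k : ℝ) * ⟪u (k - 1), S.As v⟫_ℝ - √((k : ℝ) + 1) * ⟪u (k + 1), S.A v⟫_ℝ)
    = ⟪f k, S.ι v⟫_ℝ

variable (S : DirichletPair H V) {ε τ h : ℝ}

theorem IsResolvent.unique [CompleteSpace V] (hε : 0 < ε) (hτ : 0 < τ) (hh : 0 < h)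
    (hs : h * (1 + ‖S.c‖) < ε) {f u u' : lp (fun _ : ℕ => H) 2} (hu : S.IsResolvent ε τ h f u)
    (hu' : S.IsResolvent ε τ h f u') : u = u' := by
  rw [← sub_eq_zero]
  ext k
  refine S.eq_zero_of_weak_stationary (a := h / τ) (s := h / ε) (by positivity) ?_
    (fun k => (u - u') k) (tendsto_norm_apply _) (fun k v => ?_) k
  · rw [abs_of_pos (by positivity), div_mul_eq_mul_div, div_lt_one hε]
    exact hs
  · have h1 := hu k v
    have h2 := hu' k v
    simp only [lp.coeFn_sub, Pi.sub_apply, inner_sub_left]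
    linarith

theorem exists_truncated [CompleteSpace V] (hτ : 0 < τ) (hh : 0 < h) {δ : ℝ} (hδ : 0 < δ) {n : ℕ}
    (hn : 2 ≤ n) (f : ℕ → H) :
    ∃ (u z : ℕ → V) (g : ℕ → H), S.IsTruncated n ε τ δ u z g ∧ ∀ k, f k = S.ι (u k) + h • g k := by
  obtain ⟨u, z, h1, h2, h3⟩ := S.exists_galerkin n (a := h / τ) (d := h * δ) (by positivity)
    (by positivity) (h / ε) f
  have hg : ∀ k, f k = S.ι (u k) + h • (h⁻¹ • (f k - S.ι (u k))) := fun k => by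
    rw [smul_inv_smul₀ hh.ne', add_sub_cancel]
  refine ⟨u, z, fun k => h⁻¹ • (f k - S.ι (u k)), ⟨hn, h1, h2, fun k hk => ?_⟩, hg⟩
  rw [inv_smul_eq_iff₀ hh.ne', ← h3 k hk]
  match_scalars <;> field_simp; ring

theorem IsTruncated.inner_zero_m {S : DirichletPair H V} {δ : ℝ} {n : ℕ} {u z : ℕ → V} {g : ℕ → H}
    (hu : S.IsTruncated n ε τ δ u z g) {f : ℕ → H} (hf : ∀ k, f k = S.ι (u k) + h • g k) :
    ⟪S.ι (u 0), S.ι S.m⟫_ℝ = ⟪f 0, S.ι S.m⟫_ℝ := by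
  rw [hf 0, inner_add_left, inner_smul_left, hu.inner_g_zero_m]
  simp

theorem IsTruncated.energy_le {S : DirichletPair H V} {δ : ℝ} {n : ℕ} {u z : ℕ → V} {g : ℕ → H}
    (hu : S.IsTruncated n ε τ δ u z g) (hτ : 0 < τ) (hh : 0 < h) (hδ : 0 < δ)
    {f : lp (fun _ : ℕ => H) 2} (hf : ∀ k, f k = S.ι (u k) + h • g k) :
    (∑ k ∈ Finset.range (n + 1), ‖S.ι (u k)‖ ^ 2) ≤ ‖f‖ ^ 2 ∧
    h * δ * (∑ k ∈ Finset.range (n + 1), ‖S.ι (z k)‖ ^ 2) ≤ ‖f‖ ^ 2 := by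
  have h1 := hu.sum_inner_u_g
  have h2 : ∑ k ∈ Finset.range (n + 1), ⟪S.ι (u k), f k⟫_ℝ =
      ∑ k ∈ Finset.range (n + 1), ‖S.ι (u k)‖ ^ 2
        + h * ∑ k ∈ Finset.range (n + 1), ⟪S.ι (u k), g k⟫_ℝ := by
    rw [Finset.mul_sum, ← Finset.sum_add_distrib]
    refine Finset.sum_congr rfl fun k _ => ?_
    rw [hf k, inner_add_right, inner_smul_right, real_inner_self_eq_norm_sq]
  have h3 : ∑ k ∈ Finset.range (n + 1), ⟪S.ι (u k), f k⟫_ℝ ≤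
      (∑ k ∈ Finset.range (n + 1), ‖S.ι (u k)‖ ^ 2) / 2 + ‖f‖ ^ 2 / 2 := by
    have h4 := sum_norm_sq_le f (Finset.range (n + 1))
    have h5 : ∑ k ∈ Finset.range (n + 1), ⟪S.ι (u k), f k⟫_ℝ ≤
      ∑ k ∈ Finset.range (n + 1), (‖S.ι (u k)‖ ^ 2 / 2 + ‖f k‖ ^ 2 / 2) := by
      refine Finset.sum_le_sum fun k _ => (real_inner_le_norm _ _).trans ?_
      nlinarith [sq_nonneg (‖S.ι (u k)‖ - ‖f k‖)]
    rw [Finset.sum_add_distrib, ← Finset.sum_div, ← Finset.sum_div] at h5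
    linarith
  have p1 : 0 ≤ h * ((1 / τ + δ) * ∑ k ∈ Finset.range (n + 1), (k : ℝ) * ‖S.ι (u k)‖ ^ 2) := by
    positivity
  have p2 : 0 ≤ h * (δ * ∑ k ∈ Finset.range (n + 1), ‖S.ι (z k)‖ ^ 2) := by positivity
  have p3 : 0 ≤ ∑ k ∈ Finset.range (n + 1), ‖S.ι (u k)‖ ^ 2 := by positivity
  rw [h1, mul_add] at h2
  constructor <;> nlinarith

/-- The resolvent equation is the weak limit of the truncated regularized equations. -/
theorem exists_approx [CompleteSpace H] [CompleteSpace V] (hτ : 0 < τ) (hh : 0 < h)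
    (f : lp (fun _ : ℕ => H) 2) :
    ∃ (u z : ℕ → ℕ → V) (g : ℕ → ℕ → H) (U : ℕ → lp (fun _ : ℕ => H) 2)
      (x : lp (fun _ : ℕ => H) 2),
      (∀ n, S.IsTruncated (n + 2) ε τ (1 / ((n : ℝ) + 1)) (u n) (z n) (g n)) ∧
      (∀ n k, f k = S.ι (u n k) + h • g n k) ∧
      (∀ n k, U n k = S.ι (u n k)) ∧ (∀ n, ‖U n‖ ≤ ‖f‖) ∧
      (∀ n, ‖U n‖ ^ 2 = ∑ k ∈ Finset.range (n + 2 + 1), ‖S.ι (u n k)‖ ^ 2) ∧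
      (∀ w, Tendsto (fun n => ⟪U n, w⟫_ℝ) (hyperfilter ℕ) (𝓝 ⟪x, w⟫_ℝ)) ∧
      S.IsResolvent ε τ h f x := by
  -- Truncation at level `n + 2` and regularization `1 / (n + 1)` are removed together. The shift by
  -- two keeps components `0, 1, 2` inside the truncated system.
  have h0 : ∀ n : ℕ, (0 : ℝ) < 1 / ((n : ℝ) + 1) := fun n => by positivity
  choose u z g hu hf using fun n : ℕ =>
    S.exists_truncated (ε := ε) hτ hh (h0 n) (n := n + 2) (by omega) f
  choose U hU hUn using fun n : ℕ => exists_lp_of_finite (fun k => S.ι (u n k)) (n + 2)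
    (fun k hk => by rw [(hu n).zero k hk, map_zero])
  have hUf : ∀ n, ‖U n‖ ≤ ‖f‖ := fun n => by
    have := ((hu n).energy_le hτ hh (h0 n) (hf n)).1
    rw [← hUn n] at this
    exact le_of_sq_le_sq this (norm_nonneg _)
  obtain ⟨x, hx⟩ := exists_weak_limit (hyperfilter ℕ) U ‖f‖ (Eventually.of_forall hUf)
  refine ⟨u, z, g, U, x, hu, hf, hU, hUf, hUn, hx, fun k v => ?_⟩
  have hcomp : ∀ j (w : H), Tendsto (fun n => ⟪S.ι (u n j), w⟫_ℝ) (hyperfilter ℕ)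
      (𝓝 ⟪x j, w⟫_ℝ) := fun j w => by
    have := hx (lp.single 2 j w)
    simpa [lp.inner_single_right, hU] using this
  have hle : (hyperfilter ℕ : Filter ℕ) ≤ atTop := Nat.hyperfilter_le_atTop
  have hδ : Tendsto (fun n : ℕ => 1 / ((n : ℝ) + 1)) (hyperfilter ℕ) (𝓝 0) :=
    tendsto_one_div_add_atTop_nhds_zero_nat.mono_left hle
  -- With `δ = 1 / (n + 1)`, the energy estimate bounds only `√(h δ) ‖z‖`; the spare factor `√(h δ)`
  -- sends the regularizing term to zero.
  have hz : Tendsto (fun n : ℕ => h * (1 / ((n : ℝ) + 1)) * ⟪S.ι (z n k), S.B k v⟫_ℝ)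
      (hyperfilter ℕ) (𝓝 0) := by
    have hb : Tendsto (fun n : ℕ => √(h * (1 / ((n : ℝ) + 1))) * (‖f‖ * ‖S.B k v‖))
        (hyperfilter ℕ) (𝓝 0) := by
      have := ((Real.continuous_sqrt.tendsto _).comp (hδ.const_mul h)).mul_const
        (‖f‖ * ‖S.B k v‖)
      simpa using this
    refine squeeze_zero_norm' ?_ hb
    filter_upwards [hle (eventually_ge_atTop k)] with n hn
    have hd : 0 < h * (1 / ((n : ℝ) + 1)) := mul_pos hh (h0 n)
    have h1 := ((hu n).energy_le hτ hh (h0 n) (hf n)).2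
    have h2 : ‖S.ι (z n k)‖ ^ 2 ≤ ∑ k ∈ Finset.range (n + 2 + 1), ‖S.ι (z n k)‖ ^ 2 :=
      Finset.single_le_sum (f := fun k => ‖S.ι (z n k)‖ ^ 2) (fun _ _ => sq_nonneg _)
        (Finset.mem_range.2 (by omega))
    have h3 : √(h * (1 / ((n : ℝ) + 1))) * ‖S.ι (z n k)‖ ≤ ‖f‖ := by
      apply le_of_sq_le_sq _ (norm_nonneg _)
      rw [mul_pow, Real.sq_sqrt hd.le]
      exact (mul_le_mul_of_nonneg_left h2 hd.le).trans h1
    rw [norm_mul, Real.norm_of_nonneg hd.le, Real.norm_eq_abs]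
    calc h * (1 / ((n : ℝ) + 1)) * |⟪S.ι (z n k), S.B k v⟫_ℝ|
        ≤ h * (1 / ((n : ℝ) + 1)) * (‖S.ι (z n k)‖ * ‖S.B k v‖) := by
          gcongr; exact abs_real_inner_le_norm _ _
      _ = √(h * (1 / ((n : ℝ) + 1))) * ((√(h * (1 / ((n : ℝ) + 1))) * ‖S.ι (z n k)‖)
          * ‖S.B k v‖) := by
          nth_rw 1 [← Real.mul_self_sqrt hd.le]; ring
      _ ≤ _ := by gcongr
  have hlim : Tendsto (fun n : ℕ => (1 + h / τ * k + h * (1 / ((n : ℝ) + 1)) * k)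
      * ⟪S.ι (u n k), S.ι v⟫_ℝ + h * (1 / ((n : ℝ) + 1)) * ⟪S.ι (z n k), S.B k v⟫_ℝ
      + h / ε * (√(k : ℝ) * ⟪S.ι (u n (k - 1)), S.As v⟫_ℝ
        - √((k : ℝ) + 1) * ⟪S.ι (u n (k + 1)), S.A v⟫_ℝ)) (hyperfilter ℕ)
      (𝓝 ((1 + h / τ * k + h * 0 * k) * ⟪x k, S.ι v⟫_ℝ + 0 + h / ε * (√(k : ℝ)
        * ⟪x (k - 1), S.As v⟫_ℝ - √((k : ℝ) + 1) * ⟪x (k + 1), S.A v⟫_ℝ))) :=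
    (((((hδ.const_mul h).mul_const _).const_add _).mul (hcomp _ _)).add hz).add
      ((((hcomp _ _).const_mul _).sub ((hcomp _ _).const_mul _)).const_mul _)
  have heq : ∀ᶠ n : ℕ in (hyperfilter ℕ : Filter ℕ), (1 + h / τ * k + h * (1 / ((n : ℝ) + 1)) * k)
      * ⟪S.ι (u n k), S.ι v⟫_ℝ + h * (1 / ((n : ℝ) + 1)) * ⟪S.ι (z n k), S.B k v⟫_ℝ
      + h / ε * (√(k : ℝ) * ⟪S.ι (u n (k - 1)), S.As v⟫_ℝ
        - √((k : ℝ) + 1) * ⟪S.ι (u n (k + 1)), S.A v⟫_ℝ) = ⟪f k, S.ι v⟫_ℝ := by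
    filter_upwards [hle (eventually_ge_atTop k)] with n hn
    rw [hf n k, (hu n).eq k (by omega)]
    simp only [inner_add_left, inner_sub_left, inner_smul_left, RCLike.conj_to_real, smul_add,
      smul_sub]
    rw [S.adj_Bd, S.adj, S.adj']
    ring
  have := tendsto_nhds_unique hlim (tendsto_const_nhds.congr' (heq.mono fun n hn => hn.symm))
  simpa using this

/-- A weak solution cannot be tested against itself. By uniqueness it is the weak limit of the
truncated solutions, whose norms are bounded by `‖f‖`. -/
theorem IsResolvent.norm_le [CompleteSpace H] [CompleteSpace V] (hε : 0 < ε) (hτ : 0 < τ)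
    (hh : 0 < h) (hs : h * (1 + ‖S.c‖) < ε) {f u : lp (fun _ : ℕ => H) 2}
    (hu : S.IsResolvent ε τ h f u) : ‖u‖ ≤ ‖f‖ := by
  obtain ⟨-, -, -, U, x, -, -, -, hU, -, hx, hres⟩ := S.exists_approx (ε := ε) hτ hh f
  obtain rfl := IsResolvent.unique S hε hτ hh hs hu hres
  have h1 : ‖u‖ ^ 2 ≤ ‖f‖ * ‖u‖ := by
    rw [← real_inner_self_eq_norm_sq]
    exact le_of_tendsto (hx u) (Eventually.of_forall fun n =>
      (real_inner_le_norm _ _).trans (by gcongr; exact hU n))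
  rcases (norm_nonneg u).eq_or_lt with h2 | h2
  · rw [← h2]; positivity
  · rw [sq] at h1; exact le_of_mul_le_mul_right h1 h2

theorem exists_isResolvent [CompleteSpace H] [CompleteSpace V] (hτ : 0 < τ) (hh : 0 < h)
    (f : lp (fun _ : ℕ => H) 2) : ∃ u, S.IsResolvent ε τ h f u := by
  obtain ⟨-, -, -, -, x, -, -, -, -, -, -, hres⟩ := S.exists_approx (ε := ε) hτ hh f
  exact ⟨x, hres⟩

end Resolvent

end DirichletPair

theorem tendsto_inner_apply {H : Type*} [NormedAddCommGroup H] [InnerProductSpace ℝ H]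
    {l : Filter ℕ} {x : ℕ → lp (fun _ : ℕ => H) 2}
    {y : lp (fun _ : ℕ => H) 2} (hx : ∀ w, Tendsto (fun n => ⟪x n, w⟫_ℝ) l (𝓝 ⟪y, w⟫_ℝ))
    (j : ℕ) (w : H) : Tendsto (fun n => ⟪x n j, w⟫_ℝ) l (𝓝 ⟪y j, w⟫_ℝ) := by
  have := hx (lp.single 2 j w)
  simpa [lp.inner_single_right] using this

/-! ### Modified entropies: equivalence with norms, weak closedness, one resolvent step -/

namespace DirichletPair

variable {H V : Type*} [NormedAddCommGroup H] [InnerProductSpace ℝ H] [CompleteSpace H]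
    [NormedAddCommGroup V] [InnerProductSpace ℝ V] [CompleteSpace V] (S : DirichletPair H V)

/-- The modified entropy. -/
noncomputable def entropy (α : ℝ) (x : lp (fun _ : ℕ => H) 2) : ℝ :=
  ‖x‖ ^ 2 / 2 + α * ⟪x 1, S.G (x 0)⟫_ℝ

/-- The modified entropy of first order; `F` stands for the sequence of the `B k (x k)`. -/
noncomputable def entropyB (α γ : ℝ) (F x : lp (fun _ : ℕ => H) 2) : ℝ :=
  ‖F‖ ^ 2 / 2 + α * ⟪F 1, x 0⟫_ℝ + γ * S.entropy α x

/-- `F` is the sequence of the `B k (x k)`. -/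
def IsBOf (F x : lp (fun _ : ℕ => H) 2) : Prop :=
  ∃ X : ℕ → V, (∀ k, S.ι (X k) = x k) ∧ ∀ k, F k = S.B k (X k)

/-- Sublevel sets of the modified entropy. -/
def EntropyLe (α M : ℝ) (x : lp (fun _ : ℕ => H) 2) : Prop :=
  ⟪x 0, S.ι S.m⟫_ℝ = 0 ∧ S.entropy α x ≤ M

/-- Sublevel sets of the modified entropy of first order. -/
def EntropyBLe (α γ M : ℝ) (x : lp (fun _ : ℕ => H) 2) : Prop :=
  ⟪x 0, S.ι S.m⟫_ℝ = 0 ∧ ∃ F, S.IsBOf F x ∧ S.entropyB α γ F x ≤ M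

variable {S} {ε τ α : ℝ}

theorem abs_corrector_entropy_le (hα : AdmissibleWeight S.P (1 + S.b * S.P) ε τ α)
    {x : lp (fun _ : ℕ => H) 2} (hx : ⟪x 0, S.ι S.m⟫_ℝ = 0) :
    |α * ⟪x 1, S.G (x 0)⟫_ℝ| ≤ ‖x‖ ^ 2 / 4 := by
  have h1 := abs_corrector_le hα.nonneg hα.mul_P_le (x := x 1) (S.norm_G_le _ hx) (norm_nonneg _)
  have h2 := norm_sq_add_norm_sq_le x
  linarith

theorem le_entropy (hα : AdmissibleWeight S.P (1 + S.b * S.P) ε τ α)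
    {x : lp (fun _ : ℕ => H) 2} (hx : ⟪x 0, S.ι S.m⟫_ℝ = 0) :
    ‖x‖ ^ 2 / 4 ≤ S.entropy α x := by
  have := abs_le.1 (abs_corrector_entropy_le hα hx)
  unfold entropy; linarith

theorem entropy_le (hα : AdmissibleWeight S.P (1 + S.b * S.P) ε τ α)
    {x : lp (fun _ : ℕ => H) 2} (hx : ⟪x 0, S.ι S.m⟫_ℝ = 0) :
    S.entropy α x ≤ 3 / 4 * ‖x‖ ^ 2 := by
  have := abs_le.1 (abs_corrector_entropy_le hα hx)
  unfold entropy; linarith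

theorem abs_corrector_entropyB_le (hα : AdmissibleWeight S.P (1 + S.b * S.P) ε τ α)
    {F x : lp (fun _ : ℕ => H) 2} (hx : ⟪x 0, S.ι S.m⟫_ℝ = 0) (hF : S.IsBOf F x) :
    |α * ⟪F 1, x 0⟫_ℝ| ≤ ‖F‖ ^ 2 / 4 := by
  obtain ⟨X, hX, hFX⟩ := hF
  have h0 : F 0 = S.A (X 0) := hFX 0
  have h1 := abs_corrector_le hα.nonneg hα.mul_P_le (x := F 1) (y := x 0) (t := ‖F 0‖)
    (by rw [← hX 0, h0]; exact S.poincare _ (by rw [hX 0]; exact hx)) (norm_nonneg _)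
  have h2 := norm_sq_add_norm_sq_le F
  linarith

theorem le_entropyB (hα : AdmissibleWeight S.P (1 + S.b * S.P) ε τ α) {γ : ℝ} (hγ : 0 ≤ γ)
    {F x : lp (fun _ : ℕ => H) 2} (hx : ⟪x 0, S.ι S.m⟫_ℝ = 0) (hF : S.IsBOf F x) :
    ‖F‖ ^ 2 / 4 ≤ S.entropyB α γ F x := by
  have h1 := abs_le.1 (abs_corrector_entropyB_le hα hx hF)
  have h2 := mul_nonneg hγ ((div_nonneg (sq_nonneg ‖x‖) (by norm_num)).trans (le_entropy hα hx))
  unfold entropyB; linarith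

theorem entropyB_le (hα : AdmissibleWeight S.P (1 + S.b * S.P) ε τ α) {γ : ℝ} (hγ : 0 ≤ γ)
    {F x : lp (fun _ : ℕ => H) 2} (hx : ⟪x 0, S.ι S.m⟫_ℝ = 0) (hF : S.IsBOf F x) :
    S.entropyB α γ F x ≤ 3 / 4 * (‖F‖ ^ 2 + γ * ‖x‖ ^ 2) := by
  have h1 := abs_le.1 (abs_corrector_entropyB_le hα hx hF)
  have h2 := mul_le_mul_of_nonneg_left (entropy_le hα hx) hγ
  unfold entropyB; linarith

section WeakLimit

variable {l : Filter ℕ} {x : ℕ → lp (fun _ : ℕ => H) 2} {y : lp (fun _ : ℕ => H) 2}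

/-- For a quadratic form this difference is affine in `x n`, so weak convergence suffices. -/
theorem tendsto_entropy_sub (hx : ∀ w, Tendsto (fun n => ⟪x n, w⟫_ℝ) l (𝓝 ⟪y, w⟫_ℝ)) :
    Tendsto (fun n => S.entropy α (x n) - S.entropy α (x n - y)) l (𝓝 (S.entropy α y)) := by
  have h1 : ∀ n, S.entropy α (x n) - S.entropy α (x n - y) = ⟪x n, y⟫_ℝ
      + α * (⟪x n 1, S.G (y 0)⟫_ℝ + ⟪x n 0, ContinuousLinearMap.adjoint S.G (y 1)⟫_ℝ)
      - S.entropy α y := fun n => by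
    rw [ContinuousLinearMap.adjoint_inner_right]
    simp only [entropy, norm_sub_sq_real, lp.coeFn_sub, Pi.sub_apply, map_sub, inner_sub_left,
      inner_sub_right, real_inner_comm (y 1)]
    ring
  simp only [h1]
  have h2 := ((hx y).add (((tendsto_inner_apply hx 1 (S.G (y 0))).add
    (tendsto_inner_apply hx 0 (ContinuousLinearMap.adjoint S.G (y 1)))).const_mul α)).sub_const
    (S.entropy α y)
  convert h2 using 2
  rw [ContinuousLinearMap.adjoint_inner_right, real_inner_self_eq_norm_sq,
    real_inner_comm (S.G (y 0))]
  unfold entropy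
  rw [real_inner_comm (S.G (y 0))]
  ring

theorem inner_zero_m_of_tendsto [l.NeBot]
    (hx : ∀ w, Tendsto (fun n => ⟪x n, w⟫_ℝ) l (𝓝 ⟪y, w⟫_ℝ))
    (h0 : ∀ᶠ n in l, ⟪x n 0, S.ι S.m⟫_ℝ = 0) : ⟪y 0, S.ι S.m⟫_ℝ = 0 :=
  tendsto_nhds_unique (tendsto_inner_apply hx 0 _) (tendsto_const_nhds.congr'
    (h0.mono fun _ h => h.symm))

/-- Weak lower semicontinuity: the discarded entropy of `x n - y` is nonnegative, since its zeroth
component is orthogonal to `m`. -/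
theorem EntropyLe.of_tendsto [l.NeBot] (hα : AdmissibleWeight S.P (1 + S.b * S.P) ε τ α)
    (hx : ∀ w, Tendsto (fun n => ⟪x n, w⟫_ℝ) l (𝓝 ⟪y, w⟫_ℝ)) {m : ℕ → ℝ} {M : ℝ}
    (hm : Tendsto m l (𝓝 M)) (h : ∀ᶠ n in l, S.EntropyLe α (m n) (x n)) :
    S.EntropyLe α M y := by
  have hy := inner_zero_m_of_tendsto hx (h.mono fun _ h => h.1)
  refine ⟨hy, le_of_tendsto_of_tendsto (tendsto_entropy_sub hx) hm ?_⟩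
  filter_upwards [h] with n hn
  have h0 : ⟪(x n - y) 0, S.ι S.m⟫_ℝ = 0 := by
    simp only [lp.coeFn_sub, Pi.sub_apply, inner_sub_left, hn.1, hy, sub_zero]
  have h1 := (div_nonneg (sq_nonneg ‖x n - y‖) (by norm_num)).trans (le_entropy hα h0)
  linarith [hn.2]

theorem tendsto_entropyB_sub {γ : ℝ} {F : ℕ → lp (fun _ : ℕ => H) 2} {G : lp (fun _ : ℕ => H) 2}
    (hx : ∀ w, Tendsto (fun n => ⟪x n, w⟫_ℝ) l (𝓝 ⟪y, w⟫_ℝ))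
    (hF : ∀ w, Tendsto (fun n => ⟪F n, w⟫_ℝ) l (𝓝 ⟪G, w⟫_ℝ)) :
    Tendsto (fun n => S.entropyB α γ (F n) (x n) - S.entropyB α γ (F n - G) (x n - y)) l
      (𝓝 (S.entropyB α γ G y)) := by
  have h1 : ∀ n, S.entropyB α γ (F n) (x n) - S.entropyB α γ (F n - G) (x n - y) = ⟪F n, G⟫_ℝ
      + α * (⟪F n 1, y 0⟫_ℝ + ⟪x n 0, G 1⟫_ℝ) - (‖G‖ ^ 2 / 2 + α * ⟪G 1, y 0⟫_ℝ)
      + γ * (S.entropy α (x n) - S.entropy α (x n - y)) := fun n => by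
    simp only [entropyB, norm_sub_sq_real, lp.coeFn_sub, Pi.sub_apply, inner_sub_left,
      inner_sub_right, real_inner_comm (G 1)]
    ring
  simp only [h1]
  have h2 := (((hF G).add (((tendsto_inner_apply hF 1 (y 0)).add
    (tendsto_inner_apply hx 0 (G 1))).const_mul α)).sub_const
    (‖G‖ ^ 2 / 2 + α * ⟪G 1, y 0⟫_ℝ)).add ((tendsto_entropy_sub (S := S) (α := α) hx).const_mul γ)
  convert h2 using 2
  rw [real_inner_self_eq_norm_sq, real_inner_comm (G 1) (y 0)]
  unfold entropyB
  ring

theorem IsBOf.sub {F G x y : lp (fun _ : ℕ => H) 2} (h : S.IsBOf F x) (h' : S.IsBOf G y) :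
    S.IsBOf (F - G) (x - y) := by
  obtain ⟨X, h1, h2⟩ := h
  obtain ⟨Y, h3, h4⟩ := h'
  exact ⟨fun k => X k - Y k, fun k => by simp [h1, h3], fun k => by simp [h2, h4]⟩

theorem IsBOf.of_tendsto [l.NeBot] {F : ℕ → lp (fun _ : ℕ => H) 2} {G : lp (fun _ : ℕ => H) 2}
    (hx : ∀ w, Tendsto (fun n => ⟪x n, w⟫_ℝ) l (𝓝 ⟪y, w⟫_ℝ))
    (hF : ∀ w, Tendsto (fun n => ⟪F n, w⟫_ℝ) l (𝓝 ⟪G, w⟫_ℝ))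
    (h : ∀ᶠ n in l, S.IsBOf (F n) (x n)) : S.IsBOf G y := by
  have hk : ∀ k, ∃ u, S.ι u = y k ∧ S.B k u = G k := fun k => by
    refine S.closed_B k _ _ fun v => ?_
    refine tendsto_nhds_unique (tendsto_inner_apply hx k (S.Bd k v))
      ((tendsto_inner_apply hF k (S.ι v)).congr' ?_)
    filter_upwards [h] with n hn
    obtain ⟨X, h1, h2⟩ := hn
    rw [h2, ← h1, S.adj_B]
  choose X h1 h2 using hk
  exact ⟨X, h1, fun k => (h2 k).symm⟩

/-- The entropy bound controls the derivative sequences, so they have a weak limit along the same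
ultrafilter; closedness of `B k` identifies that limit. Hence finiteness of the derivative norm is
part of what passes to the limit. -/
theorem EntropyBLe.of_tendsto {F : Ultrafilter ℕ} (hα : AdmissibleWeight S.P (1 + S.b * S.P) ε τ α)
    {γ : ℝ} (hγ : 0 ≤ γ)
    (hx : ∀ w, Tendsto (fun n => ⟪x n, w⟫_ℝ) F (𝓝 ⟪y, w⟫_ℝ)) {m : ℕ → ℝ} {M : ℝ}
    (hm : Tendsto m F (𝓝 M)) (h : ∀ᶠ n in (F : Filter ℕ), S.EntropyBLe α γ (m n) (x n)) :
    S.EntropyBLe α γ M y := by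
  have hy := inner_zero_m_of_tendsto hx (h.mono fun _ h => h.1)
  have hex : ∀ n, ∃ B : lp (fun _ : ℕ => H) 2, S.EntropyBLe α γ (m n) (x n) →
      S.IsBOf B (x n) ∧ S.entropyB α γ B (x n) ≤ m n := fun n => by
    by_cases hn : S.EntropyBLe α γ (m n) (x n)
    · obtain ⟨B, hB⟩ := hn.2
      exact ⟨B, fun _ => hB⟩
    · exact ⟨0, fun h => absurd h hn⟩
  choose B hB using hex
  have hbd : ∀ᶠ n in (F : Filter ℕ), ‖B n‖ ≤ √(4 * (M + 1)) := by
    filter_upwards [h, hm.eventually (gt_mem_nhds (lt_add_one M))] with n hn hn'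
    apply Real.le_sqrt_of_sq_le
    have := le_entropyB hα hγ hn.1 (hB n hn).1
    linarith [(hB n hn).2]
  obtain ⟨G, hG⟩ := exists_weak_limit F B _ hbd
  have hBG := IsBOf.of_tendsto hx hG (h.mono fun n hn => (hB n hn).1)
  refine ⟨hy, G, hBG, le_of_tendsto_of_tendsto (tendsto_entropyB_sub hx hG) hm ?_⟩
  filter_upwards [h] with n hn
  have h0 : ⟪(x n - y) 0, S.ι S.m⟫_ℝ = 0 := by
    simp only [lp.coeFn_sub, Pi.sub_apply, inner_sub_left, hn.1, hy, sub_zero]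
  have h1 := (div_nonneg (sq_nonneg ‖B n - G‖) (by norm_num)).trans
    (le_entropyB hα hγ h0 ((hB n hn).1.sub hBG))
  linarith [(hB n hn).2]

end WeakLimit

section Step

variable {h M : ℝ} {f x : lp (fun _ : ℕ => H) 2}

theorem tendsto_div_step (h M ρ : ℝ) (hh : 0 < h) (hρ : 0 ≤ ρ) :
    Tendsto (fun n : ℕ => M / (1 + h * (ρ - 4 * (1 / ((n : ℝ) + 1))))) (hyperfilter ℕ)
      (𝓝 (M / (1 + h * ρ))) := by
  have hδ : Tendsto (fun n : ℕ => 1 / ((n : ℝ) + 1)) (hyperfilter ℕ) (𝓝 0) :=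
    tendsto_one_div_add_atTop_nhds_zero_nat.mono_left Nat.hyperfilter_le_atTop
  have h1 := (((hδ.const_mul 4).const_sub ρ).const_mul h).const_add 1
  simp only [mul_zero, sub_zero] at h1
  exact tendsto_const_nhds.div h1 (by positivity)

theorem eventually_pos_step (h ρ : ℝ) (hh : 0 < h) (hρ : 0 ≤ ρ) :
    ∀ᶠ n : ℕ in (hyperfilter ℕ : Filter ℕ), 0 < 1 + h * (ρ - 4 * (1 / ((n : ℝ) + 1))) := by
  have hδ : Tendsto (fun n : ℕ => 1 / ((n : ℝ) + 1)) (hyperfilter ℕ) (𝓝 0) :=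
    tendsto_one_div_add_atTop_nhds_zero_nat.mono_left Nat.hyperfilter_le_atTop
  have h1 := (((hδ.const_mul 4).const_sub ρ).const_mul h).const_add 1
  simp only [mul_zero, sub_zero] at h1
  exact h1.eventually (lt_mem_nhds (by positivity))

theorem EntropyLe.resolvent (hα : AdmissibleWeight S.P (1 + S.b * S.P) ε τ α) (hh : 0 < h)
    (hs : h * (1 + ‖S.c‖) < ε) (hf : S.EntropyLe α M f) (hx : S.IsResolvent ε τ h f x) :
    S.EntropyLe α (M / (1 + h * (α / (2 * ε)))) x := by
  have hε := hα.ε_pos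
  have hτ := hα.τ_pos
  have hρ : 0 ≤ α / (2 * ε) := div_nonneg hα.nonneg (by positivity)
  obtain ⟨u, z, g, U, x', hu, hfu, hU, -, hUn, hUx, hres⟩ := S.exists_approx (ε := ε) hτ hh f
  obtain rfl := IsResolvent.unique S hε hτ hh hs hx hres
  refine EntropyLe.of_tendsto hα hUx (tendsto_div_step h M _ hh hρ) ?_
  filter_upwards [eventually_pos_step h _ hh hρ] with n hn
  have hm := (hu n).inner_zero_m (hfu n)
  rw [hf.1] at hm
  refine ⟨by rw [hU, hm], (le_div_iff₀' hn).2 ?_⟩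
  have h1 := (hu n).entropy_le hm hα (by positivity) hh.le (fun k => f k) fun k _ => hfu n k
  rw [← hUn, ← hU, ← hU] at h1
  have h2 := sum_norm_sq_le f (Finset.range (n + 2 + 1))
  have h3 := hf.2
  have h4 : 0 ≤ h * ((∑ k ∈ Finset.range (n + 2 + 1), (k : ℝ) * ‖S.ι (u n k)‖ ^ 2) / (4 * τ)) := by
    positivity
  unfold entropy at h3 ⊢
  linarith

/-- The inequality for `B` is added to `γ` times the one of order zero, and `γ` is chosen so that
the commutator source and the retained quarter of the microscopic dissipation cancel exactly. -/
theorem EntropyBLe.resolvent (hα : AdmissibleWeight S.P (1 + S.b * S.P) ε τ α) {γ : ℝ}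
    (hγ : γ = 4 * ‖S.c‖ ^ 2 * τ ^ 2 / ε ^ 2) (hh : 0 < h)
    (hs : h * (1 + ‖S.c‖) < ε) (hf : S.EntropyBLe α γ M f) (hx : S.IsResolvent ε τ h f x) :
    S.EntropyBLe α γ (M / (1 + h * (α / (2 * ε)))) x := by
  have hε := hα.ε_pos
  have hτ := hα.τ_pos
  have hγ0 : 0 ≤ γ := by rw [hγ]; positivity
  have hρ : 0 ≤ α / (2 * ε) := div_nonneg hα.nonneg (by positivity)
  obtain ⟨hf0, Ff, ⟨X, hX, hFX⟩, hM⟩ := hf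
  obtain ⟨u, z, g, U, x', hu, hfu, hU, -, hUn, hUx, hres⟩ := S.exists_approx (ε := ε) hτ hh f
  obtain rfl := IsResolvent.unique S hε hτ hh hs hx hres
  refine EntropyBLe.of_tendsto hα hγ0 hUx (tendsto_div_step h M _ hh hρ) ?_
  filter_upwards [eventually_pos_step h _ hh hρ] with n hn
  have hm := (hu n).inner_zero_m (hfu n)
  rw [hf0] at hm
  obtain ⟨F, hF, hFn⟩ := exists_lp_of_finite (fun k => S.B k (u n k)) (n + 2)
    (fun k hk => by rw [(hu n).zero k hk, map_zero])
  refine ⟨by rw [hU, hm], F, ⟨u n, fun k => (hU n k).symm, hF⟩, (le_div_iff₀' hn).2 ?_⟩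
  have h1 := (hu n).entropy_le hm hα (by positivity) hh.le (fun k => f k) fun k _ => hfu n k
  have h1' := (hu n).entropy_B_le hm hα (by positivity) hh X
    fun k _ => by rw [hX]; exact hfu n k
  have h5 : h * (‖S.c‖ ^ 2 * τ / ε ^ 2
      * ∑ k ∈ Finset.range (n + 2 + 1), (k : ℝ) * ‖S.ι (u n k)‖ ^ 2) =
      γ * (h * ((∑ k ∈ Finset.range (n + 2 + 1), (k : ℝ) * ‖S.ι (u n k)‖ ^ 2) / (4 * τ))) := by
    rw [hγ]; field_simp
  rw [← hUn, ← hU, ← hU] at h1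
  simp only [← hFX, ← hF, hX, ← hU] at h1'
  simp only [hF, hU] at h1'
  rw [← hFn, ← hF, ← hU] at h1'
  rw [h5] at h1'
  have h2 := sum_norm_sq_le f (Finset.range (n + 2 + 1))
  have h2' := sum_norm_sq_le Ff (Finset.range (n + 2 + 1))
  have h3 := mul_le_mul_of_nonneg_left h1 hγ0
  have h4 := mul_le_mul_of_nonneg_left h2 hγ0
  unfold entropyB entropy at hM ⊢
  linarith

end Step

end DirichletPair
-- Weak solutions, implicit Euler and exponential decay
theorem continuousOn_smul_sub {E : Type*} [NormedAddCommGroup E] [NormedSpace ℝ E] (R : E →L[ℝ] E)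
    {D : ℝ → E} {s : Set ℝ} (hD : ContinuousOn D s) (c : ℝ) :
    ContinuousOn (fun t => c • (R (D t) - D t)) s :=
  ((R.continuous.comp_continuousOn hD).sub hD).const_smul c

namespace DirichletPair

variable {H V : Type*} [NormedAddCommGroup H] [InnerProductSpace ℝ H] [CompleteSpace H]
    [NormedAddCommGroup V] [InnerProductSpace ℝ V] [CompleteSpace V] (S : DirichletPair H V)

/-- Weak solutions of the Hermite system, in time-integrated form. -/
structure IsWeakSolution (ε τ : ℝ) (D : ℝ → lp (fun _ : ℕ => H) 2) : Prop where
  continuousOn : ContinuousOn D (Ici 0)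
  integral_eq : ∀ (k : ℕ) (v : V) (t : ℝ), 0 ≤ t →
    ⟪D t k, S.ι v⟫_ℝ - ⟪D 0 k, S.ι v⟫_ℝ = ∫ s in (0 : ℝ)..t,
      (-(1 / ε) * (√(k : ℝ) * ⟪D s (k - 1), S.As v⟫_ℝ - √((k : ℝ) + 1) * ⟪D s (k + 1), S.A v⟫_ℝ)
        - k / τ * ⟪D s k, S.ι v⟫_ℝ)

/-- The vector that tests the resolvent equation. -/
noncomputable def testVec (ε τ h : ℝ) (k : ℕ) (v : V) : lp (fun _ : ℕ => H) 2 :=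
  (1 + h / τ * k) • lp.single 2 k (S.ι v) + (h / ε) • (√(k : ℝ) • lp.single 2 (k - 1) (S.As v)
    - √((k : ℝ) + 1) • lp.single 2 (k + 1) (S.A v))

variable {S} {ε τ h : ℝ}

theorem inner_testVec (x : lp (fun _ : ℕ => H) 2) (k : ℕ) (v : V) :
    ⟪x, S.testVec ε τ h k v⟫_ℝ = (1 + h / τ * k) * ⟪x k, S.ι v⟫_ℝ
      + h / ε * (√(k : ℝ) * ⟪x (k - 1), S.As v⟫_ℝ - √((k : ℝ) + 1) * ⟪x (k + 1), S.A v⟫_ℝ) := by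
  simp only [testVec, inner_add_right, inner_sub_right, inner_smul_right, lp.inner_single_right]

theorem isResolvent_iff {f u : lp (fun _ : ℕ => H) 2} : S.IsResolvent ε τ h f u ↔
    ∀ k v, ⟪u, S.testVec ε τ h k v⟫_ℝ = ⟪f k, S.ι v⟫_ℝ := by
  simp only [inner_testVec, IsResolvent]

theorem IsResolvent.sub {f g u w : lp (fun _ : ℕ => H) 2} (hu : S.IsResolvent ε τ h f u)
    (hw : S.IsResolvent ε τ h g w) : S.IsResolvent ε τ h (f - g) (u - w) := by
  rw [isResolvent_iff] at *
  intro k v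
  simp only [inner_sub_left, hu, hw, lp.coeFn_sub, Pi.sub_apply]

theorem IsResolvent.add {f g u w : lp (fun _ : ℕ => H) 2} (hu : S.IsResolvent ε τ h f u)
    (hw : S.IsResolvent ε τ h g w) : S.IsResolvent ε τ h (f + g) (u + w) := by
  rw [isResolvent_iff] at *
  intro k v
  simp only [inner_add_left, hu, hw, lp.coeFn_add, Pi.add_apply]

theorem IsResolvent.smul {f u : lp (fun _ : ℕ => H) 2} (hu : S.IsResolvent ε τ h f u) (c : ℝ) :
    S.IsResolvent ε τ h (c • f) (c • u) := by
  rw [isResolvent_iff] at *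
  intro k v
  simp only [inner_smul_left, hu, lp.coeFn_smul, Pi.smul_apply]

theorem exists_resolvent_operator (hε : 0 < ε) (hτ : 0 < τ) (hh : 0 < h)
    (hs : h * (1 + ‖S.c‖) < ε) :
    ∃ R : lp (fun _ : ℕ => H) 2 →L[ℝ] lp (fun _ : ℕ => H) 2,
      ∀ f, S.IsResolvent ε τ h f (R f) := by
  choose R hR using fun f => S.exists_isResolvent (ε := ε) hτ hh f
  refine ⟨LinearMap.mkContinuous ⟨⟨R, fun f g => ?_⟩, fun c f => ?_⟩ 1 fun f => ?_, hR⟩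
  · exact IsResolvent.unique S hε hτ hh hs (hR _) ((hR f).add (hR g))
  · exact IsResolvent.unique S hε hτ hh hs (hR _) ((hR f).smul c)
  · rw [one_mul]
    exact IsResolvent.norm_le S hε hτ hh hs (hR f)

/-- A vector in the range of one resolvent lies in the domain of the generator, with image `μ⁻¹ (u -
f)`; it therefore solves the resolvent equation for any other step. -/
theorem IsResolvent.change_step {μ : ℝ} (hμ : μ ≠ 0) {f u : lp (fun _ : ℕ => H) 2}
    (hu : S.IsResolvent ε τ μ f u) (h : ℝ) :
    S.IsResolvent ε τ h (u - h • μ⁻¹ • (u - f)) u := by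
  intro k v
  have h1 := hu k v
  simp only [lp.coeFn_sub, lp.coeFn_smul, Pi.sub_apply, Pi.smul_apply, inner_sub_left,
    inner_smul_left, RCLike.conj_to_real]
  rw [← h1]
  field_simp
  ring

/-- The resolvent turns the weak equation into an integral equation in norm with continuous
integrand. The difference of the two sides solves the homogeneous resolvent equation, so uniqueness
applies. -/
theorem IsWeakSolution.resolvent_sub_eq_integral {D : ℝ → lp (fun _ : ℕ => H) 2}
    (hD : S.IsWeakSolution ε τ D) (hε : 0 < ε) (hτ : 0 < τ) (hh : 0 < h)
    (hs : h * (1 + ‖S.c‖) < ε) {R : lp (fun _ : ℕ => H) 2 →L[ℝ] lp (fun _ : ℕ => H) 2}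
    (hR : ∀ f, S.IsResolvent ε τ h f (R f)) {t : ℝ} (ht : 0 ≤ t) :
    R (D t) - R (D 0) = ∫ s in (0 : ℝ)..t, h⁻¹ • (R (D s) - D s) := by
  have hc : ContinuousOn (fun s => h⁻¹ • (R (D s) - D s)) (uIcc 0 t) := by
    rw [uIcc_of_le ht]
    have h1 : ContinuousOn D (Icc 0 t) := hD.continuousOn.mono Icc_subset_Ici_self
    exact continuousOn_smul_sub R h1 _
  rw [← sub_eq_zero]
  have h0 : S.IsResolvent ε τ h 0 0 := fun k v => by simp
  refine IsResolvent.unique S hε hτ hh hs (f := 0) ?_ h0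
  rw [isResolvent_iff]
  intro k v
  have h1 := hD.integral_eq k v t ht
  have h2 : ⟪∫ s in (0 : ℝ)..t, h⁻¹ • (R (D s) - D s), S.testVec ε τ h k v⟫_ℝ
      = ∫ s in (0 : ℝ)..t, ⟪h⁻¹ • (R (D s) - D s), S.testVec ε τ h k v⟫_ℝ := by
    have := ((innerSL ℝ (S.testVec ε τ h k v)).intervalIntegral_comp_comm
      (hc.intervalIntegrable (μ := volume)))
    simp only [innerSL_apply_apply] at this
    rw [real_inner_comm, ← this]
    simp only [real_inner_comm (S.testVec ε τ h k v)]
  have hR' : ∀ f, ⟪R f, S.testVec ε τ h k v⟫_ℝ = ⟪f k, S.ι v⟫_ℝ :=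
    fun f => isResolvent_iff.1 (hR f) k v
  rw [inner_sub_left, inner_sub_left, h2, hR', hR', h1, ← intervalIntegral.integral_sub]
  · simp only [inner_smul_left, inner_sub_left, hR', inner_testVec, RCLike.conj_to_real]
    have : ∀ s, -(1 / ε) * (√(k : ℝ) * ⟪D s (k - 1), S.As v⟫_ℝ
        - √((k : ℝ) + 1) * ⟪D s (k + 1), S.A v⟫_ℝ)
        - k / τ * ⟪D s k, S.ι v⟫_ℝ - h⁻¹ * (⟪D s k, S.ι v⟫_ℝ - ((1 + h / τ * k) * ⟪D s k, S.ι v⟫_ℝ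
      + h / ε * (√(k : ℝ) * ⟪D s (k - 1), S.As v⟫_ℝ
        - √((k : ℝ) + 1) * ⟪D s (k + 1), S.A v⟫_ℝ))) = 0 := fun s => by
      field_simp; ring
    simp only [this, intervalIntegral.integral_zero]
    simp
  · refine ContinuousOn.intervalIntegrable ?_
    rw [uIcc_of_le ht]
    have hcomp : ∀ (j : ℕ) (w : H), ContinuousOn (fun s => ⟪D s j, w⟫_ℝ) (Icc 0 t) := fun j w => by
      have h1 : ContinuousOn D (Icc 0 t) := hD.continuousOn.mono Icc_subset_Ici_self
      have := h1.inner (𝕜 := ℝ) (continuousOn_const (c := lp.single 2 j w))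
      simpa [lp.inner_single_right] using this
    exact (((hcomp _ _).const_mul _ |>.sub ((hcomp _ _).const_mul _)).const_mul _).sub
      ((hcomp _ _).const_mul _)
  · exact (hc.inner (𝕜 := ℝ) continuousOn_const).intervalIntegrable

/-- Contractivity gives a weak limit point; as `μ j` tends to zero the equation reduces to equality
with `f` against the dense range of `ι`. -/
theorem resolvent_tendsto_weakly {f : lp (fun _ : ℕ => H) 2} {μ : ℕ → ℝ} (hε : 0 < ε) (hτ : 0 < τ)
    (hμ : ∀ j, 0 < μ j) (hs : ∀ j, μ j * (1 + ‖S.c‖) < ε) (hμ0 : Tendsto μ atTop (𝓝 0))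
    {u : ℕ → lp (fun _ : ℕ => H) 2} (hu : ∀ j, S.IsResolvent ε τ (μ j) f (u j)) :
    ∀ w, Tendsto (fun n => ⟪u n, w⟫_ℝ) (hyperfilter ℕ) (𝓝 ⟪f, w⟫_ℝ) := by
  obtain ⟨x, hx⟩ := exists_weak_limit (hyperfilter ℕ) u ‖f‖
    (Eventually.of_forall fun j => (hu j).norm_le S hε hτ (hμ j) (hs j))
  suffices x = f by rwa [this] at hx
  have hμ' : Tendsto μ (hyperfilter ℕ) (𝓝 0) := hμ0.mono_left Nat.hyperfilter_le_atTop
  ext k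
  refine S.dense.eq_of_inner_left ℝ fun v => ?_
  have hlim : Tendsto (fun j => (1 + μ j / τ * k) * ⟪u j k, S.ι v⟫_ℝ
      + μ j / ε * (√(k : ℝ) * ⟪u j (k - 1), S.As v⟫_ℝ - √((k : ℝ) + 1) * ⟪u j (k + 1), S.A v⟫_ℝ))
      (hyperfilter ℕ) (𝓝 ((1 + 0 / τ * k) * ⟪x k, S.ι v⟫_ℝ
      + 0 / ε * (√(k : ℝ) * ⟪x (k - 1), S.As v⟫_ℝ - √((k : ℝ) + 1) * ⟪x (k + 1), S.A v⟫_ℝ))) :=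
    ((((hμ'.div_const _).mul_const _).const_add _).mul (tendsto_inner_apply hx _ _)).add
      ((hμ'.div_const _).mul (((tendsto_inner_apply hx _ _).const_mul _).sub
        ((tendsto_inner_apply hx _ _).const_mul _)))
  have := tendsto_nhds_unique hlim (tendsto_const_nhds.congr fun j => (hu j k v).symm)
  simpa using this

/-- Convergence of the implicit Euler scheme. -/
theorem euler_error_le {y z : ℝ → lp (fun _ : ℕ => H) 2} {T r : ℝ} {n : ℕ} (hε : 0 < ε) (hτ : 0 < τ)
    (hh : 0 < h) (hs : h * (1 + ‖S.c‖) < ε) (hn : n * h = T)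
    (hz : ContinuousOn z (Icc 0 T))
    (hy : ∀ t, 0 ≤ t → t ≤ T → y t - y 0 = ∫ s in (0 : ℝ)..t, z s)
    (hres : ∀ t, 0 ≤ t → t ≤ T → S.IsResolvent ε τ h (y t - h • z t) (y t))
    (hr : ∀ s ∈ Icc 0 T, ∀ s' ∈ Icc 0 T, |s - s'| ≤ h → ‖z s - z s'‖ ≤ r)
    {e : ℕ → lp (fun _ : ℕ => H) 2} (he0 : e 0 = y 0)
    (he : ∀ j, S.IsResolvent ε τ h (e j) (e (j + 1))) :
    ∀ j ≤ n, ‖e j - y (j * h)‖ ≤ j * h * r := by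
  intro j
  induction j with
  | zero => intro _; simp [he0]
  | succ j ih =>
    intro hj
    have hjn : ((j : ℝ) + 1) * h ≤ T := by
      rw [← hn]; gcongr; exact_mod_cast hj
    have hj0 : 0 ≤ (j : ℝ) * h := by positivity
    have hjT : (j : ℝ) * h ≤ T := by linarith
    have hj1 : 0 ≤ ((j : ℝ) + 1) * h := by positivity
    have h1 := ih (by omega)
    -- The exact curve is itself an Euler step up to a consistency error. Contractivity carries the
    -- old error over without growth, and each step adds at most `h r`.
    have h2 := IsResolvent.norm_le S hε hτ hh hs ((he j).sub (hres _ hj1 hjn))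
    have hint : ∀ a b, a ∈ Icc 0 T → b ∈ Icc 0 T → IntervalIntegrable z volume a b :=
      fun a b ha hb => (hz.mono (uIcc_subset_Icc ha hb)).intervalIntegrable
    have h3 : y (((j : ℝ) + 1) * h) - y (j * h) = ∫ s in (j * h)..(((j : ℝ) + 1) * h), z s := by
      rw [← intervalIntegral.integral_interval_sub_left
        (hint 0 _ ⟨le_rfl, hj0.trans hjT⟩ ⟨hj1, hjn⟩) (hint 0 _ ⟨le_rfl, hj0.trans hjT⟩ ⟨hj0, hjT⟩),
        ← hy _ hj1 hjn, ← hy _ hj0 hjT]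
      abel
    have h4 : ‖(∫ s in (j * h)..(((j : ℝ) + 1) * h), z s) - h • z (((j : ℝ) + 1) * h)‖ ≤ r * h := by
      have e1 : h • z (((j : ℝ) + 1) * h) =
          ∫ _ in (j * h)..(((j : ℝ) + 1) * h), z (((j : ℝ) + 1) * h) := by
        rw [intervalIntegral.integral_const]; congr 1; ring
      rw [e1, ← intervalIntegral.integral_sub (hint _ _ ⟨hj0, hjT⟩ ⟨hj1, hjn⟩) (by simp)]
      refine (intervalIntegral.norm_integral_le_of_norm_le_const (C := r) fun s hs => ?_).trans ?_
      · rw [uIoc_of_le (by linarith)] at hs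
        refine hr _ ⟨by linarith [hs.1], by linarith [hs.2]⟩ _ ⟨hj1, hjn⟩ ?_
        rw [abs_le]; constructor <;> linarith [hs.1, hs.2]
      · rw [abs_of_nonneg (by linarith)]; apply le_of_eq; ring
    have h5 : e j - (y (((j : ℝ) + 1) * h) - h • z (((j : ℝ) + 1) * h)) = (e j - y (j * h))
        - ((∫ s in (j * h)..(((j : ℝ) + 1) * h), z s) - h • z (((j : ℝ) + 1) * h)) := by
      rw [← h3]; abel
    rw [h5] at h2
    push_cast
    calc _ ≤ _ := h2
      _ ≤ j * h * r + r * h := (norm_sub_le _ _).trans (add_le_add h1 h4)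
      _ = _ := by ring

/-- The smoothed curve `R j (D t)` is `C¹`, so Euler iterates from `R j (D 0)` converge to it in
norm, and `(1 + h ρ)⁻ⁿ` tends to `exp (-ρ T)`. Weak closedness is then used twice: for the Euler
limit, and for `μ j → 0`, which removes the smoothing. -/
theorem IsWeakSolution.sublevel_of_resolvent {P : ℝ → lp (fun _ : ℕ => H) 2 → Prop} {ρ : ℝ}
    (hε : 0 < ε) (hτ : 0 < τ)
    (hstep : ∀ (h M : ℝ) (f x : lp (fun _ : ℕ => H) 2), 0 < h → h * (1 + ‖S.c‖) < ε → P M f →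
      S.IsResolvent ε τ h f x → P (M / (1 + h * ρ)) x)
    (hclosed : ∀ (x : ℕ → lp (fun _ : ℕ => H) 2) (y : lp (fun _ : ℕ => H) 2) (m : ℕ → ℝ) (M : ℝ),
      (∀ w, Tendsto (fun n => ⟪x n, w⟫_ℝ) (hyperfilter ℕ) (𝓝 ⟪y, w⟫_ℝ)) →
      Tendsto m (hyperfilter ℕ) (𝓝 M) → (∀ n, P (m n) (x n)) → P M y)
    {D : ℝ → lp (fun _ : ℕ => H) 2} (hD : S.IsWeakSolution ε τ D) {M : ℝ} (h0 : P M (D 0))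
    {T : ℝ} (hT : 0 ≤ T) : P (M * Real.exp (-(ρ * T))) (D T) := by
  rcases hT.eq_or_lt with rfl | hT
  · simpa using h0
  have hc : 0 < 1 + ‖S.c‖ := by positivity
  have hle : (hyperfilter ℕ : Filter ℕ) ≤ atTop := Nat.hyperfilter_le_atTop
  set μ : ℕ → ℝ := fun j => ε / (1 + ‖S.c‖) / ((j : ℝ) + 2) with hμdef
  have hμ : ∀ j, 0 < μ j := fun j => by positivity
  have hμs : ∀ j, μ j * (1 + ‖S.c‖) < ε := fun j => by
    have : μ j * (1 + ‖S.c‖) = ε / ((j : ℝ) + 2) := by simp only [hμdef]; field_simp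
    rw [this]
    have : (0 : ℝ) ≤ j := Nat.cast_nonneg j
    exact div_lt_self hε (by linarith)
  have hμ0 : Tendsto μ atTop (𝓝 0) :=
    tendsto_const_nhds.div_atTop (tendsto_atTop_add_const_right _ _ tendsto_natCast_atTop_atTop)
  choose R hR using fun j => exists_resolvent_operator (S := S) hε hτ (hμ j) (hμs j)
  have key : ∀ j, P (M / (1 + μ j * ρ) * Real.exp (-(ρ * T))) (R j (D T)) := fun j => by
    set z : ℝ → lp (fun _ : ℕ => H) 2 := fun s => (μ j)⁻¹ • (R j (D s) - D s) with hz
    have hDc : ContinuousOn D (Icc 0 T) := hD.continuousOn.mono Icc_subset_Ici_self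
    have hzc : ContinuousOn z (Icc 0 T) :=
      continuousOn_smul_sub (R j) hDc _
    have hzu := isCompact_Icc.uniformContinuousOn_of_continuous hzc
    have hy : ∀ t, 0 ≤ t → t ≤ T → R j (D t) - R j (D 0) = ∫ s in (0 : ℝ)..t, z s :=
      fun t ht _ => hD.resolvent_sub_eq_integral hε hτ (hμ j) (hμs j) (hR j) ht
    -- Starting at `N + 1` subdivisions makes every step short enough for resolvent uniqueness.
    obtain ⟨N, hN⟩ := exists_nat_gt (T * (1 + ‖S.c‖) / ε)
    set h : ℕ → ℝ := fun n => T / ((n + N + 1 : ℕ) : ℝ) with hhdef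
    have hnpos : ∀ n : ℕ, (0 : ℝ) < ((n + N + 1 : ℕ) : ℝ) := fun n => by positivity
    have hh : ∀ n, 0 < h n := fun n => by simp only [hhdef]; positivity
    have hhs : ∀ n, h n * (1 + ‖S.c‖) < ε := fun n => by
      rw [div_lt_iff₀ hε] at hN
      simp only [hhdef]
      rw [div_mul_eq_mul_div, div_lt_iff₀ (hnpos n)]
      refine hN.trans_le ?_
      rw [mul_comm ε]
      gcongr
      omega
    have hnh : ∀ n, ((n + N + 1 : ℕ) : ℝ) * h n = T := fun n => by
      simp only [hhdef]; field_simp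
    have hh0 : Tendsto h atTop (𝓝 0) := by
      have := (tendsto_natCast_atTop_atTop (R := ℝ)).comp (tendsto_add_atTop_nat (N + 1))
      exact tendsto_const_nhds.div_atTop this
    choose Q hQ using fun n f => S.exists_isResolvent (ε := ε) hτ (hh n) f
    set e : ℕ → ℕ → lp (fun _ : ℕ => H) 2 := fun n i => (Q n)^[i] (R j (D 0)) with he
    have hes : ∀ n i, S.IsResolvent ε τ (h n) (e n i) (e n (i + 1)) := fun n i => by
      simp only [he, Function.iterate_succ_apply']
      exact hQ n _
    have hP : ∀ n i, P (M / (1 + μ j * ρ) / (1 + h n * ρ) ^ i) (e n i) := fun n i => by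
      induction i with
      | zero => simpa [he] using hstep _ _ _ _ (hμ j) (hμs j) h0 (hR j _)
      | succ i ih =>
        have := hstep _ _ _ _ (hh n) (hhs n) ih (hes n i)
        rwa [div_div, ← pow_succ] at this
    have hlim : Tendsto (fun n => e n (n + N + 1)) atTop (𝓝 (R j (D T))) := by
      rw [Metric.tendsto_atTop]
      intro η hη
      obtain ⟨d, hd, hzd⟩ := Metric.uniformContinuousOn_iff.1 hzu (η / (2 * T)) (by positivity)
      obtain ⟨n₀, hn₀⟩ := (hh0.eventually (gt_mem_nhds hd)).exists_forall_of_atTop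
      refine ⟨n₀, fun n hn => ?_⟩
      have := euler_error_le (S := S) (y := fun s => R j (D s)) (z := z) (r := η / (2 * T)) hε hτ
        (hh n) (hhs n) (hnh n) hzc hy (fun t _ _ => (hR j (D t)).change_step (hμ j).ne' (h n))
        (fun s hs s' hs' hss => by
          rw [← dist_eq_norm]
          exact (hzd s hs s' hs' (by rw [Real.dist_eq]; exact hss.trans_lt (hn₀ n hn))).le)
        (e := e n) rfl (hes n) _ le_rfl
      rw [hnh n] at this
      rw [dist_eq_norm]
      refine this.trans_lt ?_
      have e1 : T * (η / (2 * T)) = η / 2 := by field_simp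
      rw [e1]; linarith
    refine hclosed (fun n => e n (n + N + 1)) _ _ _ (fun w => ?_) ?_ fun n => hP n (n + N + 1)
    · exact (hlim.mono_left hle).inner tendsto_const_nhds
    · have h1 := ((Real.tendsto_one_add_div_pow_exp (ρ * T)).comp
        (tendsto_add_atTop_nat (N + 1))).mono_left hle
      have h2 := (tendsto_const_nhds (x := M / (1 + μ j * ρ))).div h1 (Real.exp_ne_zero _)
      rw [Real.exp_neg, ← div_eq_mul_inv]
      refine h2.congr fun n => ?_
      have h3 : h n * ρ = ρ * T / ((n + (N + 1) : ℕ) : ℝ) := by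
        simp only [hhdef, ← add_assoc]; ring
      rw [h3, add_assoc]
      rfl
  refine hclosed (fun j => R j (D T)) _ _ _
    (resolvent_tendsto_weakly hε hτ hμ hμs hμ0 fun j => hR j (D T)) ?_ key
  have h1 : Tendsto (fun j => 1 + μ j * ρ) (hyperfilter ℕ) (𝓝 (1 + 0 * ρ)) :=
    ((hμ0.mono_left hle).mul_const ρ).const_add 1
  have h2 := ((tendsto_const_nhds (x := M)).div h1 (by simp)).mul_const (Real.exp (-(ρ * T)))
  simpa using h2

variable {α : ℝ}

theorem IsWeakSolution.norm_le {D : ℝ → lp (fun _ : ℕ => H) 2} (hD : S.IsWeakSolution ε τ D)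
    (hα : AdmissibleWeight S.P (1 + S.b * S.P) ε τ α) (h0 : ⟪D 0 0, S.ι S.m⟫_ℝ = 0)
    {t : ℝ} (ht : 0 ≤ t) :
    ‖D t‖ ≤ √3 * ‖D 0‖ * Real.exp (-(α / (4 * ε) * t)) := by
  have h1 := hD.sublevel_of_resolvent hα.ε_pos hα.τ_pos (P := fun M x => S.EntropyLe α M x)
    (fun h M f x hh hs hf hx => hf.resolvent hα hh hs hx)
    (fun x y m M hx hm h => EntropyLe.of_tendsto hα hx hm (Eventually.of_forall h))
    ⟨h0, le_rfl⟩ ht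
  have h2 := le_entropy hα h1.1
  have h3 := entropy_le hα h0
  have h4 := h1.2
  apply le_of_sq_le_sq _ (by positivity)
  rw [mul_pow, mul_pow, Real.sq_sqrt (by norm_num), ← Real.exp_nat_mul]
  have h5 : ((2 : ℕ) : ℝ) * -(α / (4 * ε) * t) = -(α / (2 * ε) * t) := by
    have := hα.ε_pos.ne'; push_cast; field_simp; ring
  rw [h5]
  have h6 := mul_le_mul_of_nonneg_right h3 (Real.exp_nonneg (-(α / (2 * ε) * t)))
  linarith

/-- The coefficient `2 ‖c‖ τ / ε` is `√γ`, and the rate is half that of the entropy since norms are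
square roots. -/
theorem IsWeakSolution.norm_B_le {D : ℝ → lp (fun _ : ℕ => H) 2} (hD : S.IsWeakSolution ε τ D)
    (hα : AdmissibleWeight S.P (1 + S.b * S.P) ε τ α) (h0 : ⟪D 0 0, S.ι S.m⟫_ℝ = 0)
    {F₀ : lp (fun _ : ℕ => H) 2} (hF₀ : S.IsBOf F₀ (D 0)) {t : ℝ} (ht : 0 ≤ t) :
    ∃ F, S.IsBOf F (D t) ∧ ‖F‖ ≤ √3 * (2 * ‖S.c‖ * (τ / ε) * ‖D 0‖ + ‖F₀‖)
      * Real.exp (-(α / (4 * ε) * t)) := by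
  have hε := hα.ε_pos
  have hτ := hα.τ_pos
  set γ := 4 * ‖S.c‖ ^ 2 * τ ^ 2 / ε ^ 2 with hγ
  have hγ0 : 0 ≤ γ := by positivity
  obtain ⟨h1, F, hF, h4⟩ := hD.sublevel_of_resolvent hα.ε_pos hα.τ_pos
    (P := fun M x => S.EntropyBLe α γ M x)
    (fun h M f x hh hs hf hx => hf.resolvent hα hγ hh hs hx)
    (fun x y m M hx hm h => EntropyBLe.of_tendsto hα hγ0 hx hm (Eventually.of_forall h))
    ⟨h0, F₀, hF₀, le_rfl⟩ ht
  refine ⟨F, hF, ?_⟩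
  have h2 := le_entropyB hα hγ0 h1 hF
  have h3 := entropyB_le hα hγ0 h0 hF₀
  apply le_of_sq_le_sq _ (by positivity)
  rw [mul_pow, mul_pow, Real.sq_sqrt (by norm_num), ← Real.exp_nat_mul]
  have h5 : ((2 : ℕ) : ℝ) * -(α / (4 * ε) * t) = -(α / (2 * ε) * t) := by
    push_cast; field_simp; ring
  rw [h5]
  have h6 := mul_le_mul_of_nonneg_right h3 (Real.exp_nonneg (-(α / (2 * ε) * t)))
  have h7 : ‖F₀‖ ^ 2 + γ * ‖D 0‖ ^ 2 ≤ (2 * ‖S.c‖ * (τ / ε) * ‖D 0‖ + ‖F₀‖) ^ 2 := by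
    have e1 : γ * ‖D 0‖ ^ 2 = (2 * ‖S.c‖ * (τ / ε) * ‖D 0‖) ^ 2 := by
      rw [hγ]; field_simp; ring
    have e2 : 0 ≤ 2 * ‖S.c‖ * (τ / ε) * ‖D 0‖ * ‖F₀‖ := by positivity
    rw [e1]; nlinarith
  have h8 := mul_le_mul_of_nonneg_right h7 (Real.exp_nonneg (-(α / (2 * ε) * t)))
  linarith

end DirichletPair

variable {L : ℝ} [Fact (0 < L)]

/-! ### Smooth functions and Fourier modes on the circle -/

namespace IsSmooth

variable {φ ψ : AddCircle L → ℝ}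

theorem hasDerivAt (hφ : IsSmooth φ) (s : ℝ) :
    HasDerivAt (fun s : ℝ => φ (s : AddCircle L)) (circleDeriv φ (s : AddCircle L)) s := by
  have h1 : circleDeriv φ (s : AddCircle L) = deriv (fun s : ℝ => φ (s : AddCircle L)) s := by
    have := deriv_comp_const_add (fun r : ℝ => φ (r : AddCircle L)) s 0
    rw [add_zero] at this
    rw [← this]
    simp only [circleDeriv, AddCircle.coe_add]
  rw [h1]
  exact (ContDiff.differentiable hφ (by simp) s).hasDerivAt

theorem circleDeriv_eq {f' : AddCircle L → ℝ} (hφ : IsSmooth φ)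
    (h : ∀ s : ℝ, HasDerivAt (fun s : ℝ => φ (s : AddCircle L)) (f' (s : AddCircle L)) s) :
    circleDeriv φ = f' := by
  ext x
  induction x using QuotientAddGroup.induction_on with
  | H s => exact (hφ.hasDerivAt s).unique (h s)

theorem deriv (hφ : IsSmooth φ) : IsSmooth (circleDeriv φ) := by
  have h : (fun s : ℝ => circleDeriv φ (s : AddCircle L))
      = _root_.deriv (fun s : ℝ => φ (s : AddCircle L)) :=
    funext fun s => (hφ.hasDerivAt s).deriv.symm
  unfold IsSmooth
  rw [h]
  exact (contDiff_infty_iff_deriv.1 hφ).2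

theorem continuous (hφ : IsSmooth φ) : Continuous φ := by
  exact (QuotientAddGroup.isQuotientMap_mk _).continuous_iff.2 (ContDiff.continuous hφ)

theorem add (hφ : IsSmooth φ) (hψ : IsSmooth ψ) : IsSmooth (fun x => φ x + ψ x) :=
  ContDiff.add hφ hψ

theorem mul (hφ : IsSmooth φ) (hψ : IsSmooth ψ) : IsSmooth (fun x => φ x * ψ x) :=
  ContDiff.mul hφ hψ

theorem const (c : ℝ) : IsSmooth (fun _ : AddCircle L => c) := contDiff_const

theorem circleDeriv_mul (hφ : IsSmooth φ) (hψ : IsSmooth ψ) :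
    circleDeriv (fun x => φ x * ψ x) = fun x => circleDeriv φ x * ψ x + φ x * circleDeriv ψ x :=
  (hφ.mul hψ).circleDeriv_eq fun s => (hφ.hasDerivAt s).mul (hψ.hasDerivAt s)

theorem circleDeriv_const (c : ℝ) : circleDeriv (fun _ : AddCircle L => c) = fun _ => 0 :=
  (const c).circleDeriv_eq fun s => hasDerivAt_const s c

theorem exists_bound (hφ : IsSmooth φ) : ∃ C, ∀ x, ‖φ x‖ ≤ C := by
  obtain ⟨C, hC⟩ := isCompact_univ.exists_bound_of_continuousOn hφ.continuous.continuousOn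
  exact ⟨C, fun x => hC x (mem_univ x)⟩

theorem memLp (hφ : IsSmooth φ) (p : ENNReal) : MemLp φ p volume := by
  obtain ⟨C, hC⟩ := hφ.exists_bound
  exact MemLp.of_bound hφ.continuous.aestronglyMeasurable C (Eventually.of_forall hC)

theorem integrable (hφ : IsSmooth φ) : Integrable φ := memLp_one_iff_integrable.1 (hφ.memLp 1)

theorem integrable_mul {u : AddCircle L → ℝ} (hφ : IsSmooth φ) (hu : Integrable u) :
    Integrable fun x => u x * φ x := by
  obtain ⟨C, hC⟩ := hφ.exists_bound
  exact hu.mul_bdd (c := C) hφ.continuous.aestronglyMeasurable (Eventually.of_forall hC)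

theorem integral_circleDeriv (hφ : IsSmooth φ) : ∫ x, circleDeriv φ x = 0 := by
  rw [← AddCircle.intervalIntegral_preimage L 0]
  rw [intervalIntegral.integral_eq_sub_of_hasDerivAt (fun s _ => hφ.hasDerivAt s)
    ((ContDiff.continuous hφ.deriv).intervalIntegrable _ _), zero_add, AddCircle.coe_period]
  simp

theorem hasWeakDeriv (hφ : IsSmooth φ) : HasWeakDeriv φ (circleDeriv φ) := by
  refine ⟨hφ.integrable, hφ.deriv.integrable, fun ψ hψ => ?_⟩
  have h := (hφ.mul hψ).integral_circleDeriv
  rw [hφ.circleDeriv_mul hψ, integral_add (hφ.deriv.mul hψ).integrable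
    (hφ.mul hψ.deriv).integrable] at h
  linarith

theorem fourier_re (n : ℤ) : IsSmooth (fun x : AddCircle L => (fourier n x).re) := by
  unfold IsSmooth
  simp only [fourier_coe_apply]
  refine Complex.reCLM.contDiff.comp (Complex.contDiff_exp.comp ?_)
  have := Complex.ofRealCLM.contDiff (n := ∞)
  exact (contDiff_const.mul this).div_const _

theorem fourier_im (n : ℤ) : IsSmooth (fun x : AddCircle L => (fourier n x).im) := by
  unfold IsSmooth
  simp only [fourier_coe_apply]
  refine Complex.imCLM.contDiff.comp (Complex.contDiff_exp.comp ?_)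
  have := Complex.ofRealCLM.contDiff (n := ∞)
  exact (contDiff_const.mul this).div_const _

theorem circleDeriv_fourier_re (n : ℤ) : circleDeriv (fun x : AddCircle L => (fourier n x).re)
    = fun x => -(2 * Real.pi * n / L) * (fourier n x).im := by
  refine (fourier_re n).circleDeriv_eq fun s => ?_
  have h := Complex.reCLM.hasFDerivAt.comp_hasDerivAt s (hasDerivAt_fourier L n s)
  have : (2 * Real.pi * Complex.I * n / L : ℂ) = ((2 * Real.pi * n / L : ℝ) : ℂ) * Complex.I := by
    push_cast; ring
  rw [this, mul_assoc] at h
  simpa [-Complex.ofReal_mul, -Complex.ofReal_div, Function.comp_def] using h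

theorem circleDeriv_fourier_im (n : ℤ) : circleDeriv (fun x : AddCircle L => (fourier n x).im)
    = fun x => (2 * Real.pi * n / L) * (fourier n x).re := by
  refine (fourier_im n).circleDeriv_eq fun s => ?_
  have h := Complex.imCLM.hasFDerivAt.comp_hasDerivAt s (hasDerivAt_fourier L n s)
  have : (2 * Real.pi * Complex.I * n / L : ℂ) = ((2 * Real.pi * n / L : ℝ) : ℂ) * Complex.I := by
    push_cast; ring
  rw [this, mul_assoc] at h
  simpa [-Complex.ofReal_mul, -Complex.ofReal_div, Function.comp_def] using h

end IsSmooth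

theorem integral_mul_eq_zero_of_fourier {w : AddCircle L → ℝ} (hw : Integrable w)
    (hre : ∀ n : ℤ, ∫ x, w x * (fourier n x).re = 0)
    (him : ∀ n : ℤ, ∫ x, w x * (fourier n x).im = 0) (g : C(AddCircle L, ℂ)) :
    ∫ x, (w x : ℂ) * g x = 0 := by
  have hint : ∀ g : C(AddCircle L, ℂ), Integrable fun x => (w x : ℂ) * g x := fun g =>
    hw.ofReal.mul_bdd (c := ‖g‖) g.continuous.aestronglyMeasurable
      (Eventually.of_forall fun x => g.norm_coe_le_norm x)
  have hcl : IsClosed {g : C(AddCircle L, ℂ) | ∫ x, (w x : ℂ) * g x = 0} := by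
    refine isClosed_eq ?_ continuous_const
    refine LipschitzWith.continuous (K := (∫ x, ‖w x‖).toNNReal) ?_
    refine LipschitzWith.of_dist_le_mul fun f g => ?_
    rw [dist_eq_norm, ← integral_sub (hint f) (hint g), dist_eq_norm,
      Real.coe_toNNReal _ (integral_nonneg fun x => norm_nonneg _), ← integral_mul_const]
    refine norm_integral_le_of_norm_le (hw.norm.mul_const _) (Eventually.of_forall fun x => ?_)
    rw [← mul_sub, norm_mul, Complex.norm_real]
    gcongr
    exact (f - g).norm_coe_le_norm x
  have hspan : ∀ g ∈ Submodule.span ℂ (range (fourier (T := L))), ∫ x, (w x : ℂ) * g x = 0 := by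
    intro g hg
    induction hg using Submodule.span_induction with
    | mem g hg =>
      obtain ⟨n, rfl⟩ := hg
      have h1 : ∀ x, (w x : ℂ) * fourier n x
          = ((w x * (fourier n x).re : ℝ) : ℂ) + ((w x * (fourier n x).im : ℝ) : ℂ) * Complex.I := by
        intro x
        conv_lhs => rw [← Complex.re_add_im (fourier n x)]
        push_cast; ring
      simp_rw [h1]
      rw [integral_add ((IsSmooth.fourier_re n).integrable_mul hw).ofReal
        (((IsSmooth.fourier_im n).integrable_mul hw).ofReal.mul_const _), integral_mul_const,
        integral_complex_ofReal, integral_complex_ofReal, hre, him]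
      simp
    | zero => simp
    | add f g _ _ hf hg =>
      simp only [ContinuousMap.add_apply, mul_add]
      rw [integral_add (hint f) (hint g), hf, hg, add_zero]
    | smul c f _ hf =>
      simp only [ContinuousMap.smul_apply, smul_eq_mul, mul_left_comm _ c]
      rw [integral_const_mul, hf, mul_zero]
  have htop : g ∈ (Submodule.span ℂ (range (fourier (T := L)))).topologicalClosure := by
    rw [span_fourier_closure_eq_top]; trivial
  exact closure_minimal hspan hcl htop

/-- An integrable function on the circle is determined by its Fourier coefficients. -/
theorem ae_eq_zero_of_fourier {w : AddCircle L → ℝ} (hw : Integrable w)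
    (hre : ∀ n : ℤ, ∫ x, w x * (fourier n x).re = 0)
    (him : ∀ n : ℤ, ∫ x, w x * (fourier n x).im = 0) : w =ᵐ[volume] 0 := by
  refine ae_eq_zero_of_forall_setIntegral_isClosed_eq_zero hw fun F hF => ?_
  -- Trigonometric polynomials are dense in the continuous functions, and these approximate the
  -- indicator of a closed set boundedly and pointwise.
  have h0 : ∀ n, ∫ x, w x * (hF.apprSeq n x : ℝ) = 0 := by
    intro n
    have h := integral_mul_eq_zero_of_fourier hw hre him
      ⟨fun x => ((hF.apprSeq n x : ℝ) : ℂ), by fun_prop⟩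
    simp only [ContinuousMap.coe_mk, ← Complex.ofReal_mul] at h
    rw [integral_complex_ofReal] at h
    exact_mod_cast h
  have hlim : Tendsto (fun n => ∫ x, w x * (hF.apprSeq n x : ℝ)) atTop
      (𝓝 (∫ x, F.indicator w x)) := by
    refine tendsto_integral_of_dominated_convergence (fun x => ‖w x‖) (fun n => ?_) hw.norm
      (fun n => Eventually.of_forall fun x => ?_) (Eventually.of_forall fun x => ?_)
    · exact hw.aestronglyMeasurable.mul (Continuous.aestronglyMeasurable (by fun_prop))
    · rw [norm_mul]
      refine mul_le_of_le_one_right (norm_nonneg _) ?_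
      rw [Real.norm_of_nonneg (by positivity)]
      exact_mod_cast HasOuterApproxClosed.apprSeq_apply_le_one hF n x
    · have h := tendsto_pi_nhds.1 (HasOuterApproxClosed.tendsto_apprSeq hF) x
      have h2 := (NNReal.tendsto_coe.2 h).const_mul (w x)
      convert h2 using 2
      by_cases hx : x ∈ F <;> simp [hx]
  rw [← integral_indicator hF.measurableSet]
  refine tendsto_nhds_unique hlim ?_
  simp only [h0, tendsto_const_nhds]

theorem ae_eq_zero_of_isSmooth {w : AddCircle L → ℝ} (hw : Integrable w)
    (h : ∀ φ : AddCircle L → ℝ, IsSmooth φ → ∫ x, w x * φ x = 0) : w =ᵐ[volume] 0 :=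
  ae_eq_zero_of_fourier hw (fun n => h _ (IsSmooth.fourier_re n))
    (fun n => h _ (IsSmooth.fourier_im n))

/-! ### Weak derivatives and the Sobolev space -/

namespace HasWeakDeriv

variable {u w : AddCircle L → ℝ}

theorem congr {u' w' : AddCircle L → ℝ} (h : HasWeakDeriv u w) (hu : u =ᵐ[volume] u')
    (hw : w =ᵐ[volume] w') : HasWeakDeriv u' w' := by
  refine ⟨h.integrable.congr hu, h.integrable_deriv.congr hw, fun φ hφ => ?_⟩
  have h1 : ∫ x, u' x * circleDeriv φ x = ∫ x, u x * circleDeriv φ x :=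
    integral_congr_ae (hu.mono fun x hx => by simp only [hx])
  have h2 : ∫ x, w' x * φ x = ∫ x, w x * φ x :=
    integral_congr_ae (hw.mono fun x hx => by simp only [hx])
  rw [h1, h2, h.integral_eq φ hφ]

theorem ae_unique {w' : AddCircle L → ℝ} (h : HasWeakDeriv u w) (h' : HasWeakDeriv u w') :
    w =ᵐ[volume] w' := by
  have h0 := ae_eq_zero_of_isSmooth (h.integrable_deriv.sub h'.integrable_deriv) fun φ hφ => by
    simp only [Pi.sub_apply, sub_mul]
    rw [integral_sub (hφ.integrable_mul h.integrable_deriv)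
      (hφ.integrable_mul h'.integrable_deriv)]
    linarith [h.integral_eq φ hφ, h'.integral_eq φ hφ]
  exact h0.mono fun x hx => sub_eq_zero.1 hx

theorem weakDeriv_ae_eq (h : HasWeakDeriv u w) : weakDeriv u =ᵐ[volume] w := by
  have hex : ∃ w, HasWeakDeriv u w := ⟨w, h⟩
  have h1 : weakDeriv u = hex.choose := by rw [weakDeriv, dif_pos hex]
  rw [h1]
  exact hex.choose_spec.ae_unique h

end HasWeakDeriv

variable (L) in
/-- The Hilbert space `L²(𝕋)`. -/
abbrev L2 : Type := Lp ℝ 2 (volume : Measure (AddCircle L))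

theorem integrable_coe (u : L2 L) : Integrable (u : AddCircle L → ℝ) :=
  (Lp.memLp u).integrable (by norm_num)

theorem inner_eq_integral (u v : L2 L) : ⟪u, v⟫_ℝ = ∫ x, u x * v x := by
  rw [L2.inner_def]
  exact integral_congr_ae (Eventually.of_forall fun x => by simp [mul_comm])

theorem inner_toLp (u : L2 L) {f : AddCircle L → ℝ} (hf : MemLp f 2) :
    ⟪u, hf.toLp f⟫_ℝ = ∫ x, u x * f x := by
  rw [inner_eq_integral]
  exact integral_congr_ae (hf.coeFn_toLp.mono fun x hx => by simp only [hx])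

/-- A smooth function as an element of `L²(𝕋)`. -/
noncomputable def IsSmooth.toL2 {φ : AddCircle L → ℝ} (hφ : IsSmooth φ) : L2 L := (hφ.memLp 2).toLp φ

theorem inner_toL2 (u : L2 L) {φ : AddCircle L → ℝ} (hφ : IsSmooth φ) :
    ⟪u, hφ.toL2⟫_ℝ = ∫ x, u x * φ x := inner_toLp u _

variable (L) in
/-- The pairs `(φ', φ)` with `φ` smooth. -/
noncomputable def testPairs : Set (WithLp 2 (L2 L × L2 L)) :=
  {p | ∃ (φ : AddCircle L → ℝ) (hφ : IsSmooth φ), p = WithLp.toLp 2 (hφ.deriv.toL2, hφ.toL2)}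

variable (L) in
/-- The Sobolev space `H¹(𝕋)`, as the closed space of pairs `(u, u')` in `L²(𝕋) × L²(𝕋)`. -/
noncomputable def Sobolev : Submodule ℝ (WithLp 2 (L2 L × L2 L)) := (Submodule.span ℝ (testPairs L))ᗮ

theorem mem_sobolev {u w : L2 L} :
    WithLp.toLp 2 (u, w) ∈ Sobolev L ↔ HasWeakDeriv (u : AddCircle L → ℝ) w := by
  have key : ∀ (φ : AddCircle L → ℝ) (hφ : IsSmooth φ),
      ⟪WithLp.toLp 2 (hφ.deriv.toL2, hφ.toL2), WithLp.toLp 2 (u, w)⟫_ℝ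
        = (∫ x, u x * circleDeriv φ x) + ∫ x, w x * φ x := by
    intro φ hφ
    rw [WithLp.prod_inner_apply, real_inner_comm, real_inner_comm (WithLp.toLp 2 (u, w)).ofLp.2]
    exact congrArg₂ (· + ·) (inner_toL2 u hφ.deriv) (inner_toL2 w hφ)
  constructor
  · intro h
    refine ⟨integrable_coe u, integrable_coe w, fun φ hφ => ?_⟩
    have := (Submodule.mem_orthogonal _ _).1 h _ (Submodule.subset_span ⟨φ, hφ, rfl⟩)
    rw [key] at this
    linarith
  · intro h
    refine (Submodule.mem_orthogonal _ _).2 fun p hp => ?_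
    induction hp using Submodule.span_induction with
    | mem p hp =>
      obtain ⟨φ, hφ, rfl⟩ := hp
      rw [key, h.integral_eq φ hφ]; ring
    | zero => simp
    | add p q _ _ hp hq => rw [inner_add_left, hp, hq, add_zero]
    | smul c p _ hp => rw [inner_smul_left, hp, mul_zero]

theorem isClosed_sobolev : IsClosed (Sobolev L : Set (WithLp 2 (L2 L × L2 L))) :=
  Submodule.isClosed_orthogonal _

instance : CompleteSpace (Sobolev L) := isClosed_sobolev.completeSpace_coe

namespace Sobolev

variable (L) in
/-- The embedding of `H¹(𝕋)` in `L²(𝕋)`. -/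
noncomputable def emb : Sobolev L →L[ℝ] L2 L := (WithLp.fstL 2 ℝ _ _).comp (Sobolev L).subtypeL

variable (L) in
/-- The derivative from `H¹(𝕋)` to `L²(𝕋)`. -/
noncomputable def der : Sobolev L →L[ℝ] L2 L := (WithLp.sndL 2 ℝ _ _).comp (Sobolev L).subtypeL

theorem hasWeakDeriv (v : Sobolev L) : HasWeakDeriv (emb L v : AddCircle L → ℝ) (der L v) :=
  mem_sobolev.1 v.2

theorem exists_of_hasWeakDeriv {u w : L2 L} (h : HasWeakDeriv (u : AddCircle L → ℝ) w) :
    ∃ v : Sobolev L, emb L v = u ∧ der L v = w :=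
  ⟨⟨_, mem_sobolev.2 h⟩, rfl, rfl⟩

theorem exists_of_memLp {f g : AddCircle L → ℝ} (hf : MemLp f 2) (hg : MemLp g 2)
    (h : HasWeakDeriv f g) : ∃ v : Sobolev L, emb L v = hf.toLp f ∧ der L v = hg.toLp g :=
  exists_of_hasWeakDeriv (h.congr hf.coeFn_toLp.symm hg.coeFn_toLp.symm)

theorem norm_sq (v : Sobolev L) : ‖v‖ ^ 2 = ‖emb L v‖ ^ 2 + ‖der L v‖ ^ 2 := by
  rw [Submodule.coe_norm, WithLp.prod_norm_sq_eq_of_L2]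
  rfl

theorem inner_eq (u v : Sobolev L) :
    ⟪u, v⟫_ℝ = ⟪emb L u, emb L v⟫_ℝ + ⟪der L u, der L v⟫_ℝ := by
  rw [Submodule.coe_inner, WithLp.prod_inner_apply]
  rfl

theorem ext {u v : Sobolev L} (h1 : emb L u = emb L v) (h2 : der L u = der L v) : u = v := by
  rw [← sub_eq_zero, ← norm_eq_zero, ← sq_eq_zero_iff, norm_sq, map_sub, map_sub, h1, h2]
  simp

theorem emb_injective : Function.Injective (emb L) := by
  intro u v h
  refine ext h (Lp.ext ?_)
  have hu := hasWeakDeriv u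
  rw [h] at hu
  exact hu.ae_unique (hasWeakDeriv v)

/-- A smooth function as an element of `H¹(𝕋)`. -/
noncomputable def ofSmooth {φ : AddCircle L → ℝ} (hφ : IsSmooth φ) : Sobolev L :=
  ⟨WithLp.toLp 2 (hφ.toL2, hφ.deriv.toL2), mem_sobolev.2
    (hφ.hasWeakDeriv.congr (hφ.memLp 2).coeFn_toLp.symm (hφ.deriv.memLp 2).coeFn_toLp.symm)⟩

@[simp] theorem emb_ofSmooth {φ : AddCircle L → ℝ} (hφ : IsSmooth φ) :
    emb L (ofSmooth hφ) = hφ.toL2 := rfl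

@[simp] theorem der_ofSmooth {φ : AddCircle L → ℝ} (hφ : IsSmooth φ) :
    der L (ofSmooth hφ) = hφ.deriv.toL2 := rfl

theorem inner_der_toL2 (v : Sobolev L) {φ : AddCircle L → ℝ} (hφ : IsSmooth φ) :
    ⟪der L v, hφ.toL2⟫_ℝ = -⟪emb L v, hφ.deriv.toL2⟫_ℝ := by
  rw [inner_toL2, inner_toL2, (hasWeakDeriv v).integral_eq φ hφ, neg_neg]

theorem eq_zero_of_fourier {u : L2 L}
    (hre : ∀ n : ℤ, ⟪u, (IsSmooth.fourier_re n).toL2⟫_ℝ = 0)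
    (him : ∀ n : ℤ, ⟪u, (IsSmooth.fourier_im n).toL2⟫_ℝ = 0) : u = 0 := by
  simp only [inner_toL2] at hre him
  rw [Lp.eq_zero_iff_ae_eq_zero]
  exact ae_eq_zero_of_fourier (integrable_coe u) hre him

/-- Fourier modes satisfy `φ'' = -a φ` with `a ≥ 0`, so orthogonality in `H¹` reads `(1 + a) ⟪v, φ⟫
= 0` in `L²`. All Fourier coefficients vanish. -/
theorem eq_zero_of_inner_ofSmooth {v : Sobolev L}
    (h : ∀ (φ : AddCircle L → ℝ) (hφ : IsSmooth φ), ⟪v, ofSmooth hφ⟫_ℝ = 0) : v = 0 := by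
  have key : ∀ (φ : AddCircle L → ℝ) (hφ : IsSmooth φ) (a : ℝ), 0 ≤ a →
      circleDeriv (circleDeriv φ) = (fun x => -a * φ x) → ⟪emb L v, hφ.toL2⟫_ℝ = 0 := by
    intro φ hφ a ha hd
    have h1 := h φ hφ
    rw [inner_eq, emb_ofSmooth, der_ofSmooth, inner_der_toL2, inner_toL2 _ hφ.deriv.deriv, hd] at h1
    have h2 : ∫ x, (emb L v) x * (-a * φ x) = -a * ⟪emb L v, hφ.toL2⟫_ℝ := by
      rw [inner_toL2, ← integral_const_mul]
      exact integral_congr_ae (Eventually.of_forall fun x => by ring)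
    rw [h2] at h1
    nlinarith
  refine emb_injective ?_
  rw [map_zero]
  refine eq_zero_of_fourier (fun n => key _ _ ((2 * Real.pi * n / L) ^ 2) (sq_nonneg _) ?_)
    (fun n => key _ _ ((2 * Real.pi * n / L) ^ 2) (sq_nonneg _) ?_)
  · rw [IsSmooth.circleDeriv_fourier_re, IsSmooth.circleDeriv_mul (IsSmooth.const _)
      (IsSmooth.fourier_im n), IsSmooth.circleDeriv_const, IsSmooth.circleDeriv_fourier_im]
    ext x; ring
  · rw [IsSmooth.circleDeriv_fourier_im, IsSmooth.circleDeriv_mul (IsSmooth.const _)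
      (IsSmooth.fourier_re n), IsSmooth.circleDeriv_const, IsSmooth.circleDeriv_fourier_re]
    ext x; ring

/-- Smooth functions are dense in `H¹(𝕋)`. -/
theorem induction_smooth {p : Sobolev L → Prop} (hcl : IsClosed {v | p v})
    (h : ∀ (φ : AddCircle L → ℝ) (hφ : IsSmooth φ), p (ofSmooth hφ)) (v : Sobolev L) : p v := by
  let K : Submodule ℝ (Sobolev L) :=
    { carrier := {v | ∃ (φ : AddCircle L → ℝ) (hφ : IsSmooth φ), v = ofSmooth hφ}
      add_mem' := by
        rintro _ _ ⟨φ, hφ, rfl⟩ ⟨ψ, hψ, rfl⟩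
        exact ⟨_, hφ.add hψ, emb_injective rfl⟩
      zero_mem' := ⟨fun _ => 0, IsSmooth.const 0, emb_injective rfl⟩
      smul_mem' := by
        rintro c _ ⟨φ, hφ, rfl⟩
        exact ⟨_, (IsSmooth.const c).mul hφ, emb_injective rfl⟩ }
  have hK : K.topologicalClosure = ⊤ := by
    rw [Submodule.topologicalClosure_eq_top_iff, Submodule.eq_bot_iff]
    intro w hw
    refine eq_zero_of_inner_ofSmooth fun φ hφ => ?_
    rw [real_inner_comm]
    exact (Submodule.mem_orthogonal _ _).1 hw _ ⟨φ, hφ, rfl⟩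
  have hv : v ∈ K.topologicalClosure := by rw [hK]; trivial
  refine closure_minimal ?_ hcl hv
  rintro _ ⟨φ, hφ, rfl⟩
  exact h φ hφ

theorem denseRange_emb : DenseRange (emb L) := by
  have h : ((emb L).toLinearMap.range).topologicalClosure = ⊤ := by
    rw [Submodule.topologicalClosure_eq_top_iff, Submodule.eq_bot_iff]
    intro w hw
    have h1 : ∀ v, ⟪w, emb L v⟫_ℝ = 0 := fun v => by
      rw [real_inner_comm]
      exact (Submodule.mem_orthogonal _ _).1 hw _ ⟨v, rfl⟩
    exact eq_zero_of_fourier (fun n => h1 (ofSmooth (IsSmooth.fourier_re n)))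
      (fun n => h1 (ofSmooth (IsSmooth.fourier_im n)))
  intro x
  have hx : x ∈ ((emb L).toLinearMap.range).topologicalClosure := by rw [h]; trivial
  exact hx

theorem inner_der (u v : Sobolev L) : ⟪der L u, emb L v⟫_ℝ = -⟪emb L u, der L v⟫_ℝ := by
  refine induction_smooth (p := fun v => ⟪der L u, emb L v⟫_ℝ = -⟪emb L u, der L v⟫_ℝ)
    (isClosed_eq (by fun_prop) (by fun_prop)) (fun φ hφ => ?_) v
  exact inner_der_toL2 u hφ

theorem exists_of_inner {u w : L2 L}
    (h : ∀ v, ⟪u, der L v⟫_ℝ = -⟪w, emb L v⟫_ℝ) : ∃ v : Sobolev L, emb L v = u ∧ der L v = w := by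
  refine exists_of_hasWeakDeriv ⟨integrable_coe u, integrable_coe w, fun φ hφ => ?_⟩
  have := h (ofSmooth hφ)
  rwa [der_ofSmooth, emb_ofSmooth, inner_toL2, inner_toL2] at this

end Sobolev

/-! ### Multiplication operators, product rule and exponential chain rule -/

/-- Multiplication by a bounded function, as an operator on `L²(𝕋)`. -/
noncomputable def mulOp {a : AddCircle L → ℝ} (ha : MemLp a ⊤ volume) : L2 L →L[ℝ] L2 L :=
  (ContinuousLinearMap.mul ℝ ℝ).holderL volume ⊤ 2 2 (ha.toLp a)

section mulOp

variable {a b : AddCircle L → ℝ} (ha : MemLp a ⊤ volume) (hb : MemLp b ⊤ volume)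

theorem coeFn_mulOp (u : L2 L) : (mulOp ha u : AddCircle L → ℝ) =ᵐ[volume] fun x => a x * u x := by
  have h : (mulOp ha u : AddCircle L → ℝ) =ᵐ[volume]
      fun x => ContinuousLinearMap.mul ℝ ℝ ((ha.toLp a) x) (u x) :=
    (ContinuousLinearMap.mul ℝ ℝ).coeFn_holder (r := 2) (ha.toLp a) u
  filter_upwards [h, ha.coeFn_toLp] with x h1 h2
  rw [h1, h2]
  rfl

theorem inner_mulOp (u v : L2 L) : ⟪mulOp ha u, v⟫_ℝ = ∫ x, a x * (u x * v x) := by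
  rw [inner_eq_integral]
  refine integral_congr_ae ?_
  filter_upwards [coeFn_mulOp ha u] with x h1
  rw [h1, mul_assoc]

theorem inner_mulOp_comm (u v : L2 L) : ⟪mulOp ha u, v⟫_ℝ = ⟪u, mulOp ha v⟫_ℝ := by
  rw [inner_mulOp, real_inner_comm, inner_mulOp]
  simp only [mul_comm]

theorem mulOp_toLp {f g : AddCircle L → ℝ} (hf : MemLp f 2) (hg : MemLp g 2)
    (h : ∀ᵐ x, a x * f x = g x) : mulOp ha (hf.toLp f) = hg.toLp g := by
  refine Lp.ext ?_
  filter_upwards [coeFn_mulOp ha (hf.toLp f), hf.coeFn_toLp, hg.coeFn_toLp, h] with x h1 h2 h3 h4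
  rw [h1, h2, h3, h4]

theorem mulOp_mulOp {c : AddCircle L → ℝ} (hc : MemLp c ⊤ volume) (h : ∀ᵐ x, a x * b x = c x)
    (u : L2 L) : mulOp ha (mulOp hb u) = mulOp hc u := by
  refine Lp.ext ?_
  filter_upwards [coeFn_mulOp ha (mulOp hb u), coeFn_mulOp hb u, coeFn_mulOp hc u, h]
    with x h1 h2 h3 h4
  rw [h1, h2, h3, ← h4, mul_assoc]

end mulOp

namespace Sobolev

/-- For smooth `v` the product can be moved onto the test function. Both sides are continuous in `v`
and the graph of the weak derivative is closed, so density finishes. -/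
theorem exists_mul {a a' : AddCircle L → ℝ} (ha : MemLp a ⊤ volume) (ha' : MemLp a' ⊤ volume)
    (h : HasWeakDeriv a a') (v : Sobolev L) :
    ∃ v' : Sobolev L, emb L v' = mulOp ha (emb L v) ∧
      der L v' = mulOp ha' (emb L v) + mulOp ha (der L v) := by
  have key : ∀ v : Sobolev L, WithLp.toLp 2 (mulOp ha (emb L v),
      mulOp ha' (emb L v) + mulOp ha (der L v)) ∈ Sobolev L := by
    refine induction_smooth ?_ fun φ hφ => ?_
    · refine isClosed_sobolev.preimage ?_
      exact (WithLp.prod_continuous_toLp 2 _ _).comp (by fun_prop)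
    · rw [mem_sobolev]
      refine ⟨integrable_coe _, integrable_coe _, fun ψ hψ => ?_⟩
      have i1 := hψ.deriv.integrable_mul (hφ.integrable_mul h.integrable)
      have i2 := hψ.integrable_mul (hφ.deriv.integrable_mul h.integrable)
      have i3 := hψ.integrable_mul (hφ.integrable_mul h.integrable_deriv)
      have e1 : ∫ x, (mulOp ha (emb L (ofSmooth hφ))) x * circleDeriv ψ x
          = ∫ x, a x * φ x * circleDeriv ψ x := by
        refine integral_congr_ae ?_
        filter_upwards [coeFn_mulOp ha (emb L (ofSmooth hφ)), (hφ.memLp 2).coeFn_toLp] with x h1 h2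
        rw [h1]
        exact congrArg (fun r => a x * r * circleDeriv ψ x) h2
      have e2 : ∫ x, (mulOp ha' (emb L (ofSmooth hφ)) + mulOp ha (der L (ofSmooth hφ)) : L2 L) x
          * ψ x = ∫ x, (a' x * φ x * ψ x + a x * circleDeriv φ x * ψ x) := by
        refine integral_congr_ae ?_
        filter_upwards [Lp.coeFn_add (mulOp ha' (emb L (ofSmooth hφ)))
          (mulOp ha (der L (ofSmooth hφ))), coeFn_mulOp ha' (emb L (ofSmooth hφ)),
          coeFn_mulOp ha (der L (ofSmooth hφ)), (hφ.memLp 2).coeFn_toLp,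
          (hφ.deriv.memLp 2).coeFn_toLp] with x h1 h2 h3 h4 h5
        have h4' : (emb L (ofSmooth hφ)) x = φ x := h4
        have h5' : (der L (ofSmooth hφ)) x = circleDeriv φ x := h5
        rw [h1, Pi.add_apply, h2, h3, h4', h5', add_mul]
      have e3 := h.integral_eq _ (hφ.mul hψ)
      rw [hφ.circleDeriv_mul hψ] at e3
      have e4 : ∫ x, a x * (circleDeriv φ x * ψ x + φ x * circleDeriv ψ x)
          = (∫ x, a x * circleDeriv φ x * ψ x) + ∫ x, a x * φ x * circleDeriv ψ x := by
        rw [← integral_add i2 i1]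
        exact integral_congr_ae (Eventually.of_forall fun x => by ring)
      have e5 : ∫ x, a' x * (φ x * ψ x) = ∫ x, a' x * φ x * ψ x :=
        integral_congr_ae (Eventually.of_forall fun x => by ring)
      rw [e4, e5] at e3
      rw [e1, e2, integral_add i3 i2]
      linarith
  exact ⟨⟨_, key v⟩, rfl, rfl⟩

end Sobolev

namespace HasWeakDeriv

theorem const (c : ℝ) : HasWeakDeriv (fun _ : AddCircle L => c) fun _ => 0 := by
  have := (IsSmooth.const (L := L) c).hasWeakDeriv
  rwa [IsSmooth.circleDeriv_const] at this

theorem add {f f' g g' : AddCircle L → ℝ} (hf : HasWeakDeriv f f') (hg : HasWeakDeriv g g') :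
    HasWeakDeriv (fun x => f x + g x) fun x => f' x + g' x := by
  refine ⟨hf.integrable.add hg.integrable, hf.integrable_deriv.add hg.integrable_deriv,
    fun φ hφ => ?_⟩
  simp only [add_mul]
  rw [integral_add (hφ.deriv.integrable_mul hf.integrable) (hφ.deriv.integrable_mul hg.integrable),
    integral_add (hφ.integrable_mul hf.integrable_deriv) (hφ.integrable_mul hg.integrable_deriv),
    hf.integral_eq φ hφ, hg.integral_eq φ hφ]
  ring

theorem const_mul {f f' : AddCircle L → ℝ} (c : ℝ) (hf : HasWeakDeriv f f') :
    HasWeakDeriv (fun x => c * f x) fun x => c * f' x := by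
  refine ⟨hf.integrable.const_mul c, hf.integrable_deriv.const_mul c, fun φ hφ => ?_⟩
  simp only [mul_assoc]
  rw [integral_const_mul, integral_const_mul, hf.integral_eq φ hφ]
  ring

variable {f f' g g' : AddCircle L → ℝ}

theorem mul (hf : HasWeakDeriv f f') (hg : HasWeakDeriv g g') (mf : MemLp f ⊤ volume)
    (mf' : MemLp f' ⊤ volume) (mg : MemLp g 2 volume) (mg' : MemLp g' 2 volume) :
    HasWeakDeriv (fun x => f x * g x) fun x => f' x * g x + f x * g' x := by
  obtain ⟨v, h1, h2⟩ := Sobolev.exists_of_memLp mg mg' hg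
  obtain ⟨w, h3, h4⟩ := Sobolev.exists_mul mf mf' hf v
  have hw := Sobolev.hasWeakDeriv w
  rw [h3, h4, h1, h2] at hw
  refine hw.congr ?_ ?_
  · filter_upwards [coeFn_mulOp mf (mg.toLp g), mg.coeFn_toLp] with x k1 k2
    rw [k1, k2]
  · filter_upwards [Lp.coeFn_add (mulOp mf' (mg.toLp g)) (mulOp mf (mg'.toLp g')),
      coeFn_mulOp mf' (mg.toLp g), coeFn_mulOp mf (mg'.toLp g'), mg.coeFn_toLp, mg'.coeFn_toLp]
      with x k1 k2 k3 k4 k5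
    rw [k1, Pi.add_apply, k2, k3, k4, k5]

theorem pow_succ (hf : HasWeakDeriv f f') (mf : MemLp f ⊤ volume) (mf' : MemLp f' ⊤ volume)
    (n : ℕ) : MemLp (fun x => f x ^ n) ⊤ volume ∧
      HasWeakDeriv (fun x => f x ^ (n + 1)) fun x => (n + 1 : ℝ) * f x ^ n * f' x := by
  induction n with
  | zero => exact ⟨by simpa using memLp_const (1 : ℝ), by simpa using hf⟩
  | succ n ih =>
    have m1 : MemLp (fun x => f x ^ (n + 1)) ⊤ volume := by
      have := mf.mul' (r := ⊤) ih.1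
      simpa only [_root_.pow_succ] using this
    have m2 : MemLp (fun x => (n + 1 : ℝ) * f x ^ n * f' x) ⊤ volume :=
      mf'.mul' (r := ⊤) (ih.1.const_mul _)
    refine ⟨m1, ?_⟩
    have := ih.2.mul hf m1 m2 (mf.mono_exponent le_top) (mf'.mono_exponent le_top)
    simp only [← _root_.pow_succ] at this
    convert this using 2 with x
    push_cast; ring

theorem exp_sum (hf : HasWeakDeriv f f') (mf : MemLp f ⊤ volume) (mf' : MemLp f' ⊤ volume)
    (n : ℕ) : HasWeakDeriv (fun x => ∑ i ∈ Finset.range (n + 1), f x ^ i / (i.factorial : ℝ))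
      fun x => (∑ i ∈ Finset.range n, f x ^ i / (i.factorial : ℝ)) * f' x := by
  induction n with
  | zero => simpa using const (L := L) 1
  | succ n ih =>
    simp only [Finset.sum_range_succ _ (n + 1), Finset.sum_range_succ _ n, add_mul]
    simp only [Finset.sum_range_succ _ n] at ih
    convert ih.add ((hf.pow_succ mf mf' n).2.const_mul (1 / ((n + 1).factorial : ℝ))) using 2 with x x
    · ring
    · rw [Nat.factorial_succ]; push_cast; field_simp

/-- The exponential series has partial sums whose weak derivative is the preceding partial sum times
`f'`; both are bounded by `exp K` almost everywhere, so dominated convergence applies. -/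
theorem exp (hf : HasWeakDeriv f f') (mf : MemLp f ⊤ volume) (mf' : MemLp f' ⊤ volume) :
    MemLp (fun x => Real.exp (f x)) ⊤ volume ∧
      HasWeakDeriv (fun x => Real.exp (f x)) fun x => Real.exp (f x) * f' x := by
  obtain ⟨K, hK⟩ : ∃ K, ∀ᵐ x, ‖f x‖ ≤ K := by
    refine ⟨(eLpNormEssSup f volume).toReal, ?_⟩
    filter_upwards [ae_le_eLpNormEssSup (f := f) (μ := volume)] with x hx
    have hfin : eLpNormEssSup f volume ≠ ⊤ := by
      rw [← eLpNorm_exponent_top]; exact mf.2.ne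
    simpa using ENNReal.toReal_mono hfin hx
  have hm : MemLp (fun x => Real.exp (f x)) ⊤ volume := by
    refine MemLp.of_bound (Real.continuous_exp.comp_aestronglyMeasurable mf.1) (Real.exp K) ?_
    filter_upwards [hK] with x hx
    rw [Real.norm_of_nonneg (Real.exp_nonneg _)]
    exact Real.exp_le_exp.2 ((le_abs_self _).trans hx)
  refine ⟨hm, hm.integrable le_top, (mf'.mul' (r := ⊤) hm).integrable le_top, fun φ hφ => ?_⟩
  have hsum : ∀ x, Tendsto (fun n => ∑ i ∈ Finset.range n, f x ^ i / (i.factorial : ℝ)) atTop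
      (𝓝 (Real.exp (f x))) := fun x => by
    have := (NormedSpace.expSeries_div_hasSum_exp (f x)).tendsto_sum_nat
    rwa [← Real.exp_eq_exp_ℝ] at this
  have hbd : ∀ x, ‖f x‖ ≤ K → ∀ n, ‖∑ i ∈ Finset.range n, f x ^ i / (i.factorial : ℝ)‖
      ≤ Real.exp K := by
    intro x hx n
    refine (norm_sum_le _ _).trans ((Real.sum_le_exp_of_nonneg (norm_nonneg (f x)) n).trans'
      (Finset.sum_le_sum fun i _ => ?_) |>.trans (Real.exp_le_exp.2 hx))
    simp
  have hms : ∀ n, AEStronglyMeasurable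
      (fun x => ∑ i ∈ Finset.range n, f x ^ i / (i.factorial : ℝ)) volume := fun n =>
    (Continuous.comp_aestronglyMeasurable (g := fun y : ℝ =>
      ∑ i ∈ Finset.range n, y ^ i / (i.factorial : ℝ)) (by fun_prop) mf.1)
  have t1 : Tendsto (fun n => ∫ x, (∑ i ∈ Finset.range (n + 1), f x ^ i / (i.factorial : ℝ))
      * circleDeriv φ x) atTop (𝓝 (∫ x, Real.exp (f x) * circleDeriv φ x)) := by
    refine tendsto_integral_of_dominated_convergence (fun x => Real.exp K * ‖circleDeriv φ x‖)
      (fun n => (hms _).mul hφ.deriv.continuous.aestronglyMeasurable)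
      (hφ.deriv.integrable.norm.const_mul _) (fun n => ?_) (Eventually.of_forall fun x =>
        (((tendsto_add_atTop_iff_nat 1).2 (hsum x))).mul_const _)
    filter_upwards [hK] with x hx
    rw [norm_mul]
    exact mul_le_mul_of_nonneg_right (hbd x hx _) (norm_nonneg _)
  have t2 : Tendsto (fun n => ∫ x, (∑ i ∈ Finset.range n, f x ^ i / (i.factorial : ℝ)) * f' x
      * φ x) atTop (𝓝 (∫ x, Real.exp (f x) * f' x * φ x)) := by
    refine tendsto_integral_of_dominated_convergence (fun x => Real.exp K * ‖f' x * φ x‖)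
      (fun n => ((hms _).mul mf'.1).mul hφ.continuous.aestronglyMeasurable)
      ((hφ.integrable_mul (mf'.integrable le_top)).norm.const_mul _) (fun n => ?_)
      (Eventually.of_forall fun x => ((hsum x).mul_const _).mul_const _)
    filter_upwards [hK] with x hx
    rw [mul_assoc, norm_mul]
    exact mul_le_mul_of_nonneg_right (hbd x hx _) (norm_nonneg _)
  refine tendsto_nhds_unique t1 ?_
  simp only [(hf.exp_sum mf mf' _).integral_eq φ hφ]
  exact t2.neg

end HasWeakDeriv

/-! ### Poincaré inequalities, plain and weighted -/

theorem norm_toL2_sq {φ : AddCircle L → ℝ} (hφ : IsSmooth φ) : ‖hφ.toL2‖ ^ 2 = ∫ x, φ x ^ 2 := by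
  rw [← real_inner_self_eq_norm_sq, inner_toL2]
  refine integral_congr_ae ?_
  filter_upwards [(hφ.memLp 2).coeFn_toLp] with x hx
  rw [sq]
  exact congrArg (· * φ x) hx

theorem integral_const_circle (c : ℝ) : ∫ _ : AddCircle L, c = L * c := by
  rw [integral_const, measureReal_def, AddCircle.measure_univ,
    ENNReal.toReal_ofReal (Fact.out : 0 < L).le, smul_eq_mul]

theorem IsSmooth.abs_sub_le {φ : AddCircle L → ℝ} (hφ : IsSmooth φ) (x : AddCircle L) :
    |φ x - φ 0| ≤ ∫ y, |circleDeriv φ y| := by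
  have hL : 0 < L := Fact.out
  obtain ⟨s, hs, rfl⟩ : ∃ s ∈ Ico (0 : ℝ) (0 + L), (s : AddCircle L) = x := by
    have := AddCircle.coe_image_Ico_eq L 0
    have hx : x ∈ (QuotientAddGroup.mk '' Ico (0 : ℝ) (0 + L) : Set (AddCircle L)) := by
      rw [this]; trivial
    exact hx
  have hc : Continuous fun s : ℝ => circleDeriv φ (s : AddCircle L) := ContDiff.continuous hφ.deriv
  have h1 := intervalIntegral.integral_eq_sub_of_hasDerivAt (E := ℝ) (a := 0) (b := s)
    (fun r _ => hφ.hasDerivAt r) (hc.intervalIntegrable _ _)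
  rw [AddCircle.coe_zero] at h1
  rw [← h1, ← AddCircle.intervalIntegral_preimage L 0 fun y => |circleDeriv φ y|]
  rw [← Real.norm_eq_abs]
  refine (intervalIntegral.norm_integral_le_integral_norm hs.1).trans ?_
  exact intervalIntegral.integral_mono_interval le_rfl hs.1 hs.2.le
    (Eventually.of_forall fun x => abs_nonneg _) (hc.norm.intervalIntegrable _ _)

theorem IsSmooth.sq_integral_abs_le {φ : AddCircle L → ℝ} (hφ : IsSmooth φ) :
    (∫ x, |φ x|) ^ 2 ≤ L * ∫ x, φ x ^ 2 := by
  have hL : 0 < L := Fact.out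
  set I := ∫ x, |φ x| with hI
  -- Cauchy–Schwarz as nonnegativity of the variance of `|φ|`.
  have h0 : 0 ≤ ∫ x, (|φ x| - I / L) ^ 2 := integral_nonneg fun x => sq_nonneg _
  have i1 : Integrable fun x => φ x ^ 2 := (hφ.memLp 2).integrable_sq
  have i2 : Integrable fun x => 2 * (I / L) * |φ x| := hφ.integrable.abs.const_mul _
  have i3 : Integrable fun x => φ x ^ 2 - 2 * (I / L) * |φ x| := i1.sub i2
  have h1 : ∫ x, (|φ x| - I / L) ^ 2 = (∫ x, φ x ^ 2) - 2 * (I / L) * I + L * (I / L) ^ 2 := by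
    rw [← integral_const_circle ((I / L) ^ 2), hI, ← integral_const_mul, ← hI,
      ← integral_sub i1 i2, ← integral_add i3 (integrable_const _)]
    refine integral_congr_ae (Eventually.of_forall fun x => ?_)
    simp only
    rw [← sq_abs (φ x)]
    ring
  rw [h1] at h0
  have h2 : L * ((∫ x, φ x ^ 2) - 2 * (I / L) * I + L * (I / L) ^ 2)
      = L * (∫ x, φ x ^ 2) - I ^ 2 := by field_simp; ring
  nlinarith [mul_nonneg hL.le h0]

variable (L) in
/-- The constant function `1` in `L²(𝕋)`. -/
noncomputable def one : L2 L := (IsSmooth.const 1).toL2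

theorem IsSmooth.norm_sub_le {φ : AddCircle L → ℝ} (hφ : IsSmooth φ) :
    ‖hφ.toL2 - φ 0 • one L‖ ≤ L * ‖hφ.deriv.toL2‖ := by
  have hL : 0 < L := Fact.out
  have hs : IsSmooth fun x => φ x + -φ 0 := hφ.add (IsSmooth.const (-φ 0))
  have h1 : hφ.toL2 - φ 0 • one L = hs.toL2 := by
    refine Lp.ext ?_
    filter_upwards [Lp.coeFn_sub hφ.toL2 (φ 0 • one L), Lp.coeFn_smul (φ 0) (one L),
      (hφ.memLp 2).coeFn_toLp, (hs.memLp 2).coeFn_toLp,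
      ((IsSmooth.const (L := L) 1).memLp 2).coeFn_toLp] with x h1 h2 h3 h4 h5
    have h3' : hφ.toL2 x = φ x := h3
    have h4' : hs.toL2 x = φ x + -φ 0 := h4
    have h5' : (one L) x = 1 := h5
    rw [h1, Pi.sub_apply, h2, Pi.smul_apply, h3', h4', h5']
    simp [sub_eq_add_neg]
  rw [h1]
  refine le_of_sq_le_sq ?_ (by positivity)
  rw [norm_toL2_sq, mul_pow, norm_toL2_sq]
  have h2 : ∀ x, (φ x + -φ 0) ^ 2 ≤ L * ∫ x, circleDeriv φ x ^ 2 := fun x => by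
    refine le_trans ?_ hφ.deriv.sq_integral_abs_le
    rw [← sub_eq_add_neg, ← sq_abs]
    exact pow_le_pow_left₀ (abs_nonneg _) (hφ.abs_sub_le x) 2
  calc ∫ x, (φ x + -φ 0) ^ 2 ≤ ∫ _ : AddCircle L, L * ∫ x, circleDeriv φ x ^ 2 :=
        integral_mono (hs.memLp 2).integrable_sq (integrable_const _) h2
    _ = L ^ 2 * ∫ x, circleDeriv φ x ^ 2 := by rw [integral_const_circle]; ring

namespace Sobolev

/-- The Poincaré–Wirtinger inequality on the circle. -/
theorem exists_norm_sub_le (v : Sobolev L) :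
    ∃ c : ℝ, ‖emb L v - c • one L‖ ≤ L * ‖der L v‖ := by
  -- The constant `φ 0` has no meaning for a general element of `H¹`. The projection onto constants
  -- does at least as well and makes the inequality a closed condition.
  let K : Submodule ℝ (L2 L) := Submodule.span ℝ {one L}
  have h : ‖emb L v - K.starProjection (emb L v)‖ ≤ L * ‖der L v‖ := by
    refine induction_smooth (p := fun v => ‖emb L v - K.starProjection (emb L v)‖ ≤ L * ‖der L v‖)
      (isClosed_le (by fun_prop) (by fun_prop)) (fun φ hφ => ?_) v
    refine le_trans ?_ hφ.norm_sub_le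
    rw [Submodule.starProjection_minimal]
    exact ciInf_le (f := fun x : K => ‖emb L (ofSmooth hφ) - x‖)
      ⟨0, by rintro _ ⟨x, rfl⟩; exact norm_nonneg _⟩
      ⟨φ 0 • one L, Submodule.smul_mem _ _ (Submodule.mem_span_singleton_self _)⟩
  obtain ⟨c, hc⟩ := Submodule.mem_span_singleton.1 (K.starProjection_apply_mem (emb L v))
  exact ⟨c, by rwa [hc]⟩

theorem inner_mulOp_der {a a' : AddCircle L → ℝ} (ha : MemLp a ⊤ volume) (ha' : MemLp a' ⊤ volume)
    (h : HasWeakDeriv a a') (u v : Sobolev L) :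
    ⟪der L u, mulOp ha (emb L v)⟫_ℝ + ⟪mulOp ha (emb L u), der L v⟫_ℝ
      = -⟪mulOp ha' (emb L u), emb L v⟫_ℝ := by
  obtain ⟨w, h1, h2⟩ := exists_mul ha ha' h v
  rw [← h1, inner_der, h2, inner_add_right, inner_mulOp_comm ha, inner_mulOp_comm ha']
  ring

end Sobolev

theorem norm_toLp_pos {f : AddCircle L → ℝ} (hf : MemLp f 2 volume) (h : ∀ x, 0 < f x) :
    0 < ‖hf.toLp f‖ := by
  refine norm_pos_iff.2 fun h0 => ?_
  have h1 := hf.coeFn_toLp.symm.trans ((Lp.eq_zero_iff_ae_eq_zero).1 h0)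
  have h2 : ∀ᵐ _ : AddCircle L, False := by
    filter_upwards [h1] with x hx
    exact (h x).ne' hx
  have h3 : (volume : Measure (AddCircle L)) univ = 0 := by
    rw [eventually_false_iff_eq_bot, ae_eq_bot] at h2
    simp [h2]
  rw [AddCircle.measure_univ, ENNReal.ofReal_eq_zero] at h3
  exact absurd h3 (not_le.2 Fact.out)

section weighted

open Sobolev

theorem exists_exp_neg {θ θ₁ : AddCircle L → ℝ} (m₀ : MemLp θ ⊤ volume)
    (m₁ : MemLp θ₁ ⊤ volume) (h₁ : HasWeakDeriv θ θ₁)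
    (me : MemLp (fun x => Real.exp (-θ x)) 2 volume) :
    ∃ p : Sobolev L, emb L p = me.toLp _ ∧
    der L p + mulOp m₁ (emb L p) = 0 := by
  have hn : HasWeakDeriv (fun x => -θ x) fun x => -θ₁ x := by
    simpa using h₁.const_mul (-1)
  obtain ⟨mp, hp⟩ := hn.exp m₀.neg m₁.neg
  have mp' : MemLp (fun x => Real.exp (-θ x) * -θ₁ x) 2 volume :=
    (m₁.neg.mul' (r := ⊤) mp).mono_exponent le_top
  obtain ⟨p, hp0, hp1⟩ := exists_of_memLp me mp' hp
  refine ⟨p, hp0, ?_⟩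
  rw [hp0, hp1, mulOp_toLp m₁ me mp'.neg (Eventually.of_forall fun x => by
      simp only [Pi.neg_apply]; ring), MemLp.toLp_neg mp', add_neg_cancel]

/-- The Poincaré inequality in the weighted space `L²(e^{-2θ})`. -/
theorem exists_weighted_poincare {θ θ₁ : AddCircle L → ℝ} (m₀ : MemLp θ ⊤ volume)
    (m₁ : MemLp θ₁ ⊤ volume) (h₁ : HasWeakDeriv θ θ₁)
    (me : MemLp (fun x => Real.exp (-θ x)) 2 volume) :
    ∃ P : ℝ, 0 ≤ P ∧ ∀ v : Sobolev L,
    ⟪emb L v, me.toLp _⟫_ℝ = 0 → ‖emb L v‖ ≤ P * ‖der L v + mulOp m₁ (emb L v)‖ := by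
  have hL : 0 < L := Fact.out
  obtain ⟨mq, hq⟩ := h₁.exp m₀ m₁
  have mp : MemLp (fun x => Real.exp (-θ x)) ⊤ volume := by
    have hn : HasWeakDeriv (fun x => -θ x) fun x => -θ₁ x := by
      simpa using h₁.const_mul (-1)
    exact (hn.exp m₀.neg m₁.neg).1
  have mq' : MemLp (fun x => Real.exp (θ x) * θ₁ x) ⊤ volume := m₁.mul' (r := ⊤) mq
  refine ⟨‖mulOp mp‖ * (L * ‖mulOp mq‖), by positivity, fun v hv => ?_⟩
  -- The substitution `y = e^θ v` gives `y' = e^θ (v' + θ' v)` and reduces the claim to the plain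
  -- inequality; the subtracted constant becomes a multiple of `e^{-θ}`.
  obtain ⟨y, hy1, hy2⟩ := exists_mul mq mq' hq v
  obtain ⟨c, hc⟩ := exists_norm_sub_le y
  have hy3 : der L y = mulOp mq (der L v + mulOp m₁ (emb L v)) := by
    rw [hy2, map_add, mulOp_mulOp mq m₁ mq' (Eventually.of_forall fun x => rfl), add_comm]
  have e1 : emb L v - c • me.toLp _ = mulOp mp (emb L y - c • one L) := by
    have k1 : mulOp mp (mulOp mq (emb L v)) = emb L v := by
      refine Lp.ext ?_
      filter_upwards [coeFn_mulOp mp (mulOp mq (emb L v)), coeFn_mulOp mq (emb L v)] with x a1 a2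
      rw [a1, a2, ← mul_assoc, ← Real.exp_add, neg_add_cancel, Real.exp_zero, one_mul]
    have k2 : mulOp mp (one L) = me.toLp _ :=
      mulOp_toLp mp ((IsSmooth.const 1).memLp 2) me (Eventually.of_forall fun x => mul_one _)
    rw [map_sub, map_smul, hy1, k1, k2]
  -- As `v` is orthogonal to `e^{-θ}`, subtracting a multiple of it can only increase the norm.
  have e2 : ‖emb L v‖ ≤ ‖emb L v - c • me.toLp _‖ := by
    refine le_of_sq_le_sq ?_ (norm_nonneg _)
    rw [norm_sub_sq_real, inner_smul_right, hv]
    nlinarith [sq_nonneg ‖c • me.toLp _‖]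
  have e3 : ‖emb L y - c • one L‖ ≤ L * (‖mulOp mq‖ * ‖der L v + mulOp m₁ (emb L v)‖) := by
    refine hc.trans (mul_le_mul_of_nonneg_left ?_ hL.le)
    rw [hy3]
    exact (mulOp mq).le_opNorm _
  rw [e1] at e2
  refine e2.trans (((mulOp mp).le_opNorm _).trans ?_)
  rw [mul_assoc, mul_assoc]
  exact mul_le_mul_of_nonneg_left e3 (norm_nonneg _)

end weighted

/-! ### The concrete adjoint pair on the torus -/

theorem sq_add_sq_le_of_le {x y d s n : ℝ} (hd : 0 ≤ d) (h : d ≤ s * x + n * y) :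
    y ^ 2 + d ^ 2 ≤ (1 + 2 * s ^ 2 + 2 * n ^ 2) * (y ^ 2 + x ^ 2) := by
  have h1 : d ^ 2 ≤ (s * x + n * y) ^ 2 := pow_le_pow_left₀ hd h 2
  nlinarith [sq_nonneg (s * x - n * y), sq_nonneg (s * y), sq_nonneg (n * x), sq_nonneg x]

-- Multiplication by `θ'` is bounded and symmetric, so `A` and `As` share the domain `H¹` and `A +
-- As` is bounded. Their commutator is multiplication by `-2 σ² θ''`, where the second bounded
-- derivative is needed, and `e^{-θ}` lies in the kernel of `A`.
open Sobolev in
theorem exists_dirichletPair {θ θ₁ θ₂ : AddCircle L → ℝ} (m₀ : MemLp θ ⊤ volume)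
    (m₁ : MemLp θ₁ ⊤ volume) (m₂ : MemLp θ₂ ⊤ volume) (h₁ : HasWeakDeriv θ θ₁)
    (h₂ : HasWeakDeriv θ₁ θ₂) {σ : ℝ} (hσ : 0 < σ)
    (me : MemLp (fun x => Real.exp (-θ x)) 2 volume) :
    ∃ S : DirichletPair (L2 L) (Sobolev L), S.ι = emb L ∧
      (∀ v, S.A v = σ • (der L v + mulOp m₁ (emb L v))) ∧
      (∀ v, S.As v = σ • (-der L v + mulOp m₁ (emb L v))) ∧
      ∃ r : ℝ, S.ι S.m = r • me.toLp _ := by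
  obtain ⟨p, hp0, hp1⟩ := exists_exp_neg m₀ m₁ h₁ me
  obtain ⟨P, hP0, hP⟩ := exists_weighted_poincare m₀ m₁ h₁ me
  set M := mulOp m₁ with hM
  set A : Sobolev L →L[ℝ] L2 L := σ • (der L + M.comp (emb L)) with hA
  set As : Sobolev L →L[ℝ] L2 L := σ • (-der L + M.comp (emb L)) with hAs
  have eA : ∀ v, A v = σ • (der L v + M (emb L v)) := fun v => rfl
  have eAs : ∀ v, As v = σ • (-der L v + M (emb L v)) := fun v => rfl
  have hMc : ∀ u v, ⟪M u, v⟫_ℝ = ⟪u, M v⟫_ℝ := inner_mulOp_comm m₁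
  have hMn : ∀ u, ‖M u‖ ≤ ‖M‖ * ‖u‖ := M.le_opNorm
  have hpne : 0 < ‖emb L p‖ := by
    rw [hp0]; exact norm_toLp_pos me fun x => Real.exp_pos _
  have hAp : A p = 0 := by rw [eA, hp1, smul_zero]
  have hnorm : ∀ v, ‖v‖ ^ 2 = ‖emb L v‖ ^ 2 + ‖der L v‖ ^ 2 := norm_sq
  have hdA : ∀ v, der L v = σ⁻¹ • A v - M (emb L v) := fun v => by
    rw [eA, smul_smul, inv_mul_cancel₀ hσ.ne', one_smul, add_sub_cancel_right]
  have hdAs : ∀ v, der L v = M (emb L v) - σ⁻¹ • As v := fun v => by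
    rw [eAs, smul_smul, inv_mul_cancel₀ hσ.ne', one_smul]; abel
  have hσn : ‖σ⁻¹‖ = σ⁻¹ := by rw [Real.norm_eq_abs, abs_of_pos (inv_pos.2 hσ)]
  refine ⟨{ ι := emb L, A := A, As := As, c := (-(2 * σ ^ 2)) • mulOp m₂, m := ‖emb L p‖⁻¹ • p,
            b := 2 * σ * ‖M‖, P := P * σ⁻¹,
            Cv := 1 + 2 * σ⁻¹ ^ 2 + 2 * ‖M‖ ^ 2,
            b_nonneg := by positivity
            P_nonneg := by positivity
            Cv_pos := by positivity
            injective := emb_injective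
            dense := denseRange_emb
            adj := ?_, closed_A := ?_, closed_As := ?_, comm := ?_, norm_sq_le_A := ?_,
            norm_sq_le_As := ?_, norm_A_le := ?_, A_m := ?_, norm_m := ?_, poincare := ?_ },
          rfl, eA, eAs, ‖emb L p‖⁻¹, ?_⟩
  · intro u v
    rw [eA, eAs, inner_smul_left, inner_smul_right, inner_add_left, inner_add_right,
      inner_neg_right, inner_der, hMc]
    rfl
  · intro w q h
    obtain ⟨u, hu1, hu2⟩ := exists_of_inner (u := w) (w := σ⁻¹ • q - M w) fun v => by
      have := h v
      rw [eAs, inner_smul_right, inner_add_right, inner_neg_right, ← hMc] at this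
      rw [inner_sub_left, inner_smul_left, ← this]
      simp only [RCLike.conj_to_real]
      field_simp; ring
    refine ⟨u, hu1, ?_⟩
    rw [eA, hu1, hu2, sub_add_cancel, smul_smul, mul_inv_cancel₀ hσ.ne', one_smul]
  · intro w q h
    obtain ⟨u, hu1, hu2⟩ := exists_of_inner (u := w) (w := M w - σ⁻¹ • q) fun v => by
      have := h v
      rw [eA, inner_smul_right, inner_add_right, ← hMc] at this
      rw [inner_sub_left, inner_smul_left, ← this]
      simp only [RCLike.conj_to_real]
      field_simp; ring
    refine ⟨u, hu1, ?_⟩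
    rw [eAs, hu1, hu2, neg_sub, sub_add_cancel, smul_smul, mul_inv_cancel₀ hσ.ne', one_smul]
  · intro u v
    have h1 := inner_mulOp_der m₁ m₂ h₂ u v
    rw [← hM] at h1
    rw [eA, eA, eAs, eAs, smul_apply]
    simp only [inner_smul_left, inner_smul_right, inner_add_left, inner_add_right, inner_neg_left,
      inner_neg_right, RCLike.conj_to_real]
    linear_combination (2 * σ ^ 2) * h1
  · intro v
    rw [hnorm]
    refine sq_add_sq_le_of_le (norm_nonneg _) ?_
    rw [hdA]
    refine (norm_sub_le _ _).trans (add_le_add ?_ (hMn _))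
    rw [norm_smul, hσn]
  · intro v
    rw [hnorm]
    refine sq_add_sq_le_of_le (norm_nonneg _) ?_
    rw [hdAs, norm_sub_rev]
    refine (norm_sub_le _ _).trans (add_le_add ?_ (hMn _))
    rw [norm_smul, hσn]
  · intro v
    have h1 : A v = -As v + (2 * σ) • M (emb L v) := by
      rw [eA, eAs]; module
    rw [h1]
    refine (norm_add_le _ _).trans (add_le_add (norm_neg _).le ?_)
    rw [norm_smul, Real.norm_of_nonneg (by positivity), mul_assoc (2 * σ)]
    exact mul_le_mul_of_nonneg_left (hMn _) (by positivity)
  · rw [map_smul, hAp, smul_zero]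
  · rw [map_smul, norm_smul, norm_inv, norm_norm, inv_mul_cancel₀ hpne.ne']
  · intro v hv
    rw [map_smul, inner_smul_right] at hv
    have hv' : ⟪emb L v, me.toLp _⟫_ℝ = 0 := by
      rw [← hp0]
      exact (mul_eq_zero.1 hv).resolve_left (inv_ne_zero hpne.ne')
    refine (hP v hv').trans (le_of_eq ?_)
    rw [eA, norm_smul, Real.norm_of_nonneg hσ.le, mul_assoc, inv_mul_cancel_left₀ hσ.ne']
  · rw [map_smul, hp0]

/-! ### From distributional solutions to integrated weak solutions -/

namespace DirichletPair

variable {H V : Type*} [NormedAddCommGroup H] [InnerProductSpace ℝ H]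
    [NormedAddCommGroup V] [InnerProductSpace ℝ V] (S : DirichletPair H V)

/-- The generator of the Hermite system, tested against `v` in the `k`-th component. -/
noncomputable def generator (ε τ : ℝ) (k : ℕ) (v : V) : lp (fun _ : ℕ => H) 2 →L[ℝ] ℝ :=
  (-(1 / ε)) • (√(k : ℝ) • (innerSL ℝ (S.As v)).comp (lp.evalCLM ℝ (fun _ : ℕ => H) 2 (k - 1))
    - √((k : ℝ) + 1) • (innerSL ℝ (S.A v)).comp (lp.evalCLM ℝ (fun _ : ℕ => H) 2 (k + 1)))
    - ((k : ℝ) / τ) • (innerSL ℝ (S.ι v)).comp (lp.evalCLM ℝ (fun _ : ℕ => H) 2 k)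

theorem generator_apply (ε τ : ℝ) (k : ℕ) (v : V) (x : lp (fun _ : ℕ => H) 2) :
    S.generator ε τ k v x = -(1 / ε) * (√(k : ℝ) * ⟪x (k - 1), S.As v⟫_ℝ
      - √((k : ℝ) + 1) * ⟪x (k + 1), S.A v⟫_ℝ) - (k : ℝ) / τ * ⟪x k, S.ι v⟫_ℝ := by
  rw [real_inner_comm, real_inner_comm (S.A v), real_inner_comm (S.ι v)]
  rfl

theorem generator_single (ε τ : ℝ) (k : ℕ) (v : V) (s : ℝ) :
    S.generator ε τ k v (lp.single 2 0 (s • S.ι S.m)) = 0 := by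
  rw [generator_apply]
  rcases k with _ | _ | k
  · rw [lp.single_apply_ne 2 0 _ (Nat.succ_ne_zero 0)]
    simp
  · rw [lp.single_apply_ne 2 0 _ (Nat.succ_ne_zero 0), lp.single_apply_ne 2 0 _ (Nat.succ_ne_zero 1),
      Nat.add_sub_cancel, lp.single_apply_self, inner_smul_left, ← S.adj, S.A_m]
    simp
  · rw [lp.single_apply_ne 2 0 _ (Nat.succ_ne_zero _), lp.single_apply_ne 2 0 _ (Nat.succ_ne_zero _),
      lp.single_apply_ne 2 0 _ (by omega)]
    simp

theorem continuous_generator (ε τ : ℝ) (k : ℕ) (x : lp (fun _ : ℕ => H) 2) :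
    Continuous fun v => S.generator ε τ k v x := by
  simp only [generator_apply]
  fun_prop

/-- The integrated weak formulation follows from the weak formulation against a dense set of
test vectors; the equilibrium can be subtracted. -/
theorem isWeakSolution_sub_single [CompleteSpace H] {ε τ : ℝ} {D : ℝ → lp (fun _ : ℕ => H) 2}
    (hc : ContinuousOn D (Ici 0)) {T : Set V} (hT : Dense T)
    (h : ∀ k, ∀ v ∈ T, ∀ t : ℝ, 0 ≤ t → HasDerivWithinAt (fun s => ⟪D s k, S.ι v⟫_ℝ)
      (S.generator ε τ k v (D t)) (Ici 0) t) (r : ℝ) :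
    S.IsWeakSolution ε τ fun t => D t - lp.single 2 0 (r • S.ι S.m) := by
  refine ⟨hc.sub continuousOn_const, fun k v t ht => ?_⟩
  have hDi : IntervalIntegrable D volume 0 t :=
    (hc.mono (by rw [uIcc_of_le ht]; exact Icc_subset_Ici_self)).intervalIntegrable
  have key : ∀ v, ⟪D t k, S.ι v⟫_ℝ - ⟪D 0 k, S.ι v⟫_ℝ
      = S.generator ε τ k v (∫ s in (0 : ℝ)..t, D s) := by
    -- The time-integrated identity is continuous in `v`, so it extends from the dense test vectors
    -- to all of `V`.
    have hcl : IsClosed {v | ⟪D t k, S.ι v⟫_ℝ - ⟪D 0 k, S.ι v⟫_ℝ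
        = S.generator ε τ k v (∫ s in (0 : ℝ)..t, D s)} :=
      isClosed_eq (by fun_prop) (S.continuous_generator ε τ k _)
    have hsub : T ⊆ {v | ⟪D t k, S.ι v⟫_ℝ - ⟪D 0 k, S.ι v⟫_ℝ
        = S.generator ε τ k v (∫ s in (0 : ℝ)..t, D s)} := by
      intro v hv
      have h1 := intervalIntegral.integral_eq_sub_of_hasDeriv_right_of_le ht
        (f := fun s => ⟪D s k, S.ι v⟫_ℝ) (f' := fun s => S.generator ε τ k v (D s))
        (fun s hs => (h k v hv s hs.1).continuousWithinAt.mono Icc_subset_Ici_self)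
        (fun s hs => (h k v hv s hs.1.le).mono (Ioi_subset_Ici hs.1.le))
        (ContinuousOn.intervalIntegrable
          ((S.generator ε τ k v).continuous.comp_continuousOn (hc.mono (by
            rw [uIcc_of_le ht]; exact Icc_subset_Ici_self))))
      rw [ContinuousLinearMap.intervalIntegral_comp_comm _ hDi] at h1
      exact h1.symm
    intro v
    exact closure_minimal hsub hcl (hT v)
  have h1 : ∀ s, -(1 / ε) * (√(k : ℝ) * ⟪(D s - lp.single 2 0 (r • S.ι S.m) :
        lp (fun _ : ℕ => H) 2) (k - 1), S.As v⟫_ℝ - √((k : ℝ) + 1) *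
        ⟪(D s - lp.single 2 0 (r • S.ι S.m) : lp (fun _ : ℕ => H) 2) (k + 1), S.A v⟫_ℝ)
        - (k : ℝ) / τ * ⟪(D s - lp.single 2 0 (r • S.ι S.m) : lp (fun _ : ℕ => H) 2) k, S.ι v⟫_ℝ
      = S.generator ε τ k v (D s) := fun s => by
    rw [← generator_apply, map_sub, generator_single, sub_zero]
  simp only [h1]
  rw [ContinuousLinearMap.intervalIntegral_comp_comm _ hDi, ← key, lp.coeFn_sub, lp.coeFn_sub,
    Pi.sub_apply, Pi.sub_apply, inner_sub_left, inner_sub_left]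
  ring

theorem isBOf_single (r : ℝ) : S.IsBOf 0 (lp.single 2 0 (r • S.ι S.m)) := by
  refine ⟨fun k => if k = 0 then r • S.m else 0, fun k => ?_, fun k => ?_⟩
  · rcases k with _ | k
    · rw [lp.single_apply_self]; simp
    · rw [lp.single_apply_ne 2 0 _ (Nat.succ_ne_zero k)]; simp
  · rcases k with _ | k
    · simp [S.A_m]
    · simp

variable [CompleteSpace H] [CompleteSpace V]

theorem IsBOf.sub_single {F x : lp (fun _ : ℕ => H) 2} (h : S.IsBOf F x) (r : ℝ) :
    S.IsBOf F (x - lp.single 2 0 (r • S.ι S.m)) := by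
  simpa using h.sub (S.isBOf_single r)

theorem IsBOf.of_sub_single {F x : lp (fun _ : ℕ => H) 2} {r : ℝ}
    (h : S.IsBOf F (x - lp.single 2 0 (r • S.ι S.m))) : S.IsBOf F x := by
  have h1 := (S.isBOf_single r).sub (S.isBOf_single r)
  simpa using h.sub (h1.sub (S.isBOf_single r))

end DirichletPair

/-! ### Choice of the weight and translation between concrete and abstract objects -/

/-- The weight `α = r / (2 (C² + P² + 1) (1 + r²))`, where `r = τ / ε`, is admissible. -/
theorem AdmissibleWeight.of_ratio {P C ε τ : ℝ} (hP : 0 ≤ P) (hε : 0 < ε) (hτ : 0 < τ) :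
    AdmissibleWeight P C ε τ (1 / (2 * (C ^ 2 + P ^ 2 + 1)) * (τ * ε / (ε ^ 2 + τ ^ 2))) := by
  set Q := C ^ 2 + P ^ 2 + 1 with hQ
  have hQ1 : 1 ≤ Q := by nlinarith [sq_nonneg C, sq_nonneg P]
  have hQ0 : 0 < Q := by linarith
  have hr : τ * ε / (ε ^ 2 + τ ^ 2) ≤ 1 / 2 := by
    rw [div_le_div_iff₀ (by positivity) (by positivity)]
    nlinarith [sq_nonneg (τ - ε)]
  have hr0 : 0 ≤ τ * ε / (ε ^ 2 + τ ^ 2) := by positivity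
  have h2 : 1 / (2 * Q) * (τ * ε / (ε ^ 2 + τ ^ 2)) ≤ 1 / (2 * Q) * (1 / 2) :=
    mul_le_mul_of_nonneg_left hr (by positivity)
  refine ⟨hε, hτ, by positivity, ?_, ?_, ?_, ?_⟩
  · refine h2.trans ?_
    rw [div_mul_div_comm, div_le_one (by positivity)]
    linarith
  · refine (mul_le_mul_of_nonneg_right h2 hP).trans ?_
    rw [div_mul_div_comm, div_mul_eq_mul_div, div_le_div_iff₀ (by positivity) (by positivity)]
    nlinarith [sq_nonneg C, sq_nonneg (P - 1)]
  · have e : 2 * (1 / (2 * Q) * (τ * ε / (ε ^ 2 + τ ^ 2))) * C ^ 2 / ε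
        = C ^ 2 * τ / (Q * (ε ^ 2 + τ ^ 2)) := by field_simp
    rw [e, div_le_div_iff₀ (by positivity) hτ]
    have h1 : C ^ 2 ≤ Q := by rw [hQ]; nlinarith [sq_nonneg P]
    have h3 : C ^ 2 * τ ^ 2 ≤ Q * τ ^ 2 := mul_le_mul_of_nonneg_right h1 (sq_nonneg τ)
    nlinarith [mul_nonneg hQ0.le (sq_nonneg ε)]
  · have e : 1 / (2 * Q) * (τ * ε / (ε ^ 2 + τ ^ 2)) * (ε * P ^ 2 / τ ^ 2)
        + 1 / (2 * Q) * (τ * ε / (ε ^ 2 + τ ^ 2)) / ε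
        = (ε ^ 2 * P ^ 2 + τ ^ 2) / (2 * (Q * τ * (ε ^ 2 + τ ^ 2))) := by field_simp
    rw [e, div_le_div_iff₀ (by positivity) (by positivity)]
    have h1 : P ^ 2 ≤ Q := by rw [hQ]; nlinarith [sq_nonneg C]
    have h3 : ε ^ 2 * P ^ 2 + τ ^ 2 ≤ Q * (ε ^ 2 + τ ^ 2) := by
      nlinarith [mul_le_mul_of_nonneg_right h1 (sq_nonneg ε),
        mul_le_mul_of_nonneg_right hQ1 (sq_nonneg τ)]
    nlinarith [mul_le_mul_of_nonneg_right h3 hτ.le]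

open Sobolev

theorem dense_ofSmooth : Dense {v : Sobolev L | ∃ (φ : AddCircle L → ℝ) (hφ : IsSmooth φ),
    v = ofSmooth hφ} := fun v =>
  induction_smooth (p := fun v => v ∈ closure {v : Sobolev L |
    ∃ (φ : AddCircle L → ℝ) (hφ : IsSmooth φ), v = ofSmooth hφ}) isClosed_closure
    (fun φ hφ => subset_closure ⟨φ, hφ, rfl⟩) v

/-- A Dirichlet pair whose operators are `𝓐` and `𝓐⋆`. -/
structure Realizes (Φ : AddCircle L → ℝ) (T₀ : ℝ) (S : DirichletPair (L2 L) (Sobolev L)) :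
    Prop where
  ι_eq : S.ι = emb L
  opA_ae_eq : ∀ (f : AddCircle L → ℝ) (v : Sobolev L), f =ᵐ[volume] emb L v →
    opA Φ T₀ f =ᵐ[volume] S.A v
  opAstar_ae_eq : ∀ (f : AddCircle L → ℝ) (v : Sobolev L), f =ᵐ[volume] emb L v →
    opAstar Φ T₀ f =ᵐ[volume] S.As v

theorem exists_realizes {Φ : AddCircle L → ℝ} (hΦ : MemW2Inf Φ) {T₀ : ℝ} (hT₀ : 0 < T₀) :
    ∃ S : DirichletPair (L2 L) (Sobolev L), Realizes Φ T₀ S ∧ ∀ c₀, 0 < c₀ →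
      ∃ s : ℝ, (memLp_sqrt_rhoInf hΦ T₀ c₀).toLp _ = s • S.ι S.m := by
  obtain ⟨m₀, w₁, w₂, m₁, m₂, h₁, h₂⟩ := id hΦ
  -- With `θ = Φ / (2 T₀)` and `σ = √T₀` the abstract pair becomes `𝓐`, `𝓐⋆`, and `e^{-θ}` is
  -- proportional to `√ρ_∞`.
  set κ := 1 / (2 * T₀) with hκ
  have hσ : 0 < √T₀ := Real.sqrt_pos.2 hT₀
  have hexp : ∀ c₀ x, 0 < c₀ → √(rhoInf Φ T₀ c₀ x) = √c₀ * Real.exp (-(κ * Φ x)) := by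
    intro c₀ x hc
    rw [rhoInf, Real.sqrt_mul hc.le, show -Φ x / T₀ = -(κ * Φ x) + -(κ * Φ x) by
      rw [hκ]; field_simp; ring, Real.exp_add, Real.sqrt_mul_self (Real.exp_nonneg _)]
  have me : MemLp (fun x => Real.exp (-(κ * Φ x))) 2 volume := by
    refine (memLp_sqrt_rhoInf hΦ T₀ 1).ae_eq (Eventually.of_forall fun x => ?_)
    simp only [hexp 1 x one_pos, Real.sqrt_one, one_mul]
  obtain ⟨S, hι, hA, hAs, r, hr⟩ := exists_dirichletPair (m₀.const_mul κ) (m₁.const_mul κ)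
    (m₂.const_mul κ) (h₁.const_mul κ) (h₂.const_mul κ) hσ me
  have hfield := h₁.weakDeriv_ae_eq
  have hc : κ * √T₀ = 1 / (2 * √T₀) := by
    rw [hκ, div_mul_eq_mul_div, div_eq_div_iff (by positivity) (by positivity)]
    linear_combination 2 * Real.mul_self_sqrt hT₀.le
  refine ⟨S, ⟨hι, fun f v hf => ?_, fun f v hf => ?_⟩, fun c₀ hc₀ => ?_⟩
  · have hw := ((hasWeakDeriv v).congr hf.symm (ae_eq_refl _)).weakDeriv_ae_eq
    rw [hA]
    filter_upwards [hfield, hw, hf, Lp.coeFn_smul (√T₀) (der L v + mulOp (m₁.const_mul κ) (emb L v)),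
      Lp.coeFn_add (der L v) (mulOp (m₁.const_mul κ) (emb L v)),
      coeFn_mulOp (m₁.const_mul κ) (emb L v)] with x e1 e2 e3 e4 e5 e6
    rw [e4, Pi.smul_apply, e5, Pi.add_apply, e6, opA, field, e1, e2, e3, smul_eq_mul]
    linear_combination (-(w₁ x * (emb L v) x)) * hc
  · have hw := ((hasWeakDeriv v).congr hf.symm (ae_eq_refl _)).weakDeriv_ae_eq
    rw [hAs]
    filter_upwards [hfield, hw, hf, Lp.coeFn_smul (√T₀) (-der L v + mulOp (m₁.const_mul κ) (emb L v)),
      Lp.coeFn_add (-der L v) (mulOp (m₁.const_mul κ) (emb L v)), Lp.coeFn_neg (der L v),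
      coeFn_mulOp (m₁.const_mul κ) (emb L v)] with x e1 e2 e3 e4 e5 e7 e6
    rw [e4, Pi.smul_apply, e5, Pi.add_apply, e6, e7, Pi.neg_apply, opAstar, field, e1, e2, e3,
      smul_eq_mul]
    linear_combination (-(w₁ x * (emb L v) x)) * hc
  · have hr0 : r ≠ 0 := by
      rintro rfl
      have := S.norm_m
      rw [hr, zero_smul, norm_zero] at this
      exact zero_ne_one this
    refine ⟨√c₀ * r⁻¹, ?_⟩
    rw [hr, smul_smul, inv_mul_cancel_right₀ hr0]
    refine Lp.ext ?_
    filter_upwards [(memLp_sqrt_rhoInf hΦ T₀ c₀).coeFn_toLp, me.coeFn_toLp,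
      Lp.coeFn_smul (√c₀) (me.toLp _)] with x e1 e2 e3
    rw [e1, e3, Pi.smul_apply, e2, hexp c₀ x hc₀, smul_eq_mul]

theorem integral_sq_eq_norm {f : AddCircle L → ℝ} {u : L2 L} (h : f =ᵐ[volume] u) :
    ∫ x, f x ^ 2 = ‖u‖ ^ 2 := by
  rw [← real_inner_self_eq_norm_sq, inner_eq_integral]
  exact integral_congr_ae (h.mono fun x hx => by simp only [hx, sq])

namespace Realizes

variable {Φ : AddCircle L → ℝ} {T₀ : ℝ} {S : DirichletPair (L2 L) (Sobolev L)}

theorem opB_ae_eq (hS : Realizes Φ T₀ S) (k : ℕ) {f : AddCircle L → ℝ} {v : Sobolev L}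
    (hf : f =ᵐ[volume] emb L v) : opB Φ T₀ k f =ᵐ[volume] S.B k v := by
  rcases k with _ | k
  · exact hS.opA_ae_eq f v hf
  · exact hS.opAstar_ae_eq f v hf

theorem exists_isBOf (hS : Realizes Φ T₀ S) {D : State L} (hD : FiniteB Φ T₀ D) :
    ∃ F, S.IsBOf F D ∧ ‖F‖ = normB Φ T₀ D := by
  have hX : ∀ k, ∃ v : Sobolev L, emb L v = D k := fun k => by
    obtain ⟨_, w, mw, hw⟩ := hD.1 k
    obtain ⟨v, hv, _⟩ := exists_of_hasWeakDeriv (u := D k) (w := mw.toLp w)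
      (hw.congr (ae_eq_refl _) mw.coeFn_toLp.symm)
    exact ⟨v, hv⟩
  choose X hX using hX
  have hn : ∀ k, ∫ x, (opB Φ T₀ k (coeff D k) x) ^ 2 = ‖S.B k (X k)‖ ^ 2 := fun k =>
    integral_sq_eq_norm (hS.opB_ae_eq k (by rw [hX]; rfl))
  have hs := hD.2
  simp only [hn] at hs
  have hF : Memℓp (fun k => S.B k (X k)) 2 := memℓp_gen (by simpa using hs)
  refine ⟨⟨_, hF⟩, ⟨X, fun k => by rw [hS.ι_eq, hX], fun k => rfl⟩, ?_⟩
  rw [normB]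
  simp only [hn]
  rw [(hasSum_norm_sq (⟨_, hF⟩ : lp (fun _ : ℕ => L2 L) 2)).tsum_eq, Real.sqrt_sq (norm_nonneg _)]

theorem finiteB (hS : Realizes Φ T₀ S) {F D : State L} (h : S.IsBOf F D) :
    FiniteB Φ T₀ D ∧ normB Φ T₀ D = ‖F‖ := by
  obtain ⟨X, hX, hF⟩ := h
  rw [hS.ι_eq] at hX
  have hn : ∀ k, ∫ x, (opB Φ T₀ k (coeff D k) x) ^ 2 = ‖F k‖ ^ 2 := fun k => by
    rw [hF]
    exact integral_sq_eq_norm (hS.opB_ae_eq k (by rw [hX]; rfl))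
  refine ⟨⟨fun k => ⟨Lp.memLp _, _, Lp.memLp (der L (X k)), ?_⟩, ?_⟩, ?_⟩
  · have := hasWeakDeriv (X k)
    rwa [hX] at this
  · simp only [hn]
    exact (hasSum_norm_sq F).summable
  · rw [normB]
    simp only [hn]
    rw [(hasSum_norm_sq F).tsum_eq, Real.sqrt_sq (norm_nonneg _)]

theorem hasDerivWithinAt (hS : Realizes Φ T₀ S) {ε τ : ℝ} {D₀ : State L} {D : ℝ → State L}
    (hD : IsSolution Φ T₀ ε τ D₀ D) (k : ℕ) {φ : AddCircle L → ℝ} (hφ : IsSmooth φ) {t : ℝ}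
    (ht : 0 ≤ t) : HasDerivWithinAt (fun s => ⟪D s k, S.ι (ofSmooth hφ)⟫_ℝ)
      (S.generator ε τ k (ofSmooth hφ) (D t)) (Ici 0) t := by
  have hφe : φ =ᵐ[volume] emb L (ofSmooth hφ) := (hφ.memLp 2).coeFn_toLp.symm
  have key : ∀ (j : ℕ) (s : ℝ) (f : AddCircle L → ℝ) (u : L2 L), f =ᵐ[volume] u →
      ∫ x, coeff (D s) j x * f x = ⟪D s j, u⟫_ℝ := fun j s f u hf => by
    rw [inner_eq_integral]
    exact integral_congr_ae (hf.mono fun x hx => by simp only [coeff, hx])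
  have h := hD.equation k φ hφ t ht
  rw [S.generator_apply, hS.ι_eq]
  simp only [key _ _ _ _ hφe, key _ _ _ _ (hS.opA_ae_eq φ _ hφe),
    key _ _ _ _ (hS.opAstar_ae_eq φ _ hφe)] at h
  exact h

theorem isWeakSolution (hS : Realizes Φ T₀ S) {ε τ : ℝ} {D₀ : State L} {D : ℝ → State L}
    (hD : IsSolution Φ T₀ ε τ D₀ D) (r : ℝ) :
    S.IsWeakSolution ε τ fun t => D t - lp.single 2 0 (r • S.ι S.m) := by
  refine S.isWeakSolution_sub_single hD.continuousOn dense_ofSmooth ?_ r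
  rintro k _ ⟨φ, hφ, rfl⟩ t ht
  exact hS.hasDerivWithinAt hD k hφ ht

end Realizes

/-- The mass condition says that `D₀ 0` and `√ρ_∞` have the same pairing with `√ρ_∞`. This
orthogonality is what gives access to the Poincaré inequality. -/
theorem inner_sub_equilibrium {Φ : AddCircle L → ℝ} (hΦ : MemW2Inf Φ) {T₀ c₀ : ℝ} (hc₀ : 0 < c₀)
    {D₀ : State L} {m : L2 L} {s : ℝ} (hs : (memLp_sqrt_rhoInf hΦ T₀ c₀).toLp _ = s • m)
    (hmass : ∫ x, rhoInf Φ T₀ c₀ x = ∫ x, coeff D₀ 0 x * √(rhoInf Φ T₀ c₀ x)) :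
    ⟪(D₀ - lp.single 2 0 (s • m) : State L) 0, m⟫_ℝ = 0 := by
  have hpos : ∀ x, 0 < rhoInf Φ T₀ c₀ x := fun x => mul_pos hc₀ (Real.exp_pos _)
  have hR := norm_toLp_pos (memLp_sqrt_rhoInf hΦ T₀ c₀) fun x => Real.sqrt_pos.2 (hpos x)
  have hs0 : s ≠ 0 := by
    rintro rfl
    rw [hs, zero_smul, norm_zero] at hR
    exact lt_irrefl _ hR
  have h1 : ⟪D₀ 0, s • m⟫_ℝ = ∫ x, rhoInf Φ T₀ c₀ x := by
    rw [← hs, inner_toLp, hmass]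
    rfl
  have h2 : ⟪s • m, s • m⟫_ℝ = ∫ x, rhoInf Φ T₀ c₀ x := by
    rw [← hs, inner_toLp]
    refine integral_congr_ae ?_
    filter_upwards [(memLp_sqrt_rhoInf hΦ T₀ c₀).coeFn_toLp] with x hx
    rw [hx, Real.mul_self_sqrt (hpos x).le]
  have h3 : ⟪D₀ 0 - s • m, s • m⟫_ℝ = 0 := by rw [inner_sub_left, h1, h2, sub_self]
  rw [inner_smul_right] at h3
  rw [lp.coeFn_sub, Pi.sub_apply, lp.single_apply_self]
  exact (mul_eq_zero.1 h3).resolve_left hs0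

end VFP

/-! ### The decay theorem -/

theorem theorem2p1 {L : ℝ} [Fact (0 < L)] (Φ : AddCircle L → ℝ) (hΦ : VFP.MemW2Inf Φ)
    (T₀ : ℝ) (hT₀ : 0 < T₀) :
    ∃ C : ℝ, 0 < C ∧
      ∀ (τbar : ℝ) (τ : ℝ → ℝ), 0 < τbar → (∀ ε, 0 < ε → 0 < τ ε) →
        (∀ ε, 0 < ε → τ ε / ε ≤ τbar) →
      ∀ (ε : ℝ), 0 < ε →
      ∀ (c₀ : ℝ) (D₀ : VFP.State L) (D : ℝ → VFP.State L), 0 < c₀ →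
        -- conservation of mass fixes the constant `c₀` of the equilibrium
        (∫ x, VFP.rhoInf Φ T₀ c₀ x = ∫ x, VFP.coeff D₀ 0 x * √(VFP.rhoInf Φ T₀ c₀ x)) →
        VFP.IsSolution Φ T₀ ε (τ ε) D₀ D →
        (∀ t : ℝ, 0 ≤ t →
          ‖D t - VFP.equilibrium hΦ T₀ c₀‖ ≤
            √3 * ‖D₀ - VFP.equilibrium hΦ T₀ c₀‖ *
              Real.exp (-(τ ε / ε ^ 2 * (1 / (C * (τbar ^ 2 + 1))) * t))) ∧
        (VFP.FiniteB Φ T₀ D₀ → ∀ t : ℝ, 0 ≤ t →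
          VFP.FiniteB Φ T₀ (D t) ∧
          VFP.normB Φ T₀ (D t) ≤
            √3 * (C * (τbar + 1) * ‖D₀ - VFP.equilibrium hΦ T₀ c₀‖ + VFP.normB Φ T₀ D₀) *
              Real.exp (-(τ ε / ε ^ 2 * (1 / (C * (τbar ^ 2 + 1))) * t))) := by
  obtain ⟨S, hS, hm⟩ := VFP.exists_realizes hΦ hT₀
  set Q := (1 + S.b * S.P) ^ 2 + S.P ^ 2 + 1 with hQ
  have hQ0 : 0 < Q := by positivity
  -- The decay rate `α / (4 ε)` equals `τ / (8 Q (ε² + τ²))`, which gives `8 Q`; the coefficient `2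
  -- ‖c‖ τ / ε` in the derivative estimate gives `2 ‖c‖`.
  refine ⟨8 * Q + 2 * ‖S.c‖, by positivity, ?_⟩
  set C := 8 * Q + 2 * ‖S.c‖ with hC
  have hC0 : 0 < C := by positivity
  intro τbar τ hτbar hτ hτle ε hε c₀ D₀ D hc₀ hmass hD
  obtain ⟨s, hs⟩ := hm c₀ hc₀
  have heq : VFP.equilibrium hΦ T₀ c₀ = lp.single 2 0 (s • S.ι S.m) := by
    rw [VFP.equilibrium, hs]
  have hτε := hτ ε hε
  have hα := VFP.AdmissibleWeight.of_ratio (C := 1 + S.b * S.P) S.P_nonneg hε hτε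
  rw [← hQ] at hα
  have hX := hS.isWeakSolution hD s
  have h0 := VFP.inner_sub_equilibrium hΦ hc₀ hs hmass
  have hrate : ∀ t : ℝ, 0 ≤ t →
      Real.exp (-(1 / (2 * Q) * (τ ε * ε / (ε ^ 2 + τ ε ^ 2)) / (4 * ε) * t))
        ≤ Real.exp (-(τ ε / ε ^ 2 * (1 / (C * (τbar ^ 2 + 1))) * t)) := by
    intro t ht
    refine Real.exp_le_exp.2 (neg_le_neg (mul_le_mul_of_nonneg_right ?_ ht))
    have h1 : τ ε ≤ τbar * ε := (div_le_iff₀ hε).1 (hτle ε hε)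
    have h2 : 8 * Q * (ε ^ 2 + τ ε ^ 2) ≤ C * (τbar ^ 2 + 1) * ε ^ 2 := by
      have h3 : τ ε ^ 2 ≤ (τbar * ε) ^ 2 := pow_le_pow_left₀ hτε.le h1 2
      have h4 : 8 * Q ≤ C := by rw [hC]; linarith [norm_nonneg S.c]
      calc 8 * Q * (ε ^ 2 + τ ε ^ 2) ≤ C * (ε ^ 2 + (τbar * ε) ^ 2) := by gcongr
        _ = C * (τbar ^ 2 + 1) * ε ^ 2 := by ring
    have e1 : 1 / (2 * Q) * (τ ε * ε / (ε ^ 2 + τ ε ^ 2)) / (4 * ε)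
        = τ ε / (8 * Q * (ε ^ 2 + τ ε ^ 2)) := by field_simp; ring
    have e2 : τ ε / ε ^ 2 * (1 / (C * (τbar ^ 2 + 1))) = τ ε / (C * (τbar ^ 2 + 1) * ε ^ 2) := by
      field_simp
    rw [e1, e2]
    exact div_le_div_of_nonneg_left hτε.le (by positivity) h2
  rw [← hD.initial] at h0
  rw [heq]
  refine ⟨fun t ht => ?_, fun hF t ht => ?_⟩
  · have := hX.norm_le hα h0 ht
    rw [hD.initial] at this
    exact this.trans (mul_le_mul_of_nonneg_left (hrate t ht) (by positivity))
  · obtain ⟨F₀, hF₀, hn₀⟩ := hS.exists_isBOf hF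
    rw [← hD.initial] at hF₀
    obtain ⟨F, hFt, hle⟩ := hX.norm_B_le hα h0 (hF₀.sub_single S s) ht
    obtain ⟨hfin, hnorm⟩ := hS.finiteB (hFt.of_sub_single S)
    refine ⟨hfin, ?_⟩
    rw [hnorm, ← hn₀]
    refine hle.trans ?_
    rw [hD.initial]
    have h5 : 2 * ‖S.c‖ * (τ ε / ε) ≤ C * (τbar + 1) := by
      have h4 : 2 * ‖S.c‖ ≤ C := by rw [hC]; linarith
      exact mul_le_mul h4 ((hτle ε hε).trans (by linarith)) (by positivity) hC0.le
    have h6 := hrate t ht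
    gcongr
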